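/- A finite temporal digraph $\mathcal G=(G,\gamma,\lambda)$ consists of a finite digraph $G$ (loops and multiple edges allowed), a finite set $\gamma(v)\subseteq\mathbb N$ of times for each vertex $v$, and a finite set $\lambda(e)\subseteq\mathbb N\times\mathbb N$ for each edge $e=uv$, such that $t\le t'$, $t\in\gamma(u)$ and $t'\in\gamma(v)$ whenever $(t,t')\in\lambda(e)$. Its temporal vertices are the pairs in $V_T=\{(v,t): t\in\gamma(v)\}$, and its temporal edges are the triples $(e,t,t')$ with $(t,t')\in\lambda(e)$; for $e=uv$ such a temporal edge goes from $(u,t)$ to $(v,t')$. A temporal walk is a sequence that moves between temporal vertices by traversing temporal edges or by waiting, that is, by going from $(v,t)$ to $(v,t+1)$ when both are temporal vertices; the sequence of a single temporal vertex is a temporal walk. A temporal subdigraph of $\mathcal G$ is a temporal digraph $(G',\gamma',\lambda')$ with $G'\subseteq G$, $\gamma'(v)\subseteq\gamma(v)$ for each vertex $v$ of $G'$ and $\lambda'(e)\subseteq\lambda(e)$ for each edge $e$ of $G'$. For $R\subseteq V_T$, a temporal subdigraph $\mathcal B$ of $\mathcal G$ is a temporal-spanning branching of $\mathcal G$ with root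 $R$ if for every $x\in V_T$ there is exactly one temporal walk in $\mathcal B$ that starts in $R$ and arrives at $x$. Temporal subdigraphs are temporal-edge-disjoint if no two of them have a common temporal edge. **Theorem.** There is a deterministic polynomial-time algorithm that, given a finite temporal digraph $\mathcal G$ and sets $R_1,\dots,R_k\subseteq V_T$, finds $k$ pairwise temporal-edge-disjoint temporal-spanning branchings $\mathcal B_1,\dots,\mathcal B_k$ of $\mathcal G$ with roots $R_1,\dots,R_k$, respectively, if such branchings exist, and reports that there are none otherwise. The sets $\gamma(v)$, $\lambda(e)$ and $R_i$ are given as explicit lists, numbers are written in binary, and $k$ is part of the input; the running time, the number of steps on a random access machine with addition and subtraction, is bounded by a fixed polynomial in the length of the input. -/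

import Mathlib

/-! ### Temporal digraphs -/

/-- A finite temporal digraph `(G, γ, λ)`.  The base digraph `G` has vertex set `V` and edge set
`E`; loops and multiple edges are allowed.  `act v` is `γ(v)`, the set of times at which `v` is
active, and `app e` is `λ(e)`, the set of pairs `(t, t')` of a departure and an arrival time. -/
structure TemporalDigraph (V E : Type*) where
  src : E → V
  tgt : E → V
  act : V → Finset ℕ
  app : E → Finset (ℕ × ℕ)
  le_of_app : ∀ e, ∀ p ∈ app e, p.1 ≤ p.2
  src_act : ∀ e, ∀ p ∈ app e, p.1 ∈ act (src e)
  tgt_act : ∀ e, ∀ p ∈ app e, p.2 ∈ act (tgt e)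

/-- The set `V_T` of temporal vertices `(v, t)`, `t ∈ γ(v)`. -/
def TemporalDigraph.tverts {V E : Type*} (G : TemporalDigraph V E) : Set (V × ℕ) :=
  {x | x.2 ∈ G.act x.1}

/-- A temporal subdigraph `(G', γ', λ')` of `G`: `G' ⊆ G` is given by `verts` and `edges`, and
`γ' ⊆ γ`, `λ' ⊆ λ` hold pointwise (the functions are read as relations).  `γ'` and `λ'` are only
defined on `V(G')` and `E(G')`; here they take the value `∅` elsewhere. -/
structure TemporalSubdigraph {V E : Type*} (G : TemporalDigraph V E) where
  verts : Set V
  edges : Set E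
  act : V → Finset ℕ
  app : E → Finset (ℕ × ℕ)
  src_mem : ∀ e ∈ edges, G.src e ∈ verts
  tgt_mem : ∀ e ∈ edges, G.tgt e ∈ verts
  act_subset : ∀ v, act v ⊆ G.act v
  app_subset : ∀ e, app e ⊆ G.app e
  act_outside : ∀ v, v ∉ verts → act v = ∅
  app_outside : ∀ e, e ∉ edges → app e = ∅
  src_act : ∀ e, ∀ p ∈ app e, p.1 ∈ act (G.src e)
  tgt_act : ∀ e, ∀ p ∈ app e, p.2 ∈ act (G.tgt e)

/-- A step of a temporal walk: wait for one time unit, or traverse the temporal edge that is the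
appearance `(t, t')` of the edge `e`. -/
inductive TemporalStep (E : Type*) where
  | wait : TemporalStep E
  | traverse (e : E) (t t' : ℕ) : TemporalStep E

/-- `B.IsWalk a l b`: starting at the temporal vertex `a` and following the steps `l` is a temporal
walk of `B` that arrives at `b`.  Waiting goes from `(v, t)` to `(v, t + 1)`, both of which have to
be temporal vertices of `B`.  The sequence of temporal vertices and temporal edges of the walk and
the pair `(a, l)` determine each other. -/
def TemporalSubdigraph.IsWalk {V E : Type*} {G : TemporalDigraph V E} (B : TemporalSubdigraph G) :
    V × ℕ → List (TemporalStep E) → V × ℕ → Prop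
  | a, [], b => a.2 ∈ B.act a.1 ∧ a = b
  | a, TemporalStep.wait :: l, b => a.2 ∈ B.act a.1 ∧ B.IsWalk (a.1, a.2 + 1) l b
  | a, TemporalStep.traverse e t t' :: l, b =>
      a = (G.src e, t) ∧ (t, t') ∈ B.app e ∧ B.IsWalk (G.tgt e, t') l b

/-- `B` is a temporal-spanning branching of `G` with root `R`: for every temporal vertex `x` of `G`
there is exactly one temporal walk in `B` that starts in `R` and arrives at `x`. -/
def TemporalSubdigraph.IsTemporalSpanningBranching {V E : Type*} {G : TemporalDigraph V E}
    (B : TemporalSubdigraph G) (R : Set (V × ℕ)) : Prop :=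
  ∀ x ∈ G.tverts, ∃! w : (V × ℕ) × List (TemporalStep E), w.1 ∈ R ∧ B.IsWalk w.1 w.2 x

/-- `B 0, …, B (k-1)` are pairwise temporal-edge-disjoint temporal-spanning branchings of `G` with
roots `R 0, …, R (k-1)`, respectively. -/
def IsDisjointBranchings {V E : Type*} (G : TemporalDigraph V E) {k : ℕ}
    (R : Fin k → Finset (V × ℕ)) (B : Fin k → TemporalSubdigraph G) : Prop :=
  (∀ i, (B i).IsTemporalSpanningBranching (R i)) ∧
    ∀ i j, i ≠ j → ∀ e, Disjoint ((B i).app e) ((B j).app e)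

/-! ### Random access machines -/

/-- A program of a random access machine, in structured form.  The machine has variables
`x₀, x₁, …` and arrays `A₀, A₁, …` of unbounded length, all of natural numbers; a program mentions
only finitely many of them.  The arithmetic is addition and truncated subtraction. -/
inductive Ram where
  /-- `x := c` -/
  | const (x c : ℕ)
  /-- `x := y + z` -/
  | add (x y z : ℕ)
  /-- `x := y - z` (truncated at `0`) -/
  | sub (x y z : ℕ)
  /-- `x := A_a[y]` -/
  | load (x a y : ℕ)
  /-- `A_a[x] := y` -/
  | store (a x y : ℕ)
  /-- `P; Q` -/
  | seq (P Q : Ram)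
  /-- `if x ≠ 0 then P else Q` -/
  | ite (x : ℕ) (P Q : Ram)
  /-- `while x ≠ 0 do P` -/
  | loop (x : ℕ) (P : Ram)

namespace Ram

/-- The contents of the variables and of the arrays. -/
structure State where
  var : ℕ → ℕ
  arr : ℕ → ℕ → ℕ

/-- Assign the value `c` to the variable `x`. -/
def State.setVar (s : State) (x c : ℕ) : State :=
  { s with var := Function.update s.var x c }

/-- Assign the value `c` to the cell `A_a[i]`. -/
def State.setArr (s : State) (a i c : ℕ) : State :=
  { s with arr := Function.update s.arr a (Function.update (s.arr a) i c) }

/-- The initial state on the input word `w`: it is stored in `A₀`, its length in `x₀`, and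
everything else is `0`. -/
def State.start (w : List ℕ) : State where
  var := fun x => if x = 0 then w.length else 0
  arr := fun a i => if a = 0 then w.getD i 0 else 0

/-- The output word: the first `x₁` entries of `A₁`. -/
def State.output (s : State) : List ℕ :=
  (List.range (s.var 1)).map (s.arr 1)

/-- `Exec P s n s'`: the program `P`, started in the state `s`, halts after exactly `n` steps in the
state `s'`.  Every elementary instruction and every evaluation of a test takes one step. -/
inductive Exec : Ram → State → ℕ → State → Prop
  | const (x c : ℕ) (s : State) : Exec (const x c) s 1 (s.setVar x c)
  | add (x y z : ℕ) (s : State) : Exec (add x y z) s 1 (s.setVar x (s.var y + s.var z))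
  | sub (x y z : ℕ) (s : State) : Exec (sub x y z) s 1 (s.setVar x (s.var y - s.var z))
  | load (x a y : ℕ) (s : State) : Exec (load x a y) s 1 (s.setVar x (s.arr a (s.var y)))
  | store (a x y : ℕ) (s : State) : Exec (store a x y) s 1 (s.setArr a (s.var x) (s.var y))
  | seq {P Q : Ram} {s s' s'' : State} {m n : ℕ} :
      Exec P s m s' → Exec Q s' n s'' → Exec (seq P Q) s (m + n) s''
  | iteTrue {x : ℕ} {P Q : Ram} {s s' : State} {n : ℕ} :
      s.var x ≠ 0 → Exec P s n s' → Exec (ite x P Q) s (n + 1) s'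
  | iteFalse {x : ℕ} {P Q : Ram} {s s' : State} {n : ℕ} :
      s.var x = 0 → Exec Q s n s' → Exec (ite x P Q) s (n + 1) s'
  | loopDone {x : ℕ} {P : Ram} {s : State} :
      s.var x = 0 → Exec (loop x P) s 1 s
  | loopStep {x : ℕ} {P : Ram} {s s' s'' : State} {m n : ℕ} :
      s.var x ≠ 0 → Exec P s m s' → Exec (loop x P) s' n s'' →
        Exec (loop x P) s (m + n + 1) s''

/-- The size of a word of natural numbers: the total length of their binary representations, each
counted with one separator. -/
def bitSize (w : List ℕ) : ℕ := (w.map fun a => Nat.size a + 1).sum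

/-- The machine is deterministic. -/
theorem Exec.unique {P : Ram} {s s₁ s₂ : State} {m n : ℕ} (h₁ : Exec P s m s₁)
    (h₂ : Exec P s n s₂) : m = n ∧ s₁ = s₂ := by
  induction h₁ generalizing n s₂ with
  | const | add | sub | load | store => cases h₂; exact ⟨rfl, rfl⟩
  | seq _ _ ih ih' =>
    cases h₂ with
    | seq a b =>
      obtain ⟨rfl, rfl⟩ := ih a
      obtain ⟨rfl, rfl⟩ := ih' b
      exact ⟨rfl, rfl⟩
  | iteTrue h _ ih =>
    cases h₂ with
    | iteTrue _ a => obtain ⟨rfl, rfl⟩ := ih a; exact ⟨rfl, rfl⟩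
    | iteFalse h' _ => exact absurd h' h
  | iteFalse h _ ih =>
    cases h₂ with
    | iteTrue h' _ => exact absurd h h'
    | iteFalse _ a => obtain ⟨rfl, rfl⟩ := ih a; exact ⟨rfl, rfl⟩
  | loopDone h =>
    cases h₂ with
    | loopDone => exact ⟨rfl, rfl⟩
    | loopStep h' _ _ => exact absurd h h'
  | loopStep h _ _ ih ih' =>
    cases h₂ with
    | loopDone h' => exact absurd h' h
    | loopStep _ a b =>
      obtain ⟨rfl, rfl⟩ := ih a
      obtain ⟨rfl, rfl⟩ := ih' b
      exact ⟨rfl, rfl⟩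

end Ram

/-! ### Instances and solutions as words -/

/-- `l` lists the elements of `S`, each once, in an arbitrary order. -/
def Enumerates {α : Type*} (l : List α) (S : Finset α) : Prop :=
  l.Nodup ∧ ∀ x, x ∈ l ↔ x ∈ S

/-- A list is written as its length followed by its elements. -/
def encodeList {α : Type*} (f : α → List ℕ) (l : List α) : List ℕ :=
  l.length :: l.flatMap f

/-- The word `w` describes the temporal digraph `G` and the root sets `R 0, …, R (k-1)`: it consists
of `n`, `m`, `k`, then for each vertex `v` a list of `γ(v)`, then for each edge `e` its source, its
target and a list of `λ(e)`, and then for each `i` a list of `R i`. -/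
def EncodesInstance {n m k : ℕ} (G : TemporalDigraph (Fin n) (Fin m))
    (R : Fin k → Finset (Fin n × ℕ)) (w : List ℕ) : Prop :=
  ∃ (g : Fin n → List ℕ) (l : Fin m → List (ℕ × ℕ)) (r : Fin k → List (Fin n × ℕ)),
    (∀ v, Enumerates (g v) (G.act v)) ∧ (∀ e, Enumerates (l e) (G.app e)) ∧
    (∀ i, Enumerates (r i) (R i)) ∧
    w = [n, m, k] ++
      (List.finRange n).flatMap (fun v => encodeList (fun t => [t]) (g v)) ++
      (List.finRange m).flatMap (fun e =>
        [(G.src e : ℕ), (G.tgt e : ℕ)] ++ encodeList (fun p => [p.1, p.2]) (l e)) ++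
      (List.finRange k).flatMap (fun i => encodeList (fun x => [(x.1 : ℕ), x.2]) (r i))

/-- The word `o` describes `B 0, …, B (k-1)`: it consists of the number `1` and, for each `i`, a
list of the temporal edges `(e, t, t')` of `B i`.  (A temporal-spanning branching contains all
temporal vertices, so it is described by its temporal edges.) -/
def EncodesBranchings {n m k : ℕ} {G : TemporalDigraph (Fin n) (Fin m)}
    (B : Fin k → TemporalSubdigraph G) (o : List ℕ) : Prop :=
  ∃ d : Fin k → List (Fin m × ℕ × ℕ),
    (∀ i, (d i).Nodup ∧ ∀ e t t', (e, t, t') ∈ d i ↔ (t, t') ∈ (B i).app e) ∧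
    o = [1] ++ (List.finRange k).flatMap (fun i =>
      encodeList (fun x => [(x.1 : ℕ), x.2.1, x.2.2]) (d i))

/-!
A temporal-spanning branching contains all temporal vertices, so it contains all possible waiting
steps.  Hence within a maximal interval of times at which a vertex is active, only the first one,
the *start* of the interval, can be a root or be entered by a temporal edge.  If all roots are
starts, then branchings of the temporal digraph correspond to branchings of the digraph that arises
by contracting each interval to its start and keeping the temporal edges that lead to starts.  The
two directions are `IsTemporalSpanningBranching.exists_entering` and
`isTemporalSpanningBranching_ofEdges`.

In the contracted digraph this is Edmonds' problem of disjoint branchings with given roots, solved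
here by Lovász's greedy proof.  Each branching has a set `S i` of vertices that it has reached; the
*cut condition* says that every nonempty set `X` is entered by at least as many unused arcs as there
are branchings with `S i` disjoint from `X`.  It holds for the roots if there is a solution
(`Contracted.good`), and as long as it holds, some branching can be extended by an arc such that it
still holds (`CutCond.exists_arc`, by submodularity).  So it suffices to try arcs, keeping an arc
whenever the cut condition survives, until all branchings span (`run_growCmd`).

The cut condition itself is tested by a flow argument.  Add to the digraph a node for every
branching, with an arc to each element of `S i`.  The cut condition says that for every vertex `p`
one can send one token from each branching to `p` along arc-disjoint paths.  Tokens are sent one by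
one along paths of the residual digraph, and if a token cannot be sent, then the set of nodes from
which `p` can be reached violates the condition (`run_checkCmd`).

For the running time, the algorithm is written in a small language of expressions with finite sums
and of commands with loops, all of which run over `0, …, K - 1` for a single number `K` that never
changes; here `K` is twice the length of the input word.  A program of this language is compiled to
the random access machine, and the number of steps is at most a polynomial in `K` that is read off
from the program (`Cmd.comp_runs`).  The temporal vertices, the temporal edges and the elements of
the root sets are addressed by their positions in the input word, and the branchings by colours
`L, …, 2 L - 1`, where `L` is the length of that word.

The variable 0 holds `K`, the variable 2 holds `L`, and the variables 3, 4 and 5 hold the numbers of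
vertices, edges and branchings.  Array 0 is the input and array 1 the output.  The arrays 3, 5 and 7
mark the positions of the temporal vertices, temporal edges and roots, and the array 8 the starts.
The arrays 9, 10 and 11 contain the head, the tail and the owner of each arc: the owner is `0` if
the arc is unused, the colour of a branching, or `K` if the arc does not belong to the contracted
digraph.  Array 12 is the matrix of the sets `S i`, with a row for each colour, array 13 is the
residual matrix, and array 14 is used for labels in the search for a path.
-/

open Finset

/-! ### A language of bounded loops -/

namespace LoopLang

open Ram (State Exec)

/-- Expressions over the variables and arrays of a machine state.  The variable `0` holds the
common bound of all sums and loops. -/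
inductive Expr where
  | const (c : ℕ)
  | var (x : ℕ)
  | get (a : ℕ) (e : Expr)
  | add (e f : Expr)
  | sub (e f : Expr)
  | cond (b e f : Expr)
  /-- the sum of the values of `e` for `x = 0, …, K - 1`, where `K` is the variable `0` -/
  | sum (x : ℕ) (e : Expr)

/-- The value of an expression. -/
def Expr.eval : Expr → State → ℕ
  | const c, _ => c
  | var x, s => s.var x
  | get a e, s => s.arr a (e.eval s)
  | add e f, s => e.eval s + f.eval s
  | sub e f, s => e.eval s - f.eval s
  | cond b e f, s => if b.eval s ≠ 0 then e.eval s else f.eval s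
  | sum x e, s => ∑ j ∈ range (s.var 0), e.eval (s.setVar x j)

/-- Commands; a `loop` runs its body for `x = 0, …, K - 1`, where `K` is the variable `0`. -/
inductive Cmd where
  | skip
  | assign (x : ℕ) (e : Expr)
  | store (a : ℕ) (i e : Expr)
  | seq (c d : Cmd)
  | cond (b : Expr) (c d : Cmd)
  | loop (x : ℕ) (c : Cmd)

/-- The state after `n` rounds of a loop over `x` whose body acts by `f`. -/
def rounds (x : ℕ) (f : State → State) (s : State) : ℕ → State
  | 0 => s
  | n + 1 => f ((rounds x f s n).setVar x n)

/-- The state after a command. -/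
def Cmd.run : Cmd → State → State
  | skip, s => s
  | assign x e, s => s.setVar x (e.eval s)
  | store a i e, s => s.setArr a (i.eval s) (e.eval s)
  | seq c d, s => d.run (c.run s)
  | cond b c d, s => if b.eval s ≠ 0 then c.run s else d.run s
  | loop x c, s => rounds x c.run s (s.var 0)

/-! ### Frames -/

/-- The variables that a command may change. -/
def Cmd.vars : Cmd → List ℕ
  | skip => []
  | assign x _ => [x]
  | store _ _ _ => []
  | seq c d => c.vars ++ d.vars
  | cond _ c d => c.vars ++ d.vars
  | loop x c => x :: c.vars

/-- The arrays that a command may change. -/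
def Cmd.arrs : Cmd → List ℕ
  | skip => []
  | assign _ _ => []
  | store a _ _ => [a]
  | seq c d => c.arrs ++ d.arrs
  | cond _ c d => c.arrs ++ d.arrs
  | loop _ c => c.arrs

/-- `s'` differs from `s` only where `c` may write. -/
def Frame (c : Cmd) (s s' : State) : Prop :=
  (∀ x, x ∉ c.vars → s'.var x = s.var x) ∧ ∀ a, a ∉ c.arrs → s'.arr a = s.arr a

@[simp] theorem var_setVar (s : State) (x c y : ℕ) :
    (s.setVar x c).var y = if y = x then c else s.var y := by
  simp [State.setVar, Function.update_apply]

@[simp] theorem arr_setVar (s : State) (x c : ℕ) : (s.setVar x c).arr = s.arr := rfl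

@[simp] theorem var_setArr (s : State) (a i c : ℕ) : (s.setArr a i c).var = s.var := rfl

@[simp] theorem arr_setArr (s : State) (a i c b : ℕ) :
    (s.setArr a i c).arr b = if b = a then Function.update (s.arr a) i c else s.arr b := by
  by_cases h : b = a
  · subst h; simp [State.setArr]
  · simp [State.setArr, h]

theorem frame_rounds {x : ℕ} {c : Cmd} (h : ∀ s, Frame c s (c.run s)) (s : State) (n : ℕ) :
    Frame (Cmd.loop x c) s (rounds x c.run s n) := by
  induction n with
  | zero => exact ⟨fun _ _ => rfl, fun _ _ => rfl⟩
  | succ n ih =>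
    refine ⟨fun y hy => ?_, fun a ha => ?_⟩
    · have h1 := ih.1 y hy
      simp only [Cmd.vars, List.mem_cons, not_or] at hy
      rw [rounds, (h _).1 y hy.2, var_setVar, if_neg hy.1, h1]
    · rw [rounds, (h _).2 a ha, arr_setVar, ih.2 a ha]

theorem frame_run (c : Cmd) (s : State) : Frame c s (c.run s) := by
  induction c generalizing s with
  | skip => exact ⟨fun _ _ => rfl, fun _ _ => rfl⟩
  | assign x e =>
    refine ⟨fun y hy => ?_, fun _ _ => rfl⟩
    simp only [Cmd.vars, List.mem_singleton] at hy
    simp [Cmd.run, hy]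
  | store a i e =>
    refine ⟨fun _ _ => rfl, fun b hb => ?_⟩
    simp only [Cmd.arrs, List.mem_singleton] at hb
    simp [Cmd.run, hb]
  | seq c d ihc ihd =>
    refine ⟨fun y hy => ?_, fun b hb => ?_⟩
    · simp only [Cmd.vars, List.mem_append, not_or] at hy
      rw [Cmd.run, (ihd _).1 y hy.2, (ihc _).1 y hy.1]
    · simp only [Cmd.arrs, List.mem_append, not_or] at hb
      rw [Cmd.run, (ihd _).2 b hb.2, (ihc _).2 b hb.1]
  | cond e c d ihc ihd =>
    refine ⟨fun y hy => ?_, fun b hb => ?_⟩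
    · simp only [Cmd.vars, List.mem_append, not_or] at hy
      rw [Cmd.run]
      split
      · exact (ihc _).1 y hy.1
      · exact (ihd _).1 y hy.2
    · simp only [Cmd.arrs, List.mem_append, not_or] at hb
      rw [Cmd.run]
      split
      · exact (ihc _).2 b hb.1
      · exact (ihd _).2 b hb.2
  | loop x c ih => exact frame_rounds ih s _

/-- Reasoning about a loop by an invariant `I j`, which holds before round `j`.  In the step, all
that the loop does not write is known to be as it was before the loop. -/
theorem run_loop_inv {x : ℕ} {c : Cmd} {s : State} (I : ℕ → State → Prop) (h0 : I 0 s)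
    (hs : ∀ j < s.var 0, ∀ t, Frame (Cmd.loop x c) s t → I j t → I (j + 1) (c.run (t.setVar x j))) :
    I (s.var 0) ((Cmd.loop x c).run s) := by
  suffices h : ∀ j ≤ s.var 0, I j (rounds x c.run s j) from h _ le_rfl
  intro j hj
  induction j with
  | zero => exact h0
  | succ j ih => exact hs j hj _ (frame_rounds (frame_run c) s j) (ih (by omega))

/-! ### Compilation to the random access machine -/

/-- Started in `s`, the program `P` halts within `T` steps in a state that satisfies `Q`. -/
def Runs (P : Ram) (s : State) (T : ℕ) (Q : State → Prop) : Prop :=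
  ∃ N s', Exec P s N s' ∧ N ≤ T ∧ Q s'

theorem Runs.mono {P : Ram} {s : State} {T T' : ℕ} {Q Q' : State → Prop} (h : Runs P s T Q)
    (hT : T ≤ T') (hQ : ∀ t, Q t → Q' t) : Runs P s T' Q' := by
  obtain ⟨N, s', h1, h2, h3⟩ := h
  exact ⟨N, s', h1, h2.trans hT, hQ _ h3⟩

theorem Runs.seq {P P' : Ram} {s : State} {T T' : ℕ} {Q Q' : State → Prop} (h : Runs P s T Q)
    (h' : ∀ t, Q t → Runs P' t T' Q') : Runs (.seq P P') s (T + T') Q' := by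
  obtain ⟨N, t, h1, h2, h3⟩ := h
  obtain ⟨N', t', h1', h2', h3'⟩ := h' t h3
  exact ⟨_, t', .seq h1 h1', by omega, h3'⟩

theorem runs_const {x c : ℕ} {s : State} {Q : State → Prop} (h : Q (s.setVar x c)) :
    Runs (.const x c) s 1 Q := ⟨_, _, .const .., le_rfl, h⟩

theorem runs_add {x y z : ℕ} {s : State} {Q : State → Prop}
    (h : Q (s.setVar x (s.var y + s.var z))) : Runs (.add x y z) s 1 Q :=
  ⟨_, _, .add .., le_rfl, h⟩

theorem runs_sub {x y z : ℕ} {s : State} {Q : State → Prop}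
    (h : Q (s.setVar x (s.var y - s.var z))) : Runs (.sub x y z) s 1 Q :=
  ⟨_, _, .sub .., le_rfl, h⟩

theorem runs_load {x a y : ℕ} {s : State} {Q : State → Prop}
    (h : Q (s.setVar x (s.arr a (s.var y)))) : Runs (.load x a y) s 1 Q :=
  ⟨_, _, .load .., le_rfl, h⟩

theorem runs_store {a x y : ℕ} {s : State} {Q : State → Prop}
    (h : Q (s.setArr a (s.var x) (s.var y))) : Runs (.store a x y) s 1 Q :=
  ⟨_, _, .store .., le_rfl, h⟩

theorem runs_ite {x : ℕ} {P P' : Ram} {s : State} {T T' : ℕ} {Q : State → Prop}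
    (h : s.var x ≠ 0 → Runs P s T Q) (h' : s.var x = 0 → Runs P' s T' Q) :
    Runs (.ite x P P') s (T + T' + 1) Q := by
  by_cases hx : s.var x = 0
  · obtain ⟨N, t, h1, h2, h3⟩ := h' hx
    exact ⟨_, t, .iteFalse hx h1, by omega, h3⟩
  · obtain ⟨N, t, h1, h2, h3⟩ := h hx
    exact ⟨_, t, .iteTrue hx h1, by omega, h3⟩

/-- A loop that is controlled by a counter `x`; the invariant `I j` holds while `j` rounds are
left. -/
theorem runs_loop {x : ℕ} {P : Ram} {T : ℕ} (I : ℕ → State → Prop)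
    (hx : ∀ j s, I j s → s.var x = j) (hs : ∀ j s, I (j + 1) s → Runs P s T (I j)) (j : ℕ)
    (s : State) (h : I j s) : Runs (.loop x P) s (j * (T + 1) + 1) (I 0) := by
  induction j generalizing s with
  | zero => exact ⟨_, s, .loopDone (hx 0 s h), by omega, h⟩
  | succ j ih =>
    obtain ⟨N, t, h1, h2, h3⟩ := hs j s h
    obtain ⟨N', t', h1', h2', h3'⟩ := ih t h3
    refine ⟨_, t', .loopStep (by rw [hx _ _ h]; omega) h1 h1', ?_, h3'⟩
    rw [Nat.succ_mul]
    omega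

/-- All variables are below `B`, and the variable `0` is not bound. -/
def Expr.wf (B : ℕ) : Expr → Bool
  | const _ => true
  | var x => decide (x < B)
  | get _ e => e.wf B
  | add e f => e.wf B && f.wf B
  | sub e f => e.wf B && f.wf B
  | cond b e f => b.wf B && (e.wf B && f.wf B)
  | sum x e => decide (0 < x) && (decide (x < B) && e.wf B)

/-- All variables are below `B`, and the variable `0` is never changed. -/
def Cmd.wf (B : ℕ) : Cmd → Bool
  | skip => true
  | assign x e => decide (0 < x) && (decide (x < B) && e.wf B)
  | store _ i e => i.wf B && e.wf B
  | seq c d => c.wf B && d.wf B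
  | cond b c d => b.wf B && (c.wf B && d.wf B)
  | loop x c => decide (0 < x) && (decide (x < B) && c.wf B)

/-- A program that computes the value of an expression in the variable `b` and uses the variables
from `b` on as scratch space.  The variable bound by a sum is restored at the end. -/
def Expr.comp : Expr → ℕ → Ram
  | const c, b => .const b c
  | var x, b => .seq (.const b 0) (.add b x b)
  | get a e, b => .seq (e.comp b) (.load b a b)
  | add e f, b => .seq (e.comp b) (.seq (f.comp (b + 1)) (.add b b (b + 1)))
  | sub e f, b => .seq (e.comp b) (.seq (f.comp (b + 1)) (.sub b b (b + 1)))
  | cond c e f, b => .seq (c.comp b) (.ite b (e.comp b) (f.comp b))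
  | sum x e, b =>
    .seq (.const b 0) <| .seq (.add (b + 1) 0 b) <| .seq (.add (b + 2) x b) <|
    .seq (.const (b + 3) 1) <| .seq (.const x 0) <|
    .seq (.loop (b + 1) (.seq (e.comp (b + 4)) <| .seq (.add b b (b + 4)) <|
      .seq (.add x x (b + 3)) (.sub (b + 1) (b + 1) (b + 3)))) <|
    .seq (.const x 0) (.add x x (b + 2))

/-- A bound for the running time of `Expr.comp`, in terms of the variable `0`. -/
noncomputable def Expr.cost : Expr → Polynomial ℕ
  | const _ => 1
  | var _ => 2
  | get _ e => e.cost + 1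
  | add e f => e.cost + (f.cost + 1)
  | sub e f => e.cost + (f.cost + 1)
  | cond c e f => c.cost + (e.cost + f.cost + 1)
  | sum _ e => Polynomial.X * (e.cost + 4) + 8

/-- A program for a command; the variables from `b` on are scratch space. -/
def Cmd.comp : Cmd → ℕ → Ram
  | skip, b => .const b 0
  | assign x e, b => .seq (e.comp b) <| .seq (.const (b + 1) 0) (.add x b (b + 1))
  | store a i e, b => .seq (i.comp b) <| .seq (e.comp (b + 1)) (.store a b (b + 1))
  | seq c d, b => .seq (c.comp b) (d.comp b)
  | cond e c d, b => .seq (e.comp b) (.ite b (c.comp b) (d.comp b))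
  | loop x c, b =>
    .seq (.const (b + 1) 0) <| .seq (.add b 0 (b + 1)) <| .seq (.const (b + 2) 1) <|
    .loop b (.seq (.const x 0) <| .seq (.add x x (b + 1)) <| .seq (c.comp (b + 3)) <|
      .seq (.add (b + 1) (b + 1) (b + 2)) (.sub b b (b + 2)))

/-- A bound for the running time of `Cmd.comp`, in terms of the variable `0`. -/
noncomputable def Cmd.cost : Cmd → Polynomial ℕ
  | skip => 1
  | assign _ e => e.cost + 2
  | store _ i e => i.cost + (e.cost + 1)
  | seq c d => c.cost + d.cost
  | cond e c d => e.cost + (c.cost + d.cost + 1)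
  | loop _ c => Polynomial.X * (c.cost + 5) + 4

/-- The machine state `t` represents `s`: it may differ from `s` in the scratch variables only. -/
def Agree (B : ℕ) (s t : State) : Prop := (∀ x < B, t.var x = s.var x) ∧ t.arr = s.arr

theorem Expr.comp_runs {B : ℕ} (e : Expr) (hB : 0 < B) : ∀ (b : ℕ) (s t : State),
    e.wf B = true → B ≤ b → Agree B s t →
    Runs (e.comp b) t (e.cost.eval (s.var 0))
      (fun t' => t'.arr = t.arr ∧ (∀ y < b, t'.var y = t.var y) ∧ t'.var b = e.eval s) := by
  induction e with
  | const c =>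
    intro b s t _ hb h
    simp only [cost, Polynomial.eval_one]
    refine runs_const ⟨rfl, fun y hy => ?_, ?_⟩
    · simp [hy.ne]
    · simp [eval]
  | var x =>
    intro b s t hw hb h
    simp only [wf, decide_eq_true_eq] at hw
    refine (Runs.seq (runs_const rfl) (T' := 1) ?_).mono (by simp [cost]) (fun _ => id)
    rintro _ rfl
    refine runs_add ⟨rfl, fun y hy => ?_, ?_⟩
    · simp [hy.ne]
    · simp [eval, h.1 x hw, (hw.trans_le hb).ne]
  | get a e ih =>
    intro b s t hw hb h
    refine (Runs.seq (ih b s t hw hb h) (T' := 1) ?_).mono (by simp [cost]) (fun _ => id)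
    rintro u ⟨h1, h2, h3⟩
    refine runs_load ⟨h1, fun y hy => ?_, ?_⟩
    · simp [hy.ne, h2 y hy]
    · simp [eval, h1, h3, h.2]
  | add e f ihe ihf =>
    intro b s t hw hb h
    simp only [wf, Bool.and_eq_true] at hw
    refine (Runs.seq (ihe b s t hw.1 hb h) ?_).mono (by simp [cost]; rfl) (fun _ => id)
    rintro u ⟨h1, h2, h3⟩
    refine Runs.seq (ihf (b + 1) s u hw.2 (by omega)
      ⟨fun y hy => (h2 y (by omega)).trans (h.1 y hy), h1.trans h.2⟩) (T' := 1) ?_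
    rintro v ⟨h4, h5, h6⟩
    refine runs_add ⟨h4.trans h1, fun y hy => ?_, ?_⟩
    · simp [hy.ne, h5 y (by omega), h2 y hy]
    · simp [eval, h5 b (by omega), h3, h6]
  | sub e f ihe ihf =>
    intro b s t hw hb h
    simp only [wf, Bool.and_eq_true] at hw
    refine (Runs.seq (ihe b s t hw.1 hb h) ?_).mono (by simp [cost]; rfl) (fun _ => id)
    rintro u ⟨h1, h2, h3⟩
    refine Runs.seq (ihf (b + 1) s u hw.2 (by omega)
      ⟨fun y hy => (h2 y (by omega)).trans (h.1 y hy), h1.trans h.2⟩) (T' := 1) ?_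
    rintro v ⟨h4, h5, h6⟩
    refine runs_sub ⟨h4.trans h1, fun y hy => ?_, ?_⟩
    · simp [hy.ne, h5 y (by omega), h2 y hy]
    · simp [eval, h5 b (by omega), h3, h6]
  | cond c e f ihc ihe ihf =>
    intro b s t hw hb h
    simp only [wf, Bool.and_eq_true] at hw
    refine (Runs.seq (ihc b s t hw.1 hb h) ?_).mono (by simp [cost]; rfl) (fun _ => id)
    rintro u ⟨h1, h2, h3⟩
    have hu : Agree B s u := ⟨fun y hy => (h2 y (by omega)).trans (h.1 y hy), h1.trans h.2⟩
    refine runs_ite (fun hc => ?_) (fun hc => ?_)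
    · refine (ihe b s u hw.2.1 hb hu).mono le_rfl ?_
      rintro v ⟨h4, h5, h6⟩
      exact ⟨h4.trans h1, fun y hy => (h5 y hy).trans (h2 y hy), by
        rw [h6, eval, if_pos (by rwa [← h3])]⟩
    · refine (ihf b s u hw.2.2 hb hu).mono le_rfl ?_
      rintro v ⟨h4, h5, h6⟩
      exact ⟨h4.trans h1, fun y hy => (h5 y hy).trans (h2 y hy), by
        rw [h6, eval, if_neg (by rw [← h3]; simpa using hc)]⟩
  | sum x e ih =>
    intro b s t hw hb h
    simp only [wf, Bool.and_eq_true, decide_eq_true_eq] at hw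
    obtain ⟨hx0, hxB, hw⟩ := hw
    set K := s.var 0 with hK
    have ht0 : t.var 0 = K := h.1 0 hB
    have hxb : x < b := by omega
    -- `I j` describes the state when `j` of the `K` summands are still to be added
    let I : ℕ → State → Prop := fun j u => j ≤ K ∧ u.arr = t.arr ∧
      (∀ y < b, y ≠ x → u.var y = t.var y) ∧ u.var x = K - j ∧
      u.var b = ∑ i ∈ range (K - j), e.eval (s.setVar x i) ∧ u.var (b + 1) = j ∧
      u.var (b + 2) = t.var x ∧ u.var (b + 3) = 1
    have hloop := runs_loop (x := b + 1) (T := e.cost.eval K + 3)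
      (P := .seq (e.comp (b + 4)) <| .seq (.add b b (b + 4)) <|
        .seq (.add x x (b + 3)) (.sub (b + 1) (b + 1) (b + 3))) I (fun j u hu => hu.2.2.2.2.2.1) (by
        rintro j u ⟨hj, h1, h2, h3, h4, h5, h6, h7⟩
        have hag : Agree B (s.setVar x (K - (j + 1))) u := by
          refine ⟨fun y hy => ?_, h1.trans h.2⟩
          by_cases hyx : y = x
          · subst hyx; simp [h3]
          · simp [hyx, h2 y (by omega) hyx, h.1 y hy]
        have hr := ih (b + 4) _ u hw (by omega) hag
        rw [var_setVar, if_neg hx0.ne] at hr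
        refine Runs.mono (Runs.seq hr (T' := 1 + (1 + 1)) ?_) le_rfl (fun _ => id)
        rintro v ⟨k1, k2, k3⟩
        refine Runs.seq (runs_add rfl) ?_
        rintro _ rfl
        refine Runs.seq (runs_add rfl) ?_
        rintro _ rfl
        refine runs_sub ?_
        have hxb1 : x ≠ b := hxb.ne
        refine ⟨by omega, k1.trans h1, fun y hy hyx => ?_, ?_, ?_, ?_, ?_, ?_⟩
        · have : y ≠ b := hy.ne
          have : y ≠ b + 1 := by omega
          simp [*, k2 y (by omega), h2 y hy hyx]
        · have : x ≠ b + 1 := by omega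
          have : b + 3 ≠ x := by omega
          simp [*, k2 x (by omega), k2 (b + 3) (by omega)]
          omega
        · have : b ≠ x := by omega
          have hKj : K - j = K - (j + 1) + 1 := by omega
          rw [hKj, sum_range_succ, ← h4, ← k3, ← k2 b (by omega)]
          simp [this]
        · have : b + 1 ≠ x := by omega
          have : b + 3 ≠ x := by omega
          simp [*, k2 (b + 1) (by omega), k2 (b + 3) (by omega)]
        · have : b + 2 ≠ x := by omega
          simp [*, k2 (b + 2) (by omega)]
        · have : b + 3 ≠ x := by omega
          simp [*, k2 (b + 3) (by omega)]) K
    refine Runs.mono (T := 1 + (1 + (1 + (1 + (1 + (K * (e.cost.eval K + 4) + 1 + (1 + 1)))))))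
      (Runs.seq (runs_const rfl) ?_) (by simp [cost]; omega) (fun _ => id)
    rintro _ rfl
    refine Runs.seq (runs_add rfl) ?_
    rintro _ rfl
    refine Runs.seq (runs_add rfl) ?_
    rintro _ rfl
    refine Runs.seq (runs_const rfl) ?_
    rintro _ rfl
    refine Runs.seq (runs_const rfl) ?_
    rintro _ rfl
    have hxb1 : x ≠ b := hxb.ne
    have hxb2 : x ≠ b + 1 := by omega
    have hxb3 : x ≠ b + 2 := by omega
    have hxb4 : x ≠ b + 3 := by omega
    have e1 : b ≠ x := hxb1.symm
    have e2 : b + 1 ≠ x := hxb2.symm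
    have e3 : b + 2 ≠ x := hxb3.symm
    have e4 : b + 3 ≠ x := hxb4.symm
    have hb0 : 0 ≠ b := by omega
    refine Runs.seq (hloop _ ⟨le_rfl, rfl, fun y hy hyx => ?_, ?_, ?_, ?_, ?_, ?_⟩) ?_
    · have : y ≠ b := hy.ne
      have : y ≠ b + 1 := by omega
      have : y ≠ b + 2 := by omega
      have : y ≠ b + 3 := by omega
      simp [*]
    · simp
    · simp [*]
    · simp [*]
    · simp [*]
    · simp [*]
    · rintro u ⟨-, h1, h2, h3, h4, h5, h6, h7⟩
      refine Runs.seq (runs_const rfl) ?_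
      rintro _ rfl
      refine runs_add ⟨h1, fun y hy => ?_, ?_⟩
      · by_cases hyx : y = x
        · subst hyx; simp [*]
        · simp [*]
      · simp [*, eval]

theorem Cmd.comp_runs {B : ℕ} (c : Cmd) (hB : 0 < B) : ∀ (b : ℕ) (s t : State),
    c.wf B = true → B ≤ b → Agree B s t →
    Runs (c.comp b) t (c.cost.eval (s.var 0))
      (fun t' => Agree B (c.run s) t' ∧ (c.run s).var 0 = s.var 0 ∧
        ∀ y < b, B ≤ y → t'.var y = t.var y) := by
  induction c with
  | skip =>
    intro b s t _ hb h
    simp only [cost, Polynomial.eval_one]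
    refine runs_const ⟨⟨fun y hy => ?_, h.2⟩, rfl, fun y hy _ => ?_⟩
    · simp [(hy.trans_le hb).ne, h.1 y hy, run]
    · simp [hy.ne]
  | assign x e =>
    intro b s t hw hb h
    simp only [wf, Bool.and_eq_true, decide_eq_true_eq] at hw
    refine Runs.mono (Runs.seq (e.comp_runs hB b s t hw.2.2 hb h) (T' := 1 + 1) ?_)
      (by simp [cost]) (fun _ => id)
    rintro u ⟨h1, h2, h3⟩
    refine Runs.seq (runs_const rfl) ?_
    rintro _ rfl
    refine runs_add ⟨⟨fun y hy => ?_, h1.trans h.2⟩, ?_, fun y hy hy' => ?_⟩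
    · by_cases hyx : y = x
      · subst hyx; simp [run, h3]
      · have : y ≠ b + 1 := by omega
        simp [run, hyx, this, h2 y (by omega), h.1 y hy]
    · simp [run, hw.1.ne]
    · have : y ≠ x := by omega
      have : y ≠ b + 1 := by omega
      simp [*]
  | store a i e =>
    intro b s t hw hb h
    simp only [wf, Bool.and_eq_true] at hw
    refine Runs.mono (Runs.seq (i.comp_runs hB b s t hw.1 hb h) ?_)
      (by simp [cost]; rfl) (fun _ => id)
    rintro u ⟨h1, h2, h3⟩
    refine Runs.seq (e.comp_runs hB (b + 1) s u hw.2 (by omega)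
      ⟨fun y hy => (h2 y (by omega)).trans (h.1 y hy), h1.trans h.2⟩) (T' := 1) ?_
    rintro v ⟨h4, h5, h6⟩
    refine runs_store ⟨⟨fun y hy => ?_, ?_⟩, rfl, fun y hy hy' => ?_⟩
    · simp [run, h5 y (by omega), h2 y (by omega), h.1 y hy]
    · simp [run, State.setArr, h5 b (by omega), h3, h6, h4, h1, h.2]
    · simp [h5 y (by omega), h2 y hy]
  | seq c d ihc ihd =>
    intro b s t hw hb h
    simp only [wf, Bool.and_eq_true] at hw
    refine Runs.mono (Runs.seq (ihc b s t hw.1 hb h) ?_) (by simp [cost]; rfl) (fun _ => id)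
    rintro u ⟨h1, h2, h3⟩
    refine (ihd b _ u hw.2 hb h1).mono (by rw [h2]) ?_
    rintro v ⟨h4, h5, h6⟩
    exact ⟨h4, h5.trans h2, fun y hy hy' => (h6 y hy hy').trans (h3 y hy hy')⟩
  | cond e c d ihc ihd =>
    intro b s t hw hb h
    simp only [wf, Bool.and_eq_true] at hw
    refine Runs.mono (Runs.seq (e.comp_runs hB b s t hw.1 hb h) ?_)
      (by simp [cost]; rfl) (fun _ => id)
    rintro u ⟨h1, h2, h3⟩
    have hu : Agree B s u := ⟨fun y hy => (h2 y (by omega)).trans (h.1 y hy), h1.trans h.2⟩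
    refine runs_ite (fun hc => ?_) (fun hc => ?_)
    · refine (ihc b s u hw.2.1 hb hu).mono le_rfl ?_
      rintro v ⟨h4, h5, h6⟩
      rw [run, if_pos (by rwa [← h3])]
      exact ⟨h4, h5, fun y hy hy' => (h6 y hy hy').trans (h2 y hy)⟩
    · refine (ihd b s u hw.2.2 hb hu).mono le_rfl ?_
      rintro v ⟨h4, h5, h6⟩
      rw [run, if_neg (by rw [← h3]; simpa using hc)]
      exact ⟨h4, h5, fun y hy hy' => (h6 y hy hy').trans (h2 y hy)⟩
  | loop x c ih =>
    intro b s t hw hb h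
    simp only [wf, Bool.and_eq_true, decide_eq_true_eq] at hw
    obtain ⟨hx0, hxB, hw⟩ := hw
    set K := s.var 0 with hK
    have ht0 : t.var 0 = K := h.1 0 hB
    have hxb : x < b := by omega
    let I : ℕ → State → Prop := fun j u => j ≤ K ∧ Agree B (rounds x c.run s (K - j)) u ∧
      (rounds x c.run s (K - j)).var 0 = K ∧ (∀ y < b, B ≤ y → u.var y = t.var y) ∧
      u.var b = j ∧ u.var (b + 1) = K - j ∧ u.var (b + 2) = 1
    have hloop := runs_loop (x := b) (T := c.cost.eval K + 4)
      (P := .seq (.const x 0) <| .seq (.add x x (b + 1)) <| .seq (c.comp (b + 3)) <|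
        .seq (.add (b + 1) (b + 1) (b + 2)) (.sub b b (b + 2))) I (fun j u hu => hu.2.2.2.2.1) (by
        rintro j u ⟨hj, h1, h2, h3, h4, h5, h6⟩
        refine Runs.mono (T := 1 + (1 + (c.cost.eval K + (1 + 1)))) (Runs.seq (runs_const rfl) ?_)
          (by omega) (fun _ => id)
        rintro _ rfl
        refine Runs.seq (runs_add rfl) ?_
        rintro _ rfl
        set s' := (rounds x c.run s (K - (j + 1))).setVar x (K - (j + 1)) with hs'
        have hs0 : s'.var 0 = K := by simp [hs', hx0.ne, h2]
        have hrun : rounds x c.run s (K - j) = c.run s' := by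
          have hKj : K - j = K - (j + 1) + 1 := by omega
          rw [hKj, rounds]
        rw [← hs0]
        have hb1 : b + 1 ≠ x := by omega
        refine Runs.seq (ih (b + 3) s' _ hw (by omega) ⟨fun y hy => ?_, h1.2⟩) ?_
        · by_cases hyx : y = x
          · subst hyx; simp [hs', hb1, h5]
          · simp [hs', hyx, h1.1 y hy]
        rintro v ⟨k1, k2, k3⟩
        refine Runs.seq (runs_add rfl) ?_
        rintro _ rfl
        have a1 := k3 b (by omega) hb
        have a2 := k3 (b + 1) (by omega) (by omega)
        have a3 := k3 (b + 2) (by omega) (by omega)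
        have hb0 : b ≠ x := by omega
        have hb2 : b + 2 ≠ x := by omega
        refine runs_sub ⟨by omega, ?_, ?_, fun y hy hy' => ?_, ?_, ?_, ?_⟩
        · rw [hrun]
          refine ⟨fun y hy => ?_, k1.2⟩
          have : y ≠ b := by omega
          have : y ≠ b + 1 := by omega
          simp [*, k1.1 y hy]
        · rw [hrun, k2, hs0]
        · have : y ≠ b := by omega
          have : y ≠ b + 1 := by omega
          have : y ≠ x := by omega
          simp [*, k3 y (by omega) hy', h3 y hy hy']
        · simp [*]
        · simp [*]
          omega
        · simp [*]) K
    refine Runs.mono (T := 1 + (1 + (1 + (K * (c.cost.eval K + 5) + 1))))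
      (Runs.seq (runs_const rfl) ?_) (by simp [cost]; omega) (fun _ => id)
    rintro _ rfl
    refine Runs.seq (runs_add rfl) ?_
    rintro _ rfl
    refine Runs.seq (runs_const rfl) ?_
    rintro _ rfl
    have hb0 : 0 ≠ b := by omega
    refine (hloop _ ⟨le_rfl, ?_, ?_, fun y hy hy' => ?_, ?_, ?_, ?_⟩).mono le_rfl ?_
    · simp only [Nat.sub_self, rounds]
      refine ⟨fun y hy => ?_, h.2⟩
      have : y ≠ b := by omega
      have : y ≠ b + 1 := by omega
      have : y ≠ b + 2 := by omega
      simp [*, h.1 y hy]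
    · simp [rounds]; rfl
    · have : y ≠ b := by omega
      have : y ≠ b + 1 := by omega
      have : y ≠ b + 2 := by omega
      simp [*]
    · simp [*]
    · simp
    · simp
    · rintro u ⟨-, h1, h2, h3, -⟩
      exact ⟨h1, h2, h3⟩

/-! ### Derived expressions -/

namespace Expr

/-- Every expression is also a test, which holds if the value is not `0`. -/
def Holds (e : Expr) (s : State) : Prop := e.eval s ≠ 0

/-- Negation. -/
def neg (e : Expr) : Expr := sub (const 1) e
/-- Conjunction. -/
def conj (e f : Expr) : Expr := cond e f (const 0)
/-- Disjunction. -/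
def disj (e f : Expr) : Expr := add e f
/-- The test `e < f`. -/
def lt (e f : Expr) : Expr := sub f e
/-- The test `e ≤ f`. -/
def le (e f : Expr) : Expr := neg (sub e f)
/-- The test `e = f`. -/
def eq (e f : Expr) : Expr := neg (add (sub e f) (sub f e))
/-- The test that `e` holds for some `x < K`, where `K` is the variable `0`. -/
def ex (x : ℕ) (e : Expr) : Expr := sum x e
/-- The index of the entry `(x, e)` of a matrix that is stored row by row.  The product `K * x` is
computed as a sum over the variable 49, which is reserved for this purpose. -/
def entry (x : ℕ) (e : Expr) : Expr := add (sum 49 (var x)) e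

@[simp] theorem holds_var {x : ℕ} {s : State} : (var x).Holds s ↔ s.var x ≠ 0 := Iff.rfl

@[simp] theorem holds_get {a : ℕ} {e : Expr} {s : State} :
    (get a e).Holds s ↔ s.arr a (e.eval s) ≠ 0 := Iff.rfl

@[simp] theorem holds_neg {e : Expr} {s : State} : e.neg.Holds s ↔ ¬ e.Holds s := by
  simp only [Holds, neg, eval]; omega

@[simp] theorem holds_conj {e f : Expr} {s : State} :
    (e.conj f).Holds s ↔ e.Holds s ∧ f.Holds s := by
  simp only [Holds, conj, eval]; split_ifs <;> simp_all

@[simp] theorem holds_disj {e f : Expr} {s : State} :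
    (e.disj f).Holds s ↔ e.Holds s ∨ f.Holds s := by
  simp only [Holds, disj, eval]; omega

@[simp] theorem holds_lt {e f : Expr} {s : State} : (e.lt f).Holds s ↔ e.eval s < f.eval s := by
  simp only [Holds, lt, eval]; omega

@[simp] theorem holds_le {e f : Expr} {s : State} : (e.le f).Holds s ↔ e.eval s ≤ f.eval s := by
  simp only [Holds, le, neg, eval]; omega

@[simp] theorem holds_eq {e f : Expr} {s : State} : (e.eq f).Holds s ↔ e.eval s = f.eval s := by
  simp only [Holds, eq, neg, eval]; omega

@[simp] theorem holds_ex {x : ℕ} {e : Expr} {s : State} :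
    (ex x e).Holds s ↔ ∃ j < s.var 0, e.Holds (s.setVar x j) := by
  simp [Holds, ex, eval]

@[simp] theorem eval_const {c : ℕ} {s : State} : (const c).eval s = c := rfl

@[simp] theorem eval_var {x : ℕ} {s : State} : (var x).eval s = s.var x := rfl

@[simp] theorem eval_get {a : ℕ} {e : Expr} {s : State} :
    (get a e).eval s = s.arr a (e.eval s) := rfl

@[simp] theorem eval_add {e f : Expr} {s : State} : (add e f).eval s = e.eval s + f.eval s := rfl

@[simp] theorem eval_sub {e f : Expr} {s : State} : (sub e f).eval s = e.eval s - f.eval s := rfl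

@[simp] theorem eval_sum {x : ℕ} {e : Expr} {s : State} :
    (sum x e).eval s = ∑ j ∈ range (s.var 0), e.eval (s.setVar x j) := rfl

open Classical in
@[simp] theorem eval_cond {b e f : Expr} {s : State} :
    (cond b e f).eval s = if b.Holds s then e.eval s else f.eval s := by
  simp only [eval, Holds]; congr

theorem eval_entry {x : ℕ} {e : Expr} {s : State} (hx : x ≠ 49) :
    (entry x e).eval s = s.var 0 * s.var x + e.eval s := by
  simp [entry, hx]

end Expr

@[simp] theorem run_skip {s : State} : Cmd.skip.run s = s := rfl

@[simp] theorem run_assign {x : ℕ} {e : Expr} {s : State} :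
    (Cmd.assign x e).run s = s.setVar x (e.eval s) := rfl

@[simp] theorem run_store {a : ℕ} {i e : Expr} {s : State} :
    (Cmd.store a i e).run s = s.setArr a (i.eval s) (e.eval s) := rfl

@[simp] theorem run_seq {c d : Cmd} {s : State} : (Cmd.seq c d).run s = d.run (c.run s) := rfl

open Classical in
@[simp] theorem run_cond {b : Expr} {c d : Cmd} {s : State} :
    (Cmd.cond b c d).run s = if b.Holds s then c.run s else d.run s := by
  simp only [Cmd.run, Expr.Holds]; congr

end LoopLang

/-! ### Growing disjoint branchings: the lemma of Lovász -/

namespace Edmonds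

variable {V α ι : Type*} [DecidableEq V]

/-- The arcs of `A` that enter `X`. -/
def entering (tl hd : α → V) (A : Finset α) (X : Finset V) : Finset α :=
  {q ∈ A | hd q ∈ X ∧ tl q ∉ X}

/-- The branchings that have no vertex in `X` so far. -/
def missing (J : Finset ι) (S : ι → Finset V) (X : Finset V) : Finset ι :=
  {i ∈ J | Disjoint (S i) X}

/-- The cut condition for the vertex set `U`: into every set `X` there are at least as many
available arcs as there are branchings that still have to enter `X`. -/
def CutCond (U : Finset V) (J : Finset ι) (S : ι → Finset V) (tl hd : α → V) (A : Finset α) :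
    Prop :=
  ∀ X ⊆ U, X.Nonempty → #(missing J S X) ≤ #(entering tl hd A X)

theorem card_entering_submodular (tl hd : α → V) (A : Finset α) (X Y : Finset V) :
    #(entering tl hd A (X ∩ Y)) + #(entering tl hd A (X ∪ Y)) ≤
      #(entering tl hd A X) + #(entering tl hd A Y) := by
  simp only [entering, card_filter, ← sum_add_distrib]
  refine sum_le_sum fun q _ => ?_
  by_cases h1 : hd q ∈ X <;> by_cases h2 : hd q ∈ Y <;> by_cases h3 : tl q ∈ X <;>
    by_cases h4 : tl q ∈ Y <;> simp [*]

theorem card_missing_pointwise (S X Y : Finset V) :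
    ((if Disjoint S X then 1 else 0) + if Disjoint S Y then 1 else 0) ≤
      (if Disjoint S (X ∩ Y) then 1 else 0) + if Disjoint S (X ∪ Y) then 1 else 0 := by
  by_cases h1 : Disjoint S X
  · have := h1.mono_right (inter_subset_left (s₂ := Y))
    by_cases h2 : Disjoint S Y <;> simp [disjoint_union_right, *]
  · by_cases h2 : Disjoint S Y
    · have := h2.mono_right (inter_subset_right (s₁ := X))
      simp [disjoint_union_right, *]
    · simp [h1, h2]

theorem card_missing_supermodular (J : Finset ι) (S : ι → Finset V) (X Y : Finset V) :
    #(missing J S X) + #(missing J S Y) ≤ #(missing J S (X ∩ Y)) + #(missing J S (X ∪ Y)) := by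
  simp only [missing, card_filter, ← sum_add_distrib]
  exact sum_le_sum fun i _ => card_missing_pointwise _ _ _

theorem card_missing_supermodular_lt {J : Finset ι} {S : ι → Finset V} {X Y : Finset V} {i : ι}
    (hi : i ∈ J) (hX : ¬ Disjoint (S i) X) (hY : ¬ Disjoint (S i) Y)
    (hXY : Disjoint (S i) (X ∩ Y)) :
    #(missing J S X) + #(missing J S Y) < #(missing J S (X ∩ Y)) + #(missing J S (X ∪ Y)) := by
  simp only [missing, card_filter, ← sum_add_distrib]
  refine sum_lt_sum (fun i _ => card_missing_pointwise _ _ _) ⟨i, hi, ?_⟩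
  simp [*]

/-- While the cut condition holds, every branching that does not span yet can be extended by an
arc such that the cut condition is kept.  The dangerous sets are those that are tight, meet `S i`
and are not contained in it; the right arc is found inside a minimal one. -/
theorem CutCond.exists_arc [DecidableEq α] [DecidableEq ι] {U : Finset V} {J : Finset ι}
    {S : ι → Finset V} {tl hd : α → V} {A : Finset α} (h : CutCond U J S tl hd A)
    (hA : ∀ q ∈ A, tl q ∈ U) {i : ι} (hi : i ∈ J) (hS : ¬ U ⊆ S i) :
    ∃ q ∈ A, tl q ∈ S i ∧ hd q ∈ U ∧ hd q ∉ S i ∧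
      CutCond U J (Function.update S i (insert (hd q) (S i))) tl hd (A.erase q) := by
  classical
  let T : Finset (Finset V) := {X ∈ U.powerset | #(missing J S X) = #(entering tl hd A X) ∧
    ¬ Disjoint (S i) X ∧ ¬ X ⊆ S i}
  have hU : U ∈ T := by
    have hne : U.Nonempty := by
      rw [nonempty_iff_ne_empty]
      rintro rfl
      exact hS (empty_subset _)
    have h0 : entering tl hd A U = ∅ :=
      filter_eq_empty_iff.2 fun q hq hq' => hq'.2 (hA q hq)
    have h1 := h U subset_rfl hne
    rw [h0, card_empty, Nat.le_zero, card_eq_zero] at h1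
    refine mem_filter.2 ⟨mem_powerset_self U, by rw [h0, h1, card_empty, card_empty], ?_, hS⟩
    exact fun hd => filter_eq_empty_iff.1 h1 hi hd
  obtain ⟨X, -, hXT, hXmin⟩ := T.exists_le_minimal hU
  obtain ⟨hXU, hXt, hXm, hXS⟩ := mem_filter.1 hXT
  rw [mem_powerset] at hXU
  -- an arc that enters `X \ S i` but not `X`
  obtain ⟨q, hq, hqX⟩ : ∃ q ∈ entering tl hd A (X \ S i), q ∉ entering tl hd A X := by
    apply exists_mem_notMem_of_card_lt_card
    rw [← hXt]
    refine lt_of_lt_of_le (card_lt_card ?_)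
      (h (X \ S i) (sdiff_subset.trans hXU) (sdiff_nonempty.2 hXS))
    refine Finset.ssubset_iff_subset_ne.2 ⟨fun j hj => ?_, fun he => ?_⟩
    · rw [missing, mem_filter] at hj ⊢
      exact ⟨hj.1, hj.2.mono_right sdiff_subset⟩
    · have : i ∈ missing J S (X \ S i) := mem_filter.2 ⟨hi, disjoint_sdiff⟩
      rw [← he] at this
      exact hXm (mem_filter.1 this).2
  obtain ⟨hqA, hqh, hqt⟩ := mem_filter.1 hq
  rw [mem_sdiff] at hqh hqt
  have htX : tl q ∈ X := by
    by_contra hc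
    exact hqX (mem_filter.2 ⟨hqA, hqh.1, hc⟩)
  have htS : tl q ∈ S i := by
    by_contra hc
    exact hqt ⟨htX, hc⟩
  refine ⟨q, hqA, htS, hXU hqh.1, hqh.2, fun Z hZU hZ => ?_⟩
  have hmis : missing J (Function.update S i (insert (hd q) (S i))) Z ⊆ missing J S Z := by
    intro j hj
    rw [missing, mem_filter] at hj ⊢
    refine ⟨hj.1, ?_⟩
    by_cases hji : j = i
    · subst hji
      rw [Function.update_self] at hj
      exact hj.2.mono_left (subset_insert _ _)
    · rw [Function.update_of_ne hji] at hj
      exact hj.2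
  by_cases hqZ : q ∈ entering tl hd A Z
  swap
  · refine (card_le_card hmis).trans ((h Z hZU hZ).trans (card_le_card fun p hp => ?_))
    have hp' := mem_filter.1 hp
    exact mem_filter.2 ⟨mem_erase.2 ⟨fun he => hqZ (he ▸ hp), hp'.1⟩, hp'.2⟩
  obtain ⟨-, hhZ, htZ⟩ := mem_filter.1 hqZ
  have hcard : #(entering tl hd A Z) ≤ #(entering tl hd (A.erase q) Z) + 1 := by
    rw [← card_erase_add_one hqZ]
    refine Nat.add_le_add_right (card_le_card fun p hp => ?_) 1
    obtain ⟨hpq, hp⟩ := mem_erase.1 hp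
    obtain ⟨hpA, hp⟩ := mem_filter.1 hp
    exact mem_filter.2 ⟨mem_erase.2 ⟨hpq, hpA⟩, hp⟩
  by_cases hdZ : Disjoint (S i) Z
  · have hlt : #(missing J (Function.update S i (insert (hd q) (S i))) Z) < #(missing J S Z) := by
      refine card_lt_card (Finset.ssubset_iff_subset_ne.2 ⟨hmis, fun he => ?_⟩)
      have : i ∈ missing J S Z := mem_filter.2 ⟨hi, hdZ⟩
      rw [← he, missing, mem_filter, Function.update_self] at this
      exact disjoint_left.1 this.2 (mem_insert_self _ _) hhZ
    have := h Z hZU hZ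
    omega
  have hle := card_le_card hmis
  by_contra hlt
  have hZt : #(missing J S Z) = #(entering tl hd A Z) := by
    have := h Z hZU hZ
    omega
  have hI := h (X ∩ Z) (inter_subset_left.trans hXU) ⟨hd q, mem_inter.2 ⟨hqh.1, hhZ⟩⟩
  have hUn := h (X ∪ Z) (union_subset hXU hZU) (hZ.mono subset_union_right)
  have hsub := card_entering_submodular tl hd A X Z
  by_cases hdI : Disjoint (S i) (X ∩ Z)
  · have := card_missing_supermodular_lt hi hXm hdZ hdI
    omega
  · have hsup := card_missing_supermodular J S X Z
    have hIT : X ∩ Z ∈ T := by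
      refine mem_filter.2
        ⟨mem_powerset.2 (inter_subset_left.trans hXU), by omega, hdI, fun hc => ?_⟩
      exact hqh.2 (hc (mem_inter.2 ⟨hqh.1, hhZ⟩))
    exact htZ (mem_inter.1 (hXmin hIT inter_subset_left htX)).2

end Edmonds

namespace LoopLang

open Ram (State)

/-! ### Filling arrays -/

theorem entry_inj {K x y x' y' : ℕ} (hy : y < K) (hy' : y' < K) (h : K * x + y = K * x' + y') :
    x = x' ∧ y = y' := by
  have h1 := congrArg (· / K) h
  have h2 := congrArg (· % K) h
  have hK : 0 < K := by omega
  simp only [Nat.mul_add_div hK, Nat.div_eq_of_lt hy, Nat.div_eq_of_lt hy', Nat.mul_add_mod,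
    Nat.mod_eq_of_lt hy, Nat.mod_eq_of_lt hy', add_zero] at h1 h2
  exact ⟨h1, h2⟩

/-- Set the first `K` entries of the array `a` to the values of `e`, where the variable `x` is the
index. -/
def Cmd.fill (a x : ℕ) (e : Expr) : Cmd := .loop x (.store a (.var x) e)

/-- Set the first `K` rows and columns of the matrix `a` to the values of `e`, where the variables
`x` and `y` are the indices. -/
def Cmd.fillMatrix (a x y : ℕ) (e : Expr) : Cmd :=
  .loop x (.loop y (.store a (.entry x (.var y)) e))

theorem run_fill {a x : ℕ} {e : Expr} {s : State} (g : ℕ → ℕ)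
    (hg : ∀ j < s.var 0, ∀ t : State, (∀ y, y ≠ x → t.var y = s.var y) →
      (∀ b, b ≠ a → t.arr b = s.arr b) → t.var x = j → e.eval t = g j) :
    ((Cmd.fill a x e).run s).arr a = fun i => if i < s.var 0 then g i else s.arr a i := by
  refine run_loop_inv (fun j t => t.arr a = fun i => if i < j then g i else s.arr a i)
    (by simp) ?_
  intro j hj t ht ih
  have hv := hg j hj (t.setVar x j) (fun y hy => ?_) (fun b hb => ?_) (by simp)
  · funext i
    simp only [run_store, Expr.eval_var, var_setVar, if_true, arr_setArr, hv, arr_setVar, ih,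
      Function.update_apply]
    by_cases h1 : i = j
    · simp [h1]
    · have : i < j + 1 ↔ i < j := by omega
      simp [h1, this]
  · simpa [hy] using ht.1 y (by simpa [Cmd.vars] using hy)
  · exact ht.2 b (by simpa [Cmd.arrs] using hb)

theorem run_fillMatrix {a x y : ℕ} {e : Expr} {s : State} (hx : 0 < x) (hy : 0 < y)
    (hxy : x ≠ y) (hx49 : x ≠ 49) (g : ℕ → ℕ → ℕ)
    (hg : ∀ i < s.var 0, ∀ j < s.var 0, ∀ t : State,
      (∀ z, z ≠ x → z ≠ y → t.var z = s.var z) →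
      (∀ b, b ≠ a → t.arr b = s.arr b) → t.var x = i → t.var y = j → e.eval t = g i j) :
    ∀ i < s.var 0, ∀ j < s.var 0,
      ((Cmd.fillMatrix a x y e).run s).arr a (s.var 0 * i + j) = g i j := by
  set K := s.var 0 with hK
  refine run_loop_inv (fun m t => ∀ i < m, ∀ j < K, t.arr a (K * i + j) = g i j)
    (by simp) ?_
  intro m hm t ht ih
  have ht0 : (t.setVar x m).var 0 = K := by
    rw [var_setVar, if_neg (by omega), hK]
    exact ht.1 0 (by simp [Cmd.vars]; omega)
  have key := run_loop_inv (x := y) (c := .store a (.entry x (.var y)) e) (s := t.setVar x m)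
    (fun l u => (∀ i < m, ∀ j < K, u.arr a (K * i + j) = g i j) ∧
      ∀ j < l, u.arr a (K * m + j) = g m j) ⟨ih, by simp⟩ (by
    rintro l hl u hu ⟨ih1, ih2⟩
    rw [ht0] at hl
    have hux : u.var x = m := by
      rw [hu.1 x (by simp [Cmd.vars, hxy]), var_setVar, if_pos rfl]
    have hu0 : u.var 0 = K := by
      rw [hu.1 0 (by simp [Cmd.vars]; omega), ht0]
    have hv := hg m hm l hl (u.setVar y l) (fun z hz hz' => ?_) (fun b hb => ?_)
      (by simp [hxy, hux]) (by simp)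
    · have hidx : (Expr.entry x (.var y)).eval (u.setVar y l) = K * m + l := by
        rw [Expr.eval_entry hx49]
        simp [hxy, hux, hu0, hy.ne]
      simp only [run_store, hidx, hv, arr_setArr, if_true, arr_setVar, Function.update_apply]
      refine ⟨fun i hi j hj => ?_, fun j hj => ?_⟩
      · rw [if_neg, ih1 i hi j hj]
        intro h
        exact hi.ne (entry_inj hj hl h).1
      · by_cases hjl : j = l
        · simp [hjl]
        · rw [if_neg (by omega), ih2 j (by omega)]
    · rw [var_setVar, if_neg hz', hu.1 z (by simpa [Cmd.vars] using hz'), var_setVar, if_neg hz,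
        ht.1 z (by simp [Cmd.vars, hz, hz'])]
    · rw [arr_setVar, hu.2 b (by simpa [Cmd.arrs] using hb), arr_setVar,
        ht.2 b (by simpa [Cmd.arrs] using hb)])
  rw [ht0] at key
  intro i hi j hj
  rcases Nat.lt_succ_iff_lt_or_eq.1 hi with h | rfl
  · exact key.1 i h j hj
  · exact key.2 j hj

end LoopLang

/-! ### Sending tokens through a residual matrix -/

namespace Edmonds

open LoopLang (entry_inj)

/-- The capacity that leads into `X` in the network on the nodes `0, …, K - 1` with the capacity
matrix `r`. -/
def cut (K : ℕ) (r : ℕ → ℕ) (X : Finset ℕ) : ℕ :=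
  ∑ p ∈ (range K \ X) ×ˢ X, r (K * p.1 + p.2)

/-- The matrix `r` after one unit of capacity from `a` to `b` has been reversed. -/
def push (K : ℕ) (r : ℕ → ℕ) (a b : ℕ) : ℕ → ℕ :=
  let r' := Function.update r (K * a + b) (r (K * a + b) - 1)
  Function.update r' (K * b + a) (r' (K * b + a) + 1)

/-- Moving a token from `a` to `b` along a unit of capacity, which is reversed thereby, preserves
for every `X` the capacity into `X` plus the number of tokens in `X`. -/
theorem cut_push {K : ℕ} {r : ℕ → ℕ} {a b : ℕ} {X : Finset ℕ} (hX : X ⊆ range K) (ha : a < K)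
    (hb : b < K) (hab : a ≠ b) (hr : r (K * a + b) ≠ 0) :
    cut K (push K r a b) X + (if b ∈ X then 1 else 0) = cut K r X + if a ∈ X then 1 else 0 := by
  have hpt : ∀ p ∈ (range K \ X) ×ˢ X, ((push K r a b (K * p.1 + p.2) : ℕ) : ℤ) =
      (r (K * p.1 + p.2) : ℤ) + ((if p = (b, a) then 1 else 0) - if p = (a, b) then 1 else 0) := by
    rintro ⟨x, y⟩ hp
    have hy : y < K := mem_range.1 (hX (mem_product.1 hp).2)
    have h1 : K * x + y = K * b + a ↔ (x, y) = (b, a) := by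
      refine ⟨fun h => ?_, fun h => ?_⟩
      · obtain ⟨rfl, rfl⟩ := entry_inj hy ha h; rfl
      · obtain ⟨rfl, rfl⟩ := Prod.mk.inj h; rfl
    have h2 : K * x + y = K * a + b ↔ (x, y) = (a, b) := by
      refine ⟨fun h => ?_, fun h => ?_⟩
      · obtain ⟨rfl, rfl⟩ := entry_inj hy hb h; rfl
      · obtain ⟨rfl, rfl⟩ := Prod.mk.inj h; rfl
    have h3 : K * b + a ≠ K * a + b := fun h => hab (entry_inj ha hb h).1.symm
    simp only [push, Function.update_apply, h1, h2, if_neg h3]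
    by_cases h4 : (x, y) = (b, a)
    · have h5 : (x, y) ≠ (a, b) := by
        rw [h4]; intro h; exact hab (Prod.mk.inj h).1.symm
      obtain ⟨rfl, rfl⟩ := Prod.mk.inj h4
      simp [h5]
    · by_cases h5 : (x, y) = (a, b)
      · obtain ⟨rfl, rfl⟩ := Prod.mk.inj h5
        simp only [h4, if_true, if_false]
        omega
      · simp [h4, h5]
  have hsum : ((cut K (push K r a b) X : ℕ) : ℤ) = cut K r X +
      ((if (b, a) ∈ (range K \ X) ×ˢ X then 1 else 0) -
        if (a, b) ∈ (range K \ X) ×ˢ X then 1 else 0) := by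
    rw [cut, Nat.cast_sum, sum_congr rfl hpt, sum_add_distrib, sum_sub_distrib, sum_ite_eq',
      sum_ite_eq', cut, Nat.cast_sum]
  simp only [mem_product, mem_sdiff, mem_range, ha, hb, true_and] at hsum
  by_cases h1 : a ∈ X <;> by_cases h2 : b ∈ X <;> simp [h1, h2] at hsum ⊢ <;> omega

/-- `d` labels the nodes from which `v` can be reached along positive entries of `r`: from every
other labelled node there is such an entry to a node of smaller label. -/
structure Labels (K : ℕ) (r : ℕ → ℕ) (v : ℕ) (d : ℕ → ℕ) : Prop where
  target : d v = 1
  le : ∀ x < K, d x ≤ K + 1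
  descend : ∀ x < K, d x ≠ 0 → x ≠ v →
    ∃ y < K, r (K * x + y) ≠ 0 ∧ d y ≠ 0 ∧ d y < d x
  closed : ∀ x < K, d x = 0 → ∀ y < K, d y ≠ 0 → r (K * x + y) = 0

theorem Labels.cut_eq_zero {K : ℕ} {r : ℕ → ℕ} {v : ℕ} {d : ℕ → ℕ} (h : Labels K r v d) :
    cut K r {x ∈ range K | d x ≠ 0} = 0 := by
  refine sum_eq_zero fun p hp => ?_
  simp only [mem_product, mem_sdiff, mem_range, mem_filter, not_and, not_not] at hp
  exact h.closed _ hp.1.1 (hp.1.2 hp.1.1) _ hp.2.1 hp.2.2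

/-- The number of colours `L, …, K - 1` in `X` from `c` on. -/
def tokens (L c : ℕ) (X : Finset ℕ) : ℕ := #{x ∈ X | L ≤ x ∧ c ≤ x}

theorem tokens_succ {L c : ℕ} (hc : L ≤ c) (X : Finset ℕ) :
    tokens L c X = tokens L (c + 1) X + if c ∈ X then 1 else 0 := by
  have : ({x ∈ X | L ≤ x ∧ c ≤ x} : Finset ℕ) =
      {x ∈ X | L ≤ x ∧ c + 1 ≤ x} ∪ {x ∈ X | x = c} := by
    ext x; simp only [mem_filter, mem_union]; grind
  rw [tokens, this, card_union_of_disjoint, tokens, filter_eq']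
  · split_ifs <;> simp
  · rw [disjoint_left]; intro x; simp only [mem_filter]; omega

/-- The network of the cut condition: the nodes are the vertices `0, …, L - 1` and the colours
`L, …, K - 1`; the colour `c` leads to the vertices `p` with `m (K * c + p) ≠ 0`, and the available
arcs have capacity `1`. -/
structure Network (L K : ℕ) (tl hd own m r : ℕ → ℕ) : Prop where
  le : L ≤ K
  eq_zero : ∀ x < K, ∀ y < K, ¬ (L ≤ x ∧ y < L) → m (K * x + y) = 0
  le_one : ∀ x < K, ∀ y < K, m (K * x + y) ≤ 1
  avail : ∀ q < K, own q = 0 → q < L ∧ tl q < L ∧ hd q < L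
  capacity : ∀ x < K, ∀ y < K,
    r (K * x + y) = m (K * x + y) + #{q ∈ range K | own q = 0 ∧ tl q = x ∧ hd q = y}

/-- The vertices below `L` in the row `c` of a matrix. -/
def row (L K : ℕ) (m : ℕ → ℕ) (c : ℕ) : Finset ℕ := {p ∈ range L | m (K * c + p) ≠ 0}

/-- The arcs below `L` without an owner. -/
def free (L : ℕ) (own : ℕ → ℕ) : Finset ℕ := {q ∈ range L | own q = 0}

theorem Network.cut_add_tokens {L K : ℕ} {tl hd own m r : ℕ → ℕ} (h : Network L K tl hd own m r)
    {X : Finset ℕ} (hX : X ⊆ range K) :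
    cut K r X + tokens L 0 X = #(entering tl hd (free L own) (X ∩ range L)) +
      ∑ c ∈ Ico L K, if c ∈ X then 1 else #(row L K m c ∩ (X ∩ range L)) := by
  have hXK : ∀ x ∈ X, x < K := fun x hx => mem_range.1 (hX hx)
  have h1 : cut K r X = ∑ x ∈ range K \ X, ∑ y ∈ X, m (K * x + y) +
      #(entering tl hd (free L own) (X ∩ range L)) := by
    have hmap : Set.MapsTo (fun q => (tl q, hd q))
        (entering tl hd (free L own) (X ∩ range L) : Finset ℕ)
        ((range K \ X) ×ˢ X : Finset (ℕ × ℕ)) := by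
      intro q hq
      simp only [entering, free, coe_filter, mem_filter, mem_range, mem_inter,
        Set.mem_ofPred_eq] at hq
      have ha := h.avail q (hq.1.1.trans_le h.le) hq.1.2
      simp only [coe_product, Set.mem_prod, mem_coe, mem_sdiff, mem_range]
      exact ⟨⟨ha.2.1.trans_le h.le, fun hc => hq.2.2 ⟨hc, ha.2.1⟩⟩, hq.2.1.1⟩
    rw [card_eq_sum_card_fiberwise hmap, ← sum_product', ← sum_add_distrib, cut]
    refine sum_congr rfl fun p hp => ?_
    simp only [mem_product, mem_sdiff, mem_range] at hp
    rw [h.capacity _ hp.1.1 _ (hXK _ hp.2)]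
    congr 2
    ext q
    simp only [entering, free, mem_filter, mem_range, mem_inter, Prod.ext_iff]
    constructor
    · rintro ⟨hq, ho, e1, e2⟩
      have ha := h.avail q hq ho
      exact ⟨⟨⟨ha.1, ho⟩, ⟨by rw [e2]; exact hp.2, ha.2.2⟩, fun hc => hp.1.2 (e1 ▸ hc.1)⟩, e1, e2⟩
    · rintro ⟨⟨⟨hq, ho⟩, -⟩, e1, e2⟩
      exact ⟨hq.trans_le h.le, ho, e1, e2⟩
  have h2 : ∑ x ∈ range K \ X, ∑ y ∈ X, m (K * x + y) + tokens L 0 X =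
      ∑ c ∈ Ico L K, if c ∈ X then 1 else #(row L K m c ∩ (X ∩ range L)) := by
    have ht : tokens L 0 X = ∑ x ∈ range K, if x ∈ X ∧ L ≤ x then 1 else 0 := by
      rw [tokens, ← card_filter]
      congr 1
      ext x
      simp only [mem_filter, mem_range, Nat.zero_le, and_true]
      exact ⟨fun hx => ⟨hXK x hx.1, hx⟩, fun hx => hx.2⟩
    rw [ht, sdiff_eq_filter, sum_filter, ← sum_add_distrib]
    have hsub : Ico L K ⊆ range K := fun c hc => mem_range.2 (mem_Ico.1 hc).2
    rw [← sum_subset hsub]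
    · refine sum_congr rfl fun c hc => ?_
      rw [mem_Ico] at hc
      by_cases hcX : c ∈ X
      · simp [hcX, hc.1]
      · simp only [hcX, not_false_eq_true, if_true, false_and, if_false, add_zero]
        rw [card_eq_sum_ones, ← sum_subset (inter_subset_right.trans inter_subset_left)]
        · refine sum_congr rfl fun y hy => ?_
          simp only [row, mem_inter, mem_filter, mem_range] at hy
          have := h.le_one c hc.2 y (hXK y hy.2.1)
          omega
        · intro y hy hyn
          simp only [row, mem_inter, mem_filter, mem_range] at hyn
          by_cases hyL : y < L
          · by_contra hne
            exact hyn ⟨⟨hyL, hne⟩, hy, hyL⟩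
          · exact h.eq_zero c hc.2 y (hXK y hy) (by omega)
    · intro x hx hxn
      rw [mem_range] at hx
      rw [mem_Ico] at hxn
      have hxL : ¬ L ≤ x := fun hc => hxn ⟨hc, hx⟩
      simp only [hxL, and_false, if_false, add_zero]
      split_ifs
      · rfl
      · exact sum_eq_zero fun y hy => h.eq_zero x hx y (hXK y hy) (by omega)
  rw [h1, ← h2]
  omega

/-- The cut condition says that all sets of nodes that contain a vertex satisfy a bound in the
network; the colours in the worst such set are those that meet its set of vertices. -/
theorem Network.cutCond_iff {L K : ℕ} {tl hd own m r : ℕ → ℕ} (h : Network L K tl hd own m r) :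
    CutCond (range L) (Ico L K) (row L K m) tl hd (free L own) ↔
      ∀ v < L, ∀ X ⊆ range K, v ∈ X → K - L ≤ cut K r X + tokens L 0 X := by
  have hcard : ∀ Y, K - L = #(missing (Ico L K) (row L K m) Y) +
      ∑ c ∈ Ico L K, if Disjoint (row L K m c) Y then 0 else 1 := by
    intro Y
    rw [missing, card_filter, ← sum_add_distrib]
    trans ∑ c ∈ Ico L K, 1
    · simp
    · exact sum_congr rfl fun c _ => by split_ifs <;> rfl
  constructor
  · intro hc v hv X hX hvX
    rw [h.cut_add_tokens hX, hcard (X ∩ range L)]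
    refine Nat.add_le_add (hc _ inter_subset_right ⟨v, mem_inter.2 ⟨hvX, mem_range.2 hv⟩⟩)
      (sum_le_sum fun c _ => ?_)
    split_ifs with h1 h2 h2
    · exact Nat.zero_le _
    · exact Nat.zero_le _
    · exact le_rfl
    · rw [Nat.one_le_iff_ne_zero, Ne, card_eq_zero, ← disjoint_iff_inter_eq_empty]
      exact h1
  · intro hc Y hY hne
    obtain ⟨v, hv⟩ := hne
    let X := Y ∪ {c ∈ Ico L K | ¬ Disjoint (row L K m c) Y}
    have hX : X ⊆ range K := by
      intro x hx
      simp only [X, mem_union, mem_filter, mem_Ico] at hx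
      rcases hx with hx | hx
      · exact mem_range.2 ((mem_range.1 (hY hx)).trans_le h.le)
      · exact mem_range.2 hx.1.2
    have hXL : X ∩ range L = Y := by
      ext x
      simp only [X, mem_inter, mem_union, mem_filter, mem_Ico, mem_range]
      refine ⟨fun hx => hx.1.resolve_right fun h' => by omega, fun hx => ⟨.inl hx, ?_⟩⟩
      exact mem_range.1 (hY hx)
    have := hc v (mem_range.1 (hY hv)) X hX (mem_union_left _ hv)
    rw [h.cut_add_tokens hX, hcard Y, hXL] at this
    have hsum : ∑ c ∈ Ico L K, (if c ∈ X then 1 else #(row L K m c ∩ Y)) =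
        ∑ c ∈ Ico L K, if Disjoint (row L K m c) Y then 0 else 1 := by
      refine sum_congr rfl fun c hcI => ?_
      have hcY : c ∉ Y := fun h' => by
        have := mem_range.1 (hY h')
        rw [mem_Ico] at hcI
        omega
      have hmem : c ∈ X ↔ ¬ Disjoint (row L K m c) Y := by
        simp [X, hcY, mem_Ico.1 hcI]
      by_cases hd : Disjoint (row L K m c) Y
      · rw [if_neg (by rw [hmem]; exact not_not.2 hd), if_pos hd, card_eq_zero,
          ← disjoint_iff_inter_eq_empty]
        exact hd
      · rw [if_pos (hmem.2 hd), if_neg hd]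
    omega

end Edmonds

/-! ### The test of the cut condition -/

namespace Edmonds

open LoopLang
open Ram (State)

/-- Label by breadth-first search all nodes from which the node in variable 20 can be reached along
positive entries of the matrix in array 13; the labels are put into array 14. -/
def labelCmd : Cmd :=
  .seq (.fill 14 25 (.const 0)) <|
  .seq (.store 14 (.var 20) (.const 1)) <|
  .loop 26 <|
    .seq (.fill 15 25 <| .cond (.get 14 (.var 25)) (.get 14 (.var 25)) <|
      .cond (.ex 27 <| .conj (.get 13 (.entry 25 (.var 27))) (.get 14 (.var 27)))
        (.add (.var 26) (.const 2)) (.const 0)) <|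
    .fill 14 25 (.get 15 (.var 25))

theorem run_labelCmd {s : State} (hv : s.var 20 < s.var 0) :
    Labels (s.var 0) (s.arr 13) (s.var 20) ((labelCmd.run s).arr 14) := by
  obtain ⟨K, hK⟩ : ∃ K, s.var 0 = K := ⟨_, rfl⟩
  obtain ⟨v, hv'⟩ : ∃ v, s.var 20 = v := ⟨_, rfl⟩
  obtain ⟨r, hr⟩ : ∃ r, s.arr 13 = r := ⟨_, rfl⟩
  rw [hK, hv'] at hv ⊢
  rw [hr, labelCmd, run_seq, run_seq]
  have f1 := frame_run (.fill 14 25 (.const 0)) s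
  have e1 := run_fill (s := s) (a := 14) (x := 25) (e := .const 0) (fun _ => 0)
    (by intros; rfl)
  set s1 := (Cmd.fill 14 25 (.const 0)).run s
  have h20 : s1.var 20 = v := (f1.1 20 (by decide)).trans hv'
  have h0 : s1.var 0 = K := (f1.1 0 (by decide)).trans hK
  have h13 : s1.arr 13 = r := (f1.2 13 (by decide)).trans hr
  set s2 := (Cmd.store 14 (.var 20) (.const 1)).run s1 with hs2
  have k0 : s2.var 0 = K := h0
  have k13 : s2.arr 13 = r := by simpa [hs2] using h13
  have k14 : ∀ x < K, s2.arr 14 x = if x = v then 1 else 0 := by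
    intro x hx
    simp [hs2, h20, Function.update_apply, e1, hK, hx]
  -- each round labels a further node unless the labelled set is closed
  have key := run_loop_inv (x := 26) (s := s2) (c := .seq (.fill 15 25 <|
      .cond (.get 14 (.var 25)) (.get 14 (.var 25)) <|
      .cond (.ex 27 <| .conj (.get 13 (.entry 25 (.var 27))) (.get 14 (.var 27)))
        (.add (.var 26) (.const 2)) (.const 0)) <| .fill 14 25 (.get 15 (.var 25)))
    (fun j t => t.arr 14 v = 1 ∧ (∀ x < K, t.arr 14 x ≤ j + 1) ∧
      (∀ x < K, t.arr 14 x ≠ 0 → x ≠ v →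
        ∃ y < K, r (K * x + y) ≠ 0 ∧ t.arr 14 y ≠ 0 ∧ t.arr 14 y < t.arr 14 x) ∧
      ((∀ x < K, t.arr 14 x = 0 → ∀ y < K, t.arr 14 y ≠ 0 → r (K * x + y) = 0) ∨
        j + 1 ≤ #{x ∈ range K | t.arr 14 x ≠ 0})) ?_ ?_
  · rw [k0] at key
    refine ⟨key.1, key.2.1, key.2.2.1, key.2.2.2.resolve_right fun h => ?_⟩
    have := h.trans (card_filter_le _ _)
    rw [card_range] at this
    omega
  · refine ⟨by simp [k14 v hv], fun x hx => ?_, fun x hx hx0 hxv => ?_, .inr ?_⟩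
    · rw [k14 x hx]; split_ifs <;> omega
    · simp [k14 x hx, hxv] at hx0
    · rw [zero_add, one_le_card]
      exact ⟨v, by simp [k14 v hv, hv]⟩
  · rintro j hj t ht ⟨i1, i2, i3, i4⟩
    obtain ⟨d, hd⟩ : ∃ d, t.arr 14 = d := ⟨_, rfl⟩
    rw [hd] at i1 i2 i3 i4
    have t0 : t.var 0 = K := (ht.1 0 (by decide)).trans k0
    have t13 : t.arr 13 = r := (ht.2 13 (by decide)).trans k13
    classical
    -- the new labels
    obtain ⟨d', hd'⟩ : ∃ d' : ℕ → ℕ, d' = fun x => if d x ≠ 0 then d x else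
      if ∃ y < K, r (K * x + y) ≠ 0 ∧ d y ≠ 0 then j + 2 else 0 := ⟨_, rfl⟩
    have hrun : ∀ x < K, ((Cmd.seq (.fill 15 25 <|
      .cond (.get 14 (.var 25)) (.get 14 (.var 25)) <|
      .cond (.ex 27 <| .conj (.get 13 (.entry 25 (.var 27))) (.get 14 (.var 27)))
        (.add (.var 26) (.const 2)) (.const 0)) <|
        .fill 14 25 (.get 15 (.var 25))).run (t.setVar 26 j)).arr 14 x = d' x := by
      intro x hx
      rw [run_seq]
      set u := t.setVar 26 j with hu
      have u0 : u.var 0 = K := by simp [hu, t0]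
      have u26 : u.var 26 = j := by simp [hu]
      have g1 := run_fill (s := u) (a := 15) (x := 25)
        (e := .cond (.get 14 (.var 25)) (.get 14 (.var 25)) <|
          .cond (.ex 27 <| .conj (.get 13 (.entry 25 (.var 27))) (.get 14 (.var 27)))
          (.add (.var 26) (.const 2)) (.const 0)) d' (by
          intro i hi w hw1 hw2 hw3
          have w0 : w.var 0 = K := by rw [hw1 0 (by decide), u0]
          have w26 : w.var 26 = j := by rw [hw1 26 (by decide), u26]
          have w14 : w.arr 14 = d := by rw [hw2 14 (by decide)]; exact hd
          have w13 : w.arr 13 = r := by rw [hw2 13 (by decide)]; exact t13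
          simp [hd', w0, w26, w14, w13, hw3, Expr.eval_entry])
      have f2 := frame_run (.fill 15 25 <| .cond (.get 14 (.var 25)) (.get 14 (.var 25)) <|
          .cond (.ex 27 <| .conj (.get 13 (.entry 25 (.var 27))) (.get 14 (.var 27)))
          (.add (.var 26) (.const 2)) (.const 0)) u
      set u' := (Cmd.fill 15 25 <| .cond (.get 14 (.var 25)) (.get 14 (.var 25)) <|
          .cond (.ex 27 <| .conj (.get 13 (.entry 25 (.var 27))) (.get 14 (.var 27)))
          (.add (.var 26) (.const 2)) (.const 0)).run u
      have u0' : u'.var 0 = K := (f2.1 0 (by decide)).trans u0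
      have g2 := run_fill (s := u') (a := 14) (x := 25) (e := .get 15 (.var 25)) d' (by
          intro i hi w hw1 hw2 hw3
          have : w.arr 15 i = d' i := by
            rw [hw2 15 (by decide), g1, u0]
            simp [← u0', hi]
          simp [hw3, this])
      rw [g2, u0']
      simp [hx]
    have keep : ∀ x, d x ≠ 0 → d' x = d x := fun x hx => by rw [hd']; simp [hx]
    refine ⟨?_, fun x hx => ?_, fun x hx hx0 hxv => ?_, ?_⟩
    · rw [hrun v hv, keep v (by omega), i1]
    · rw [hrun x hx, hd']
      have := i2 x hx
      dsimp only
      split_ifs <;> omega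
    · rw [hrun x hx] at hx0 ⊢
      by_cases hdx : d x = 0
      · have hE : ∃ y < K, r (K * x + y) ≠ 0 ∧ d y ≠ 0 := by
          by_contra hc
          rw [hd'] at hx0
          dsimp only at hx0
          rw [if_neg (not_not.2 hdx), if_neg hc] at hx0
          exact hx0 rfl
        obtain ⟨y, hy, h1, h2⟩ := hE
        refine ⟨y, hy, h1, ?_⟩
        rw [hrun y hy, keep y h2]
        refine ⟨h2, ?_⟩
        have hx2 : d' x = j + 2 := by
          rw [hd']
          dsimp only
          rw [if_neg (not_not.2 hdx), if_pos ⟨y, hy, h1, h2⟩]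
        have := i2 y hy
        omega
      · obtain ⟨y, hy, h1, h2, h3⟩ := i3 x hx hdx hxv
        refine ⟨y, hy, h1, ?_⟩
        rw [hrun y hy, keep y h2, keep x hdx]
        exact ⟨h2, h3⟩
    · by_cases hcl : ∀ x < K, d x = 0 → ∀ y < K, d y ≠ 0 → r (K * x + y) = 0
      · left
        have hsame : ∀ x < K, d' x = d x := by
          intro x hx
          by_cases hdx : d x = 0
          · have hE : ¬ ∃ y < K, r (K * x + y) ≠ 0 ∧ d y ≠ 0 := by
              rintro ⟨y, hy, h1, h2⟩
              exact h1 (hcl x hx hdx y hy h2)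
            rw [hd']
            dsimp only
            rw [if_neg (not_not.2 hdx), if_neg hE, hdx]
          · exact keep x hdx
        intro x hx hx0 y hy hy0
        rw [hrun x hx, hsame x hx] at hx0
        rw [hrun y hy, hsame y hy] at hy0
        exact hcl x hx hx0 y hy hy0
      · right
        have i4' := i4.resolve_left hcl
        push Not at hcl
        obtain ⟨x, hx, hx0, y, hy, hy0, hxy⟩ := hcl
        have hlt : #{x ∈ range K | d x ≠ 0} < #{x ∈ range K | d' x ≠ 0} := by
          refine card_lt_card (Finset.ssubset_iff_subset_ne.2 ⟨fun z hz => ?_, fun he => ?_⟩)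
          · rw [mem_filter] at hz ⊢
            rw [keep z hz.2]
            exact hz
          · have : x ∈ ({x ∈ range K | d' x ≠ 0} : Finset ℕ) := by
              rw [mem_filter, hd']
              dsimp only
              rw [if_neg (not_not.2 hx0), if_pos ⟨y, hy, hxy, hy0⟩]
              exact ⟨mem_range.2 hx, by omega⟩
            rw [← he, mem_filter] at this
            exact this.2 hx0
        have heq : ({x ∈ range K | d' x ≠ 0} : Finset ℕ) =
            {x ∈ range K | ((Cmd.seq (.fill 15 25 <|
              .cond (.get 14 (.var 25)) (.get 14 (.var 25)) <|
              .cond (.ex 27 <| .conj (.get 13 (.entry 25 (.var 27))) (.get 14 (.var 27)))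
              (.add (.var 26) (.const 2)) (.const 0)) <|
              .fill 14 25 (.get 15 (.var 25))).run (t.setVar 26 j)).arr 14 x ≠ 0} :=
          filter_congr fun x hx => by rw [hrun x (mem_range.1 hx)]
        rw [← heq]
        omega

/-- Move the token in variable 28 by one step towards smaller labels. -/
def stepCmd : Cmd :=
  .seq (.loop 25 <| .cond (.conj (.get 13 (.entry 28 (.var 25))) <| .conj (.get 14 (.var 25)) <|
      .lt (.get 14 (.var 25)) (.get 14 (.var 28))) (.assign 29 (.var 25)) .skip) <|
  .seq (.store 13 (.entry 28 (.var 29)) (.sub (.get 13 (.entry 28 (.var 29))) (.const 1))) <|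
  .seq (.store 13 (.entry 29 (.var 28)) (.add (.get 13 (.entry 29 (.var 28))) (.const 1))) <|
  .assign 28 (.var 29)

/-- Move a token from the node in variable 24 to the node in variable 20. -/
def walkCmd : Cmd :=
  .seq (.assign 28 (.var 24)) <|
  .loop 26 <| .cond (.neg (.eq (.var 28) (.var 20))) stepCmd .skip

theorem run_stepCmd {s : State} (h : ∃ y < s.var 0, s.arr 13 (s.var 0 * s.var 28 + y) ≠ 0 ∧
      s.arr 14 y ≠ 0 ∧ s.arr 14 y < s.arr 14 (s.var 28)) :
    ∃ y < s.var 0, s.arr 13 (s.var 0 * s.var 28 + y) ≠ 0 ∧ s.arr 14 y ≠ 0 ∧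
      s.arr 14 y < s.arr 14 (s.var 28) ∧ (stepCmd.run s).var 28 = y ∧
      (stepCmd.run s).arr 13 = push (s.var 0) (s.arr 13) (s.var 28) y := by
  obtain ⟨y, hy, h1⟩ := h
  have key := run_loop_inv (x := 25) (s := s) (c := .cond (.conj (.get 13 (.entry 28 (.var 25))) <|
      .conj (.get 14 (.var 25)) <|
      .lt (.get 14 (.var 25)) (.get 14 (.var 28))) (.assign 29 (.var 25)) .skip)
    (fun j t => y < j → t.var 29 < s.var 0 ∧ s.arr 13 (s.var 0 * s.var 28 + t.var 29) ≠ 0 ∧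
      s.arr 14 (t.var 29) ≠ 0 ∧ s.arr 14 (t.var 29) < s.arr 14 (s.var 28)) (by simp) (by
    intro j hj t ht ih hyj
    have t0 : t.var 0 = s.var 0 := ht.1 0 (by decide)
    have t28 : t.var 28 = s.var 28 := ht.1 28 (by decide)
    have t13 : t.arr 13 = s.arr 13 := ht.2 13 (by decide)
    have t14 : t.arr 14 = s.arr 14 := ht.2 14 (by decide)
    simp only [run_cond, Expr.holds_conj, Expr.holds_get, Expr.holds_lt, Expr.eval_get,
      Expr.eval_var, ne_eq, Expr.eval_entry (x := 28) (by decide)]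
    simp only [arr_setVar, var_setVar, t0, t28, t13, t14, Nat.reduceEqDiff, if_true, if_false,
      run_assign, run_skip, Expr.eval_var]
    split_ifs with hP
    · simpa [hj] using hP
    · simp only [var_setVar, Nat.reduceEqDiff, if_false]
      refine ih (lt_of_le_of_ne (by omega) ?_)
      rintro rfl
      exact hP h1)
  have f := frame_run (.loop 25 <| .cond (.conj (.get 13 (.entry 28 (.var 25))) <|
      .conj (.get 14 (.var 25)) <|
      .lt (.get 14 (.var 25)) (.get 14 (.var 28))) (.assign 29 (.var 25)) .skip) s
  rw [stepCmd]
  simp only [run_seq]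
  set t := (Cmd.loop 25 <| .cond (.conj (.get 13 (.entry 28 (.var 25))) <|
      .conj (.get 14 (.var 25)) <|
      .lt (.get 14 (.var 25)) (.get 14 (.var 28))) (.assign 29 (.var 25)) .skip).run s
  have t0 : t.var 0 = s.var 0 := f.1 0 (by decide)
  have t28 : t.var 28 = s.var 28 := f.1 28 (by decide)
  have t13 : t.arr 13 = s.arr 13 := f.2 13 (by decide)
  refine ⟨t.var 29, (key hy).1, (key hy).2.1, (key hy).2.2.1, (key hy).2.2.2, ?_, ?_⟩
  · simp
  · simp [push, Expr.eval_entry, t0, t28, t13]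

theorem run_walkCmd {s : State} (hc : s.var 24 < s.var 0)
    (hl : Labels (s.var 0) (s.arr 13) (s.var 20) (s.arr 14)) (hd : s.arr 14 (s.var 24) ≠ 0)
    {X : Finset ℕ} (hX : X ⊆ range (s.var 0)) (hv : s.var 20 ∈ X) :
    cut (s.var 0) ((walkCmd.run s).arr 13) X + 1 =
      cut (s.var 0) (s.arr 13) X + if s.var 24 ∈ X then 1 else 0 := by
  obtain ⟨K, hK⟩ : ∃ K, s.var 0 = K := ⟨_, rfl⟩
  obtain ⟨v, hv'⟩ : ∃ v, s.var 20 = v := ⟨_, rfl⟩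
  obtain ⟨r, hr⟩ : ∃ r, s.arr 13 = r := ⟨_, rfl⟩
  obtain ⟨d, hd'⟩ : ∃ d, s.arr 14 = d := ⟨_, rfl⟩
  obtain ⟨c, hc'⟩ : ∃ c, s.var 24 = c := ⟨_, rfl⟩
  rw [walkCmd, run_seq]
  simp only [hK, hv', hr, hd', hc'] at hc hl hd hX hv ⊢
  set s1 := (Cmd.assign 28 (.var 24)).run s with hs1
  have h0 : s1.var 0 = K := by simp [hs1, hK]
  -- the capacities between nodes whose labels are not above that of the token are unchanged
  have key := run_loop_inv (x := 26) (s := s1)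
    (c := .cond (.neg (.eq (.var 28) (.var 20))) stepCmd .skip)
    (fun j t => t.var 28 < K ∧ d (t.var 28) ≠ 0 ∧ (d (t.var 28) = 1 ∨ d (t.var 28) + j ≤ K + 1) ∧
      (∀ x < K, ∀ y < K, d x ≤ d (t.var 28) → d y ≤ d (t.var 28) →
        t.arr 13 (K * x + y) = r (K * x + y)) ∧
      cut K (t.arr 13) X + (if t.var 28 ∈ X then 1 else 0) =
        cut K r X + if c ∈ X then 1 else 0) ?_ ?_
  · rw [h0] at key
    obtain ⟨k1, k2, k3, -, k4⟩ := key
    have : ((Cmd.loop 26 (.cond (.neg (.eq (.var 28) (.var 20))) stepCmd .skip)).run s1).var 28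
        = v := by
      by_contra hne
      obtain ⟨y, -, -, h1, h2⟩ := hl.descend _ k1 k2 hne
      omega
    rw [this, if_pos hv] at k4
    exact k4
  · have e28 : s1.var 28 = c := by simp [hs1, hc']
    have e13 : s1.arr 13 = r := hr
    rw [e28, e13]
    exact ⟨hc, hd, .inr (hl.le c hc), fun _ _ _ _ _ _ => rfl, rfl⟩
  · rintro j hj t ht ⟨i1, i2, i3, i4, i5⟩
    have t0 : t.var 0 = K := (ht.1 0 (by decide)).trans h0
    have t20 : t.var 20 = v := (ht.1 20 (by decide)).trans (by simp [hs1, hv'])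
    have t14 : t.arr 14 = d := (ht.2 14 (by decide)).trans hd'
    simp only [run_cond, Expr.holds_neg, Expr.holds_eq, Expr.eval_var, var_setVar,
      Nat.reduceEqDiff, if_false, t20]
    by_cases hne : t.var 28 = v
    swap
    · rw [if_pos hne]
      obtain ⟨y, hy, h1, h2, h3⟩ := hl.descend _ i1 i2 hne
      obtain ⟨y, hy, h1, h2, h3, h4, h5⟩ := run_stepCmd (s := t.setVar 26 j) (by
        refine ⟨y, ?_⟩
        simp only [var_setVar, arr_setVar, Nat.reduceEqDiff, if_false, t0, t14, OfNat.zero_ne_ofNat]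
        exact ⟨hy, by rwa [i4 _ i1 _ hy le_rfl h3.le], h2, h3⟩)
      simp only [var_setVar, arr_setVar, Nat.reduceEqDiff, if_false, t0, t14,
        OfNat.zero_ne_ofNat] at hy h1 h2 h3 h5
      have hne' : t.var 28 ≠ y := by rintro rfl; exact lt_irrefl _ h3
      rw [h4, h5]
      refine ⟨hy, h2, by omega, fun x hx z hz hdx hdz => ?_, ?_⟩
      · have n1 : K * x + z ≠ K * y + t.var 28 := by
          intro h
          obtain ⟨-, rfl⟩ := entry_inj hz i1 h
          omega
        have n2 : K * x + z ≠ K * t.var 28 + y := by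
          intro h
          obtain ⟨rfl, -⟩ := entry_inj hz hy h
          omega
        rw [push, Function.update_of_ne n1, Function.update_of_ne n2]
        exact i4 x hx z hz (by omega) (by omega)
      · rw [cut_push hX i1 hy hne' h1, i5]
    · rw [if_neg (not_not.2 hne)]
      simp only [run_skip, var_setVar, arr_setVar, Nat.reduceEqDiff, if_false]
      refine ⟨i1, i2, .inl ?_, i4, i5⟩
      rw [hne, hl.target]

/-- For every colour send a token to the vertex in variable 20; if this fails, the variable 30 is
set to `0`. -/
def sendCmd : Cmd :=
  .loop 24 <| .cond (.le (.var 2) (.var 24))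
    (.seq labelCmd <| .cond (.get 14 (.var 24)) walkCmd (.assign 30 (.const 0))) .skip

/-- Put the capacities of the network into array 13. -/
def networkCmd : Cmd :=
  .fillMatrix 13 21 22 <| .add (.get 12 (.entry 21 (.var 22))) <|
    .sum 23 <| .cond (.conj (.eq (.get 11 (.var 23)) (.const 0)) <|
      .conj (.eq (.get 10 (.var 23)) (.var 21)) (.eq (.get 9 (.var 23)) (.var 22)))
      (.const 1) (.const 0)

/-- Test the cut condition for the vertices in the matrix 12 and the arcs without an owner in
array 11, whose tails and heads are in the arrays 10 and 9; the answer is put into variable 30. -/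
def checkCmd : Cmd :=
  .seq (.assign 30 (.const 1)) <|
  .loop 20 <| .cond (.lt (.var 20) (.var 2)) (.seq networkCmd sendCmd) .skip

theorem run_networkCmd (s : State) : ∀ x < s.var 0, ∀ y < s.var 0,
    (networkCmd.run s).arr 13 (s.var 0 * x + y) = s.arr 12 (s.var 0 * x + y) +
      #{q ∈ range (s.var 0) | s.arr 11 q = 0 ∧ s.arr 10 q = x ∧ s.arr 9 q = y} := by
  refine run_fillMatrix (by decide) (by decide) (by decide) (by decide)
    (fun x y => s.arr 12 (s.var 0 * x + y) +
      #{q ∈ range (s.var 0) | s.arr 11 q = 0 ∧ s.arr 10 q = x ∧ s.arr 9 q = y}) ?_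
  intro i hi j hj t h1 h2 h3 h4
  have t0 : t.var 0 = s.var 0 := h1 0 (by decide) (by decide)
  simp [Expr.eval_entry, h3, h4, t0, h2]

theorem tokens_of_le {L c c' : ℕ} (h : c ≤ L) (h' : c' ≤ L) (X : Finset ℕ) :
    tokens L c X = tokens L c' X := by
  rw [tokens, tokens]
  congr 1
  exact filter_congr fun x _ => by omega

theorem run_sendCmd {s : State} (hv : s.var 20 < s.var 0) (hL : s.var 2 < s.var 0) :
    (sendCmd.run s).var 30 ≠ 0 ↔ s.var 30 ≠ 0 ∧ ∀ X ⊆ range (s.var 0), s.var 20 ∈ X →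
      s.var 0 - s.var 2 ≤ cut (s.var 0) (s.arr 13) X + tokens (s.var 2) 0 X := by
  obtain ⟨K, hK⟩ : ∃ K, s.var 0 = K := ⟨_, rfl⟩
  obtain ⟨v, hv'⟩ : ∃ v, s.var 20 = v := ⟨_, rfl⟩
  obtain ⟨r, hr⟩ : ∃ r, s.arr 13 = r := ⟨_, rfl⟩
  obtain ⟨L, hL'⟩ : ∃ L, s.var 2 = L := ⟨_, rfl⟩
  rw [sendCmd]
  simp only [hK, hv', hr, hL'] at hv hL ⊢
  have key := run_loop_inv (x := 24) (s := s) (c := .cond (.le (.var 2) (.var 24))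
      (.seq labelCmd <| .cond (.get 14 (.var 24)) walkCmd (.assign 30 (.const 0))) .skip)
    (fun j t => (t.var 30 ≠ 0 → s.var 30 ≠ 0 ∧ ∀ X ⊆ range K, v ∈ X →
        cut K (t.arr 13) X + tokens L j X + (j - L) = cut K r X + tokens L 0 X) ∧
      (t.var 30 = 0 → s.var 30 = 0 ∨ ∃ X ⊆ range K, v ∈ X ∧ cut K r X + tokens L 0 X < K - L))
    ?_ ?_
  · rw [hK] at key
    constructor
    · intro h
      obtain ⟨h1, h2⟩ := key.1 h
      refine ⟨h1, fun X hX hvX => ?_⟩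
      have := h2 X hX hvX
      omega
    · rintro ⟨h1, h2⟩ h3
      obtain h4 | ⟨X, hX, hvX, h4⟩ := key.2 h3
      · exact h1 h4
      · have := h2 X hX hvX
        omega
  · refine ⟨fun h => ⟨h, fun X _ _ => ?_⟩, fun h => .inl h⟩
    rw [hr, Nat.zero_sub, add_zero]
  · rintro j hj t ht ⟨i1, i2⟩
    rw [hK] at hj
    have t0 : t.var 0 = K := (ht.1 0 (by decide)).trans hK
    have t20 : t.var 20 = v := (ht.1 20 (by decide)).trans hv'
    have t2 : t.var 2 = L := (ht.1 2 (by decide)).trans hL'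
    rw [run_cond]
    simp only [Expr.holds_le, Expr.eval_var, var_setVar, Nat.reduceEqDiff, if_false, if_true, t2]
    by_cases hjL : L ≤ j
    swap
    · rw [if_neg hjL, run_skip]
      simp only [var_setVar, Nat.reduceEqDiff, if_false, arr_setVar]
      refine ⟨fun h => ⟨(i1 h).1, fun X hX hvX => ?_⟩, i2⟩
      have := (i1 h).2 X hX hvX
      rw [tokens_of_le (show j + 1 ≤ L by omega) (show j ≤ L by omega)]
      omega
    rw [if_pos hjL, run_seq]
    have hlab := run_labelCmd (s := t.setVar 24 j) (by simp [t0, t20, hv])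
    have hf := frame_run labelCmd (t.setVar 24 j)
    set u := labelCmd.run (t.setVar 24 j)
    have u0 : u.var 0 = K := (hf.1 0 (by decide)).trans (by simp [t0])
    have u20 : u.var 20 = v := (hf.1 20 (by decide)).trans (by simp [t20])
    have u24 : u.var 24 = j := (hf.1 24 (by decide)).trans (by simp)
    have u30 : u.var 30 = t.var 30 := (hf.1 30 (by decide)).trans (by simp)
    have u13 : u.arr 13 = t.arr 13 := hf.2 13 (by decide)
    simp only [var_setVar, Nat.reduceEqDiff, if_false, t0, t20, OfNat.zero_ne_ofNat,
      arr_setVar] at hlab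
    rw [run_cond]
    simp only [Expr.holds_get, Expr.eval_var, u24]
    split_ifs with hd
    · have hw := fun X => run_walkCmd (s := u) (by rw [u0, u24]; exact hj)
        (by rw [u0, u20, u13]; exact hlab) (by rwa [u24]) (X := X)
      have hf2 := frame_run walkCmd u
      rw [hf2.1 30 (by decide), u30]
      refine ⟨fun h => ⟨(i1 h).1, fun X hX hvX => ?_⟩, i2⟩
      have h1 := (i1 h).2 X hX hvX
      have h2 := hw X (by rwa [u0]) (by rwa [u20])
      rw [u0, u24, u13] at h2
      have h3 := tokens_succ hjL X
      omega
    · simp only [run_assign, Expr.eval_const, var_setVar, if_true, ne_eq, not_true_eq_false,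
        false_imp_iff, true_and, forall_const]
      by_cases h30 : t.var 30 = 0
      · exact i2 h30
      · right
        rw [not_not] at hd
        refine ⟨{x ∈ range K | u.arr 14 x ≠ 0}, filter_subset _ _, ?_, ?_⟩
        · simp [hv, hlab.target]
        · rw [← (i1 h30).2 _ (filter_subset _ _) (by simp [hv, hlab.target]), hlab.cut_eq_zero]
          have : tokens L j {x ∈ range K | u.arr 14 x ≠ 0} ≤ #(Ico (j + 1) K) := by
            refine card_le_card fun x hx => ?_
            simp only [mem_filter, mem_range] at hx
            rw [mem_Ico]
            refine ⟨lt_of_le_of_ne hx.2.2 ?_, hx.1.1⟩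
            rintro rfl
            exact hx.1.2 hd
          rw [Nat.card_Ico] at this
          omega

/-- The arrays 9 to 12 and the variables 0 and 2 describe a state of the construction: the heads
and tails of the arcs, their owners, and the vertices of the branchings. -/
structure Shape (s : State) : Prop where
  pos : 0 < s.var 2
  le : s.var 2 < s.var 0
  eq_zero : ∀ x < s.var 0, ∀ y < s.var 0, ¬ (s.var 2 ≤ x ∧ y < s.var 2) →
    s.arr 12 (s.var 0 * x + y) = 0
  le_one : ∀ x < s.var 0, ∀ y < s.var 0, s.arr 12 (s.var 0 * x + y) ≤ 1
  avail : ∀ q < s.var 0, s.arr 11 q = 0 → q < s.var 2 ∧ s.arr 10 q < s.var 2 ∧ s.arr 9 q < s.var 2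

/-- The cut condition in a state of the construction. -/
def Good (s : State) : Prop :=
  CutCond (range (s.var 2)) (Ico (s.var 2) (s.var 0)) (row (s.var 2) (s.var 0) (s.arr 12))
    (s.arr 10) (s.arr 9) (free (s.var 2) (s.arr 11))

theorem run_checkCmd {s : State} (h : Shape s) : (checkCmd.run s).var 30 ≠ 0 ↔ Good s := by
  obtain ⟨K, hK⟩ : ∃ K, s.var 0 = K := ⟨_, rfl⟩
  obtain ⟨L, hL⟩ : ∃ L, s.var 2 = L := ⟨_, rfl⟩
  have hLK : L < K := by rw [← hK, ← hL]; exact h.le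
  obtain ⟨r, hr⟩ : ∃ r, r = fun z => s.arr 12 z + #{q ∈ range K | s.arr 11 q = 0 ∧
    s.arr 10 q = z / K ∧ s.arr 9 q = z % K} := ⟨_, rfl⟩
  have hrxy : ∀ x < K, ∀ y < K, r (K * x + y) = s.arr 12 (K * x + y) +
      #{q ∈ range K | s.arr 11 q = 0 ∧ s.arr 10 q = x ∧ s.arr 9 q = y} := by
    intro x hx y hy
    have hdiv : (K * x + y) / K = x := by
      rw [Nat.mul_add_div (by omega), Nat.div_eq_of_lt hy, add_zero]
    have hmod : (K * x + y) % K = y := by rw [Nat.mul_add_mod, Nat.mod_eq_of_lt hy]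
    rw [hr]
    simp only [hdiv, hmod]
  have hnet : Network L K (s.arr 10) (s.arr 9) (s.arr 11) (s.arr 12) r := by
    have := h
    exact ⟨hLK.le, by simpa only [hK, hL] using h.eq_zero, by simpa only [hK] using h.le_one,
      by simpa only [hK, hL] using h.avail, hrxy⟩
  rw [Good, hK, hL, hnet.cutCond_iff, checkCmd, run_seq]
  set s1 := (Cmd.assign 30 (.const 1)).run s with hs1
  have h10 : s1.var 0 = K := by simp [hs1, hK]
  have key := run_loop_inv (x := 20) (s := s1)
    (c := .cond (.lt (.var 20) (.var 2)) (.seq networkCmd sendCmd) .skip)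
    (fun j t => t.var 30 ≠ 0 ↔ ∀ v < L, v < j → ∀ X ⊆ range K, v ∈ X →
      K - L ≤ cut K r X + tokens L 0 X) (by simp [hs1]) (by
    intro j hj t ht ih
    rw [h10] at hj
    have t0 : t.var 0 = K := (ht.1 0 (by decide)).trans h10
    have t2 : t.var 2 = L := (ht.1 2 (by decide)).trans (by simp [hs1, hL])
    rw [run_cond]
    simp only [Expr.holds_lt, Expr.eval_var, var_setVar, Nat.reduceEqDiff, if_false, if_true, t2]
    split_ifs with hjL
    · rw [run_seq]
      have hn := run_networkCmd (t.setVar 20 j)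
      have hf := frame_run networkCmd (t.setVar 20 j)
      set u := networkCmd.run (t.setVar 20 j)
      have u0 : u.var 0 = K := (hf.1 0 (by decide)).trans (by simp [t0])
      have u2 : u.var 2 = L := (hf.1 2 (by decide)).trans (by simp [t2])
      have u20 : u.var 20 = j := (hf.1 20 (by decide)).trans (by simp)
      have u30 : u.var 30 = t.var 30 := (hf.1 30 (by decide)).trans (by simp)
      have hcut : ∀ X ⊆ range K, cut K (u.arr 13) X = cut K r X := by
        intro X hX
        refine sum_congr rfl fun p hp => ?_
        simp only [mem_product, mem_sdiff, mem_range] at hp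
        have hp2 := mem_range.1 (hX hp.2)
        simp only [var_setVar, OfNat.zero_ne_ofNat, if_false, t0, arr_setVar] at hn
        rw [hn _ hp.1.1 _ hp2, hrxy _ hp.1.1 _ hp2, ht.2 12 (by decide), ht.2 11 (by decide),
          ht.2 10 (by decide), ht.2 9 (by decide)]
        rfl
      rw [run_sendCmd (by rw [u20, u0]; exact hj) (by rw [u2, u0]; exact hLK), u30, ih, u0, u2, u20]
      constructor
      · rintro ⟨h1, h2⟩ v hv hvj X hX hvX
        rcases Nat.lt_succ_iff_lt_or_eq.1 hvj with h3 | rfl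
        · exact h1 v hv h3 X hX hvX
        · rw [← hcut X hX]
          exact h2 X hX hvX
      · intro h1
        refine ⟨fun v hv hvj => h1 v hv (by omega), fun X hX hvX => ?_⟩
        rw [hcut X hX]
        exact h1 j hjL (by omega) X hX hvX
    · rw [run_skip, var_setVar, if_neg (by decide), ih]
      constructor
      · exact fun h1 v hv _ => h1 v hv (by omega)
      · exact fun h1 v hv _ => h1 v hv (by omega))
  rw [key, h10]
  exact ⟨fun h1 v hv => h1 v hv (by omega), fun h1 v hv _ => h1 v hv⟩

end Edmonds

/-! ### Temporal-spanning branchings and waiting intervals -/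

section Temporal

variable {V E : Type*} {G : TemporalDigraph V E}

/-- A temporal vertex is a start if it is the first one of a maximal interval of times at which
its vertex is active. -/
def TemporalDigraph.IsStart (G : TemporalDigraph V E) (x : V × ℕ) : Prop :=
  x.2 ∈ G.act x.1 ∧ ∀ t, t + 1 = x.2 → t ∉ G.act x.1

/-- `y` is the latest start at the vertex of `x` that is not after `x`.  For a temporal vertex `x`
this is the start of the interval of `x`. -/
def TemporalDigraph.StartOf (G : TemporalDigraph V E) (x y : V × ℕ) : Prop :=
  G.IsStart y ∧ y.1 = x.1 ∧ y.2 ≤ x.2 ∧ ∀ t ≤ x.2, G.IsStart (x.1, t) → t ≤ y.2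

theorem TemporalDigraph.StartOf.unique {x y z : V × ℕ} (hy : G.StartOf x y) (hz : G.StartOf x z) :
    y = z := by
  obtain ⟨h1, h2, h3, h4⟩ := hy
  obtain ⟨k1, k2, k3, k4⟩ := hz
  refine Prod.ext (h2.trans k2.symm) (le_antisymm ?_ ?_)
  · exact k4 _ h3 (by rw [← h2]; exact h1)
  · exact h4 _ k3 (by rw [← k2]; exact k1)

theorem TemporalDigraph.IsStart.startOf_self {x : V × ℕ} (hx : G.IsStart x) : G.StartOf x x :=
  ⟨hx, rfl, le_rfl, fun _ ht _ => ht⟩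

theorem TemporalDigraph.StartOf.succ {v : V} {t : ℕ} {y : V × ℕ} (h : G.StartOf (v, t) y)
    (ht : t ∈ G.act v) : G.StartOf (v, t + 1) y := by
  obtain ⟨h1, h2, h3, h4⟩ := h
  refine ⟨h1, h2, Nat.le_succ_of_le h3, fun t' ht' hs => ?_⟩
  rcases Nat.le_succ_iff.1 ht' with h5 | h5
  · exact h4 t' h5 hs
  · exact absurd ht (hs.2 t h5.symm)

/-- Induction along a waiting interval: what holds at its start and is preserved by waiting holds
at each of its temporal vertices. -/
theorem TemporalDigraph.wait_induction {P : V → ℕ → Prop} {v : V}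
    (hs : ∀ t, G.IsStart (v, t) → P v t)
    (hw : ∀ t, t ∈ G.act v → t + 1 ∈ G.act v → P v t → P v (t + 1)) :
    ∀ t, t ∈ G.act v → P v t := by
  intro t
  induction t with
  | zero => exact fun h => hs 0 ⟨h, fun t ht => absurd ht (Nat.succ_ne_zero t)⟩
  | succ t ih =>
    intro h
    by_cases ht : t ∈ G.act v
    · exact hw t ht h (ih ht)
    · refine hs _ ⟨h, fun t' ht' => ?_⟩
      obtain rfl : t' = t := Nat.succ_injective ht'
      exact ht

theorem TemporalDigraph.exists_startOf {x : V × ℕ} (hx : x ∈ G.tverts) : ∃ y, G.StartOf x y :=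
  TemporalDigraph.wait_induction (P := fun v t => ∃ y, G.StartOf (v, t) y)
    (fun _ h => ⟨_, h.startOf_self⟩) (fun _ h _ ⟨y, hy⟩ => ⟨y, hy.succ h⟩) x.2 hx

namespace TemporalSubdigraph

variable {B : TemporalSubdigraph G}

/-- A single step of a temporal walk. -/
def IsStep (B : TemporalSubdigraph G) (a : V × ℕ) : TemporalStep E → V × ℕ → Prop
  | .wait, b => a.2 ∈ B.act a.1 ∧ b.2 ∈ B.act b.1 ∧ b = (a.1, a.2 + 1)
  | .traverse e t t', b => a = (G.src e, t) ∧ (t, t') ∈ B.app e ∧ b = (G.tgt e, t')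

theorem IsWalk.mem_act {l : List (TemporalStep E)} {a b : V × ℕ} (h : B.IsWalk a l b) :
    b.2 ∈ B.act b.1 := by
  induction l generalizing a with
  | nil => obtain ⟨h1, rfl⟩ := h; exact h1
  | cons st l ih =>
    cases st with
    | wait => exact ih h.2
    | traverse e t t' => exact ih h.2.2

theorem isWalk_append_singleton {l : List (TemporalStep E)} {st : TemporalStep E} {a b : V × ℕ} :
    B.IsWalk a (l ++ [st]) b ↔ ∃ c, B.IsWalk a l c ∧ B.IsStep c st b := by
  induction l generalizing a with
  | nil =>
    cases st with
    | wait =>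
      constructor
      · rintro ⟨h1, h2, rfl⟩
        exact ⟨a, ⟨h1, rfl⟩, h1, h2, rfl⟩
      · rintro ⟨c, ⟨h1, rfl⟩, -, h2, rfl⟩
        exact ⟨h1, h2, rfl⟩
    | traverse e t t' =>
      constructor
      · rintro ⟨rfl, h2, h3, rfl⟩
        exact ⟨(G.src e, t), ⟨B.src_act e _ h2, rfl⟩, rfl, h2, rfl⟩
      · rintro ⟨c, ⟨h1, rfl⟩, rfl, h2, rfl⟩
        exact ⟨rfl, h2, B.tgt_act e _ h2, rfl⟩
  | cons st' l ih =>
    cases st' with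
    | wait =>
      constructor
      · rintro ⟨h1, h2⟩
        obtain ⟨c, h3, h4⟩ := ih.1 h2
        exact ⟨c, ⟨h1, h3⟩, h4⟩
      · rintro ⟨c, ⟨h1, h3⟩, h4⟩
        exact ⟨h1, ih.2 ⟨c, h3, h4⟩⟩
    | traverse e t t' =>
      constructor
      · rintro ⟨h1, h2, h5⟩
        obtain ⟨c, h3, h4⟩ := ih.1 h5
        exact ⟨c, ⟨h1, h2, h3⟩, h4⟩
      · rintro ⟨c, ⟨h1, h2, h3⟩, h4⟩
        exact ⟨h1, h2, ih.2 ⟨c, h3, h4⟩⟩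

/-- Two walks to the same temporal vertex of a branching have the same last step. -/
theorem IsTemporalSpanningBranching.step_unique {R : Set (V × ℕ)}
    (hB : B.IsTemporalSpanningBranching R) {x c c' : V × ℕ} (hx : x ∈ G.tverts)
    (hc : c ∈ G.tverts) (hc' : c' ∈ G.tverts) {st st' : TemporalStep E} (h : B.IsStep c st x)
    (h' : B.IsStep c' st' x) : st = st' := by
  obtain ⟨w, ⟨hw, hwc⟩, -⟩ := hB c hc
  obtain ⟨w', ⟨hw', hwc'⟩, -⟩ := hB c' hc'
  have := (hB x hx).unique (y₁ := (w.1, w.2 ++ [st])) (y₂ := (w'.1, w'.2 ++ [st']))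
    ⟨hw, isWalk_append_singleton.2 ⟨c, hwc, h⟩⟩ ⟨hw', isWalk_append_singleton.2 ⟨c', hwc', h'⟩⟩
  simpa using congrArg (fun w => w.2.getLast?) this

namespace IsTemporalSpanningBranching

variable {R : Set (V × ℕ)}

theorem mem_act (hB : B.IsTemporalSpanningBranching R) {x : V × ℕ} (hx : x ∈ G.tverts) :
    x.2 ∈ B.act x.1 := by
  obtain ⟨w, ⟨-, hw⟩, -⟩ := hB x hx
  exact hw.mem_act

theorem isStep_wait (hB : B.IsTemporalSpanningBranching R) {v : V} {t : ℕ} (h : t ∈ G.act v)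
    (h' : t + 1 ∈ G.act v) : B.IsStep (v, t) .wait (v, t + 1) :=
  ⟨hB.mem_act (x := (v, t)) h, hB.mem_act (x := (v, t + 1)) h', rfl⟩

/-- The roots are starts, since waiting leads to all other temporal vertices. -/
theorem isStart_of_mem (hB : B.IsTemporalSpanningBranching R) (hR : R ⊆ G.tverts) {x : V × ℕ}
    (hx : x ∈ R) : G.IsStart x := by
  refine ⟨hR hx, fun t ht hact => ?_⟩
  obtain ⟨v, t'⟩ := x
  subst ht
  obtain ⟨w, ⟨hw, hwc⟩, -⟩ := hB (v, t) hact
  have := (hB _ (hR hx)).unique (y₁ := (w.1, w.2 ++ [.wait])) (y₂ := ((v, t + 1), []))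
    ⟨hw, isWalk_append_singleton.2 ⟨(v, t), hwc, hB.isStep_wait hact (hR hx)⟩⟩
    ⟨hx, hB.mem_act (hR hx), rfl⟩
  simpa using congrArg Prod.snd this

/-- All temporal edges of a branching lead to starts. -/
theorem isStart_tgt (hB : B.IsTemporalSpanningBranching R) {e : E} {t t' : ℕ}
    (h : (t, t') ∈ B.app e) : G.IsStart (G.tgt e, t') := by
  have hG := B.app_subset e h
  refine ⟨G.tgt_act e _ hG, fun u hu hact => ?_⟩
  dsimp only at hu hact
  subst hu
  have := hB.step_unique (x := (G.tgt e, u + 1)) (c := (G.tgt e, u)) (c' := (G.src e, t))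
    (st := .wait) (st' := .traverse e t (u + 1)) (G.tgt_act e _ hG) hact (G.src_act e _ hG)
    (hB.isStep_wait hact (G.tgt_act e _ hG)) ⟨rfl, h, rfl⟩
  cases this

/-- A branching enters every set of starts that contains no root: this is the necessity of the
cut condition. -/
theorem exists_entering (hB : B.IsTemporalSpanningBranching R) (hR : R ⊆ G.tverts)
    {X : Set (V × ℕ)} (hRX : ∀ x ∈ R, x ∉ X) {x : V × ℕ} (hx : x ∈ X) (hxs : G.IsStart x) :
    ∃ e t t', (t, t') ∈ B.app e ∧ (G.tgt e, t') ∈ X ∧ ∀ y, G.StartOf (G.src e, t) y → y ∉ X := by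
  by_contra hcon
  push Not at hcon
  have key : ∀ (l : List (TemporalStep E)) (a b : V × ℕ), a ∈ R → B.IsWalk a l b →
      ∀ y, G.StartOf b y → y ∉ X := by
    intro l
    induction l using List.reverseRecOn with
    | nil =>
      rintro a b ha ⟨-, rfl⟩ y hy
      rw [← (hB.isStart_of_mem hR ha).startOf_self.unique hy]
      exact hRX a ha
    | append_singleton l st ih =>
      intro a b ha hw y hy
      obtain ⟨c, hc, hst⟩ := isWalk_append_singleton.1 hw
      cases st with
      | wait =>
        obtain ⟨h1, h2, rfl⟩ := hst
        obtain ⟨z, hz⟩ := G.exists_startOf (x := c) (B.act_subset _ h1)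
        rw [← (hz.succ (B.act_subset _ h1)).unique hy]
        exact ih a c ha hc z hz
      | traverse e t t' =>
        obtain ⟨rfl, h2, rfl⟩ := hst
        rw [← (hB.isStart_tgt h2).startOf_self.unique hy]
        intro hX
        obtain ⟨z, hz, hzX⟩ := hcon e t t' h2 hX
        exact ih a _ ha hc z hz hzX
  obtain ⟨w, ⟨hw, hwx⟩, -⟩ := hB x hxs.1
  exact key w.2 w.1 x hw hwx x hxs.startOf_self hx

end IsTemporalSpanningBranching

/-- The temporal subdigraph with all temporal vertices and the temporal edges that satisfy `F`. -/
noncomputable def ofEdges (G : TemporalDigraph V E) (F : E → ℕ × ℕ → Prop) :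
    TemporalSubdigraph G := by
  classical
  exact {
    verts := Set.univ
    edges := Set.univ
    act := G.act
    app := fun e => {p ∈ G.app e | F e p}
    src_mem := fun _ _ => trivial
    tgt_mem := fun _ _ => trivial
    act_subset := fun _ => subset_rfl
    app_subset := fun _ => filter_subset _ _
    act_outside := fun v hv => absurd trivial hv
    app_outside := fun e he => absurd trivial he
    src_act := fun e p hp => G.src_act e p (mem_filter.1 hp).1
    tgt_act := fun e p hp => G.tgt_act e p (mem_filter.1 hp).1 }

theorem mem_app_ofEdges {F : E → ℕ × ℕ → Prop} {e : E} {p : ℕ × ℕ} :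
    p ∈ (ofEdges G F).app e ↔ p ∈ G.app e ∧ F e p := by
  classical
  simp [ofEdges]

/-- Waiting leads from the start of an interval to all of it. -/
theorem exists_isWalk_of_startOf {F : E → ℕ × ℕ → Prop} {a : V × ℕ} {x y : V × ℕ}
    (hx : x ∈ G.tverts) (hy : G.StartOf x y) (h : ∃ l, (ofEdges G F).IsWalk a l y) :
    ∃ l, (ofEdges G F).IsWalk a l x := by
  refine G.wait_induction (P := fun v t => ∀ y, G.StartOf (v, t) y →
    (∃ l, (ofEdges G F).IsWalk a l y) → ∃ l, (ofEdges G F).IsWalk a l (v, t)) ?_ ?_ x.2 hx y hy h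
  · intro t ht y hy hw
    rw [ht.startOf_self.unique hy]
    exact hw
  · intro t h1 h2 ih y hy hw
    obtain ⟨z, hz⟩ := G.exists_startOf (x := (x.1, t)) h1
    obtain ⟨l, hl⟩ := ih z hz (by rwa [(hz.succ h1).unique hy])
    exact ⟨l ++ [.wait], isWalk_append_singleton.2 ⟨_, hl,
      show (ofEdges G F).IsStep (x.1, t) .wait (x.1, t + 1) from ⟨h1, h2, rfl⟩⟩⟩

/-- A sufficient condition for a branching, in terms of the starts. -/
theorem isTemporalSpanningBranching_ofEdges {F : E → ℕ × ℕ → Prop} {R : Set (V × ℕ)}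
    (hR : ∀ x ∈ R, G.IsStart x)
    (hF : ∀ e p, p ∈ G.app e → F e p → G.IsStart (G.tgt e, p.2) ∧ (G.tgt e, p.2) ∉ R)
    (hinj : ∀ e p e' p', p ∈ G.app e → F e p → p' ∈ G.app e' → F e' p' →
      (G.tgt e, p.2) = (G.tgt e', p'.2) → e = e' ∧ p = p')
    (hex : ∀ x, G.IsStart x → ∃ a l, a ∈ R ∧ (ofEdges G F).IsWalk a l x) :
    (ofEdges G F).IsTemporalSpanningBranching R := by
  set B := ofEdges G F
  have hexw : ∀ x ∈ G.tverts, ∃ a l, a ∈ R ∧ B.IsWalk a l x := fun x hx =>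
    G.wait_induction (P := fun v t => ∃ a l, a ∈ R ∧ B.IsWalk a l (v, t)) (fun t h => hex _ h)
      (fun t h h' ⟨a, l, ha, hl⟩ => ⟨a, l ++ [.wait], ha,
        isWalk_append_singleton.2 ⟨_, hl,
          show B.IsStep (x.1, t) .wait (x.1, t + 1) from ⟨h, h', rfl⟩⟩⟩) x.2 hx
  have key : ∀ (l l' : List (TemporalStep E)) (a a' b : V × ℕ), a ∈ R → a' ∈ R → B.IsWalk a l b →
      B.IsWalk a' l' b → a = a' ∧ l = l' := by
    -- no step leads to a root
    have hroot : ∀ b c st, b ∈ R → ¬ B.IsStep c st b := by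
      intro b c st hb h
      cases st with
      | wait =>
        obtain ⟨h1, -, rfl⟩ := h
        exact (hR _ hb).2 c.2 rfl h1
      | traverse e t t' =>
        obtain ⟨-, h2, rfl⟩ := h
        exact (hF e (t, t') (mem_app_ofEdges.1 h2).1 (mem_app_ofEdges.1 h2).2).2 hb
    intro l
    induction l using List.reverseRecOn with
    | nil =>
      rintro l' a a' b ha ha' ⟨-, rfl⟩ hw'
      induction l' using List.reverseRecOn with
      | nil => exact ⟨hw'.2.symm, rfl⟩
      | append_singleton l' st' _ =>
        obtain ⟨c, -, hst⟩ := isWalk_append_singleton.1 hw'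
        exact absurd hst (hroot _ _ _ ha)
    | append_singleton l st ih =>
      intro l' a a' b ha ha' hw hw'
      obtain ⟨c, hc, hst⟩ := isWalk_append_singleton.1 hw
      induction l' using List.reverseRecOn with
      | nil =>
        obtain ⟨-, rfl⟩ := hw'
        exact absurd hst (hroot _ _ _ ha')
      | append_singleton l' st' _ =>
        obtain ⟨c', hc', hst'⟩ := isWalk_append_singleton.1 hw'
        suffices h : c = c' ∧ st = st' by
          obtain ⟨rfl, rfl⟩ := h
          obtain ⟨rfl, rfl⟩ := ih l' a a' c ha ha' hc hc'
          exact ⟨rfl, rfl⟩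
        cases st with
        | wait =>
          obtain ⟨h1, h2, rfl⟩ := hst
          cases st' with
          | wait =>
            obtain ⟨-, -, h3⟩ := hst'
            simp only [Prod.mk.injEq, add_left_inj] at h3
            exact ⟨Prod.ext h3.1 h3.2, rfl⟩
          | traverse e t t' =>
            obtain ⟨-, h4, h5⟩ := hst'
            have := (hF e (t, t') (mem_app_ofEdges.1 h4).1 (mem_app_ofEdges.1 h4).2).1
            rw [← h5] at this
            exact absurd h1 (this.2 c.2 rfl)
        | traverse e t t' =>
          obtain ⟨rfl, h2, rfl⟩ := hst
          have h2' := mem_app_ofEdges.1 h2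
          cases st' with
          | wait =>
            obtain ⟨h3, -, h5⟩ := hst'
            have := (hF e (t, t') h2'.1 h2'.2).1
            rw [h5] at this
            exact absurd h3 (this.2 c'.2 rfl)
          | traverse e' u u' =>
            obtain ⟨rfl, h4, h5⟩ := hst'
            have h4' := mem_app_ofEdges.1 h4
            obtain ⟨rfl, h6⟩ := hinj e (t, t') e' (u, u') h2'.1 h2'.2 h4'.1 h4'.2 h5
            obtain ⟨rfl, rfl⟩ := Prod.mk.inj h6
            exact ⟨rfl, rfl⟩
  intro x hx
  obtain ⟨a, l, ha, hl⟩ := hexw x hx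
  refine ⟨(a, l), ⟨ha, hl⟩, ?_⟩
  rintro ⟨a', l'⟩ ⟨ha', hl'⟩
  obtain ⟨rfl, rfl⟩ := key l' l a' a x ha' ha hl' hl
  rfl

end TemporalSubdigraph

end Temporal

/-! ### Reading the input -/

namespace Edmonds

open LoopLang
open Ram (State)

/-- Read the blocks of a part of the input word, starting at the position in variable 6.  The
variable `n` holds the number of blocks.  A block consists of `h` header entries, the number of
items, and the items, which take `d` entries each.  Array `bs` receives the positions of the
blocks, and array `mark` receives at the position of each item of the block `u` the value
`u + 1`. -/
def scanCmd (n h d bs mark : ℕ) : Cmd :=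
  .loop 8 <| .cond (.lt (.var 8) (.var n))
    (.seq (.store bs (.var 8) (.var 6)) <|
      .seq (.assign 7 (.get 0 (.add (.var 6) (.const h)))) <|
      .seq (.assign 6 (.add (.var 6) (.const (h + 1)))) <|
      .loop 9 <| .cond (.lt (.var 9) (.var 7))
        (.seq (.store mark (.var 6) (.add (.var 8) (.const 1))) <|
          .assign 6 (.add (.var 6) (.const d))) .skip) .skip

/-- The items of the block `u` that are read after `l` rounds of the inner loop. -/
theorem run_scanCmd_inner {s : State} {mark d l₀ u : ℕ} {old : ℕ → ℕ → Prop} (hd : 0 < d)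
    (hl : l₀ ≤ s.var 0) (h7 : s.var 7 = l₀) (h8 : s.var 8 = u)
    (hz : ∀ p, s.var 6 ≤ p → s.arr mark p = 0) (hold : ∀ p v, s.arr mark p = v + 1 ↔ old p v) :
    let t := (Cmd.loop 9 <| .cond (.lt (.var 9) (.var 7))
        (.seq (.store mark (.var 6) (.add (.var 8) (.const 1))) <|
          .assign 6 (.add (.var 6) (.const d))) .skip).run s
    t.var 6 = s.var 6 + d * l₀ ∧ (∀ p, s.var 6 + d * l₀ ≤ p → t.arr mark p = 0) ∧
      ∀ p v, t.arr mark p = v + 1 ↔ old p v ∨ v = u ∧ ∃ j < l₀, p = s.var 6 + d * j := by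
  have key := run_loop_inv (x := 9) (s := s) (c := .cond (.lt (.var 9) (.var 7))
        (.seq (.store mark (.var 6) (.add (.var 8) (.const 1))) <|
          .assign 6 (.add (.var 6) (.const d))) .skip)
    (fun l t => t.var 6 = s.var 6 + d * min l l₀ ∧
      (∀ p, s.var 6 + d * min l l₀ ≤ p → t.arr mark p = 0) ∧
      ∀ p v, t.arr mark p = v + 1 ↔ old p v ∨ v = u ∧ ∃ j < min l l₀, p = s.var 6 + d * j)
    (by simpa using ⟨hz, hold⟩) (by
    rintro l - t ht ⟨i1, i2, i3⟩
    have t7 : t.var 7 = l₀ := (ht.1 7 (by simp [Cmd.vars])).trans h7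
    have t8 : t.var 8 = u := (ht.1 8 (by simp [Cmd.vars])).trans h8
    simp only [run_cond, Expr.holds_lt, Expr.eval_var, var_setVar, Nat.reduceEqDiff, if_false,
      if_true, t7]
    split_ifs with h
    · have e1 : min l l₀ = l := by omega
      have e2 : min (l + 1) l₀ = l + 1 := by omega
      rw [e1] at i1 i2 i3
      simp only [e2, run_seq, run_store, run_assign, Expr.eval_add, Expr.eval_var, Expr.eval_const,
        var_setArr, var_setVar, arr_setVar, arr_setArr, if_true, i1, t8, Nat.reduceEqDiff,
        if_false, Function.update_apply]
      refine ⟨by ring, fun p hp => ?_, fun p v => ?_⟩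
      · rw [Nat.mul_succ] at hp
        rw [if_neg (by omega)]
        exact i2 p (by omega)
      · by_cases hp : p = s.var 6 + d * l
        · rw [if_pos hp, add_left_inj]
          constructor
          · rintro rfl
            exact .inr ⟨rfl, l, by omega, hp⟩
          · have hnot : ¬ old p v := by
              intro ho
              have := (i3 p v).2 (.inl ho)
              rw [i2 p hp.ge] at this
              omega
            rintro (ho | ⟨rfl, -⟩)
            · exact absurd ho hnot
            · rfl
        · rw [if_neg hp, i3]
          refine or_congr_right (and_congr_right fun _ => ⟨?_, ?_⟩)
          · rintro ⟨j, hj, hpj⟩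
            exact ⟨j, by omega, hpj⟩
          · rintro ⟨j, hj, hpj⟩
            refine ⟨j, lt_of_le_of_ne (by omega) ?_, hpj⟩
            rintro rfl
            exact hp hpj
    · have e2 : min (l + 1) l₀ = min l l₀ := by omega
      simp only [e2, run_skip, var_setVar, arr_setVar, Nat.reduceEqDiff, if_false]
      exact ⟨i1, i2, i3⟩)
  rw [Nat.min_eq_right hl] at key
  exact key

theorem run_scanCmd {s : State} {n h d bs mark : ℕ} (hn : 0 < n ∧ n < 6) (hbs : bs ≠ 0)
    (hmark : mark ≠ 0) (hne : bs ≠ mark) (hd : 0 < d) {off c : ℕ → ℕ} (hN : s.var n ≤ s.var 0)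
    (h6 : s.var 6 = off 0) (hoff : ∀ u < s.var n, off (u + 1) = off u + (h + 1) + d * c u)
    (hw : ∀ u < s.var n, s.arr 0 (off u + h) = c u) (hc : ∀ u < s.var n, c u ≤ s.var 0)
    (hz : ∀ p, s.arr mark p = 0) :
    let t := (scanCmd n h d bs mark).run s
    t.var 6 = off (s.var n) ∧ (∀ u < s.var n, t.arr bs u = off u) ∧
      ∀ p u, t.arr mark p = u + 1 ↔ u < s.var n ∧ ∃ j < c u, p = off u + (h + 1) + d * j := by
  obtain ⟨N, hN'⟩ : ∃ N, s.var n = N := ⟨_, rfl⟩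
  rw [hN'] at hN hoff hw hc ⊢
  have key := run_loop_inv (x := 8) (s := s) (c := .cond (.lt (.var 8) (.var n))
    (.seq (.store bs (.var 8) (.var 6)) <|
      .seq (.assign 7 (.get 0 (.add (.var 6) (.const h)))) <|
      .seq (.assign 6 (.add (.var 6) (.const (h + 1)))) <|
      .loop 9 <| .cond (.lt (.var 9) (.var 7))
        (.seq (.store mark (.var 6) (.add (.var 8) (.const 1))) <|
          .assign 6 (.add (.var 6) (.const d))) .skip) .skip)
    (fun l t => t.var 6 = off (min l N) ∧ (∀ u < min l N, t.arr bs u = off u) ∧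
      (∀ p, off (min l N) ≤ p → t.arr mark p = 0) ∧
      ∀ p u, t.arr mark p = u + 1 ↔ u < min l N ∧ ∃ j < c u, p = off u + (h + 1) + d * j)
    (by simp [h6, hz]) (by
    rintro l - t ht ⟨i1, i2, i3, i4⟩
    have tn : t.var n = N := (ht.1 n (by simp [Cmd.vars]; omega)).trans hN'
    have t0 : t.var 0 = s.var 0 := ht.1 0 (by simp [Cmd.vars])
    have ta : t.arr 0 = s.arr 0 := ht.2 0 (by simp [Cmd.arrs]; omega)
    have hn8 : n ≠ 8 := by omega
    rw [run_cond]
    simp only [Expr.holds_lt, Expr.eval_var, var_setVar, if_true, if_neg hn8, tn]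
    split_ifs with hl
    · have e1 : min l N = l := by omega
      have e2 : min (l + 1) N = l + 1 := by omega
      rw [e1] at i1 i2 i3 i4
      rw [e2, run_seq, run_seq, run_seq]
      set u := (Cmd.assign 6 (.add (.var 6) (.const (h + 1)))).run
        ((Cmd.assign 7 (.get 0 (.add (.var 6) (.const h)))).run
          ((Cmd.store bs (.var 8) (.var 6)).run (t.setVar 8 l))) with hu
      have u0 : u.var 0 = s.var 0 := by simp [hu, t0]
      have u7 : u.var 7 = c l := by simp [hu, i1, hbs.symm, ta, hw l hl]
      have u8 : u.var 8 = l := by simp [hu]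
      have u6 : u.var 6 = off l + (h + 1) := by simp [hu, i1]
      have um : u.arr mark = t.arr mark := by simp [hu, hne.symm]
      have ub : u.arr bs = Function.update (t.arr bs) l (off l) := by simp [hu, i1]
      have hin := run_scanCmd_inner (s := u) (mark := mark) (d := d) (u := l) (l₀ := c l)
        (old := fun p v => v < l ∧ ∃ j < c v, p = off v + (h + 1) + d * j) hd
        (by rw [u0]; exact hc l hl) u7 u8
        (fun p hp => by rw [um]; exact i3 p (by omega)) (fun p v => by rw [um]; exact i4 p v)
      have hf := frame_run (Cmd.loop 9 <| .cond (.lt (.var 9) (.var 7))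
        (.seq (.store mark (.var 6) (.add (.var 8) (.const 1))) <|
          .assign 6 (.add (.var 6) (.const d))) .skip) u
      rw [u6] at hin
      refine ⟨?_, fun v hv => ?_, fun p hp => ?_, fun p v => ?_⟩
      · rw [hin.1, hoff l hl]
      · rw [hf.2 bs (by simpa [Cmd.arrs] using hne), ub, Function.update_apply]
        split_ifs with h
        · rw [h]
        · exact i2 v (by omega)
      · rw [hoff l hl] at hp
        exact hin.2.1 p hp
      · rw [hin.2.2, Nat.lt_succ_iff_lt_or_eq, or_and_right]
        refine or_congr_right ⟨?_, ?_⟩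
        · rintro ⟨rfl, hj⟩; exact ⟨rfl, hj⟩
        · rintro ⟨rfl, hj⟩; exact ⟨rfl, hj⟩
    · have e2 : min (l + 1) N = min l N := by omega
      simp only [e2, run_skip, var_setVar, arr_setVar, Nat.reduceEqDiff, if_false]
      exact ⟨i1, i2, i3, i4⟩)
  rw [Nat.min_eq_right hN] at key
  exact ⟨key.1, key.2.1, key.2.2.2⟩

/-- The positions of the blocks of a word. -/
theorem exists_offsets {N : ℕ} (b : Fin N → List ℕ) (pre post : List ℕ) :
    ∃ off : ℕ → ℕ, off 0 = pre.length ∧ off N = (pre ++ (List.finRange N).flatMap b).length ∧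
      ∀ u : Fin N, off (u + 1) = off u + (b u).length ∧
        off (u + 1) ≤ (pre ++ (List.finRange N).flatMap b ++ post).length ∧
        ∀ i < (b u).length,
          (pre ++ (List.finRange N).flatMap b ++ post).getD (off u + i) 0 = (b u).getD i 0 := by
  induction N generalizing pre with
  | zero => exact ⟨fun _ => pre.length, by simp, by simp, fun u => u.elim0⟩
  | succ N ih =>
    obtain ⟨off, h0, hN, h⟩ := ih (fun u => b u.succ) (pre ++ b 0)
    have hw : pre ++ (List.finRange (N + 1)).flatMap b =
        pre ++ b 0 ++ (List.finRange N).flatMap fun u => b u.succ := by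
      simp [List.finRange_succ, List.flatMap_map]
    rw [hw]
    refine ⟨fun i => i.casesOn pre.length off, rfl, hN,
      Fin.cases ⟨?_, ?_, fun i hi => ?_⟩ fun u => ?_⟩
    · simp [h0]
    · simp [h0]
    · have : pre.length + i < (pre ++ b 0).length := by simpa using hi
      change (_ ++ _ ++ _ ++ _ : List ℕ).getD (pre.length + i) 0 = _
      rw [List.append_assoc, List.getD_append _ _ _ _ this,
        List.getD_append_right _ _ _ _ (by omega), Nat.add_sub_cancel_left]
    · exact h u

/-- What the arrays say about the instance: array 0 holds the input word; array 3 marks the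
positions of the temporal vertices, array 5 those of the temporal edges, and array 7 those of the
elements of the root sets; array 4 holds the positions of the edges. -/
structure Parsed {n m k : ℕ} (G : TemporalDigraph (Fin n) (Fin m)) (R : Fin k → Finset (Fin n × ℕ))
    (L : ℕ) (a : ℕ → ℕ → ℕ) : Prop where
  pos : 0 < L
  le : k ≤ L
  vertex : ∀ p v', a 3 p = v' + 1 → p < L ∧ ∃ v : Fin n, (v : ℕ) = v' ∧ a 0 p ∈ G.act v
  exists_vertex : ∀ v, ∀ t ∈ G.act v, ∃ p, a 3 p = v + 1 ∧ a 0 p = t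
  vertex_inj : ∀ p p' v, a 3 p = v + 1 → a 3 p' = v + 1 → a 0 p = a 0 p' → p = p'
  edge : ∀ q e', a 5 q = e' + 1 →
    q < L ∧ ∃ e : Fin m, (e : ℕ) = e' ∧ (a 0 q, a 0 (q + 1)) ∈ G.app e
  exists_edge : ∀ e, ∀ x ∈ G.app e, ∃ q, a 5 q = e + 1 ∧ a 0 q = x.1 ∧ a 0 (q + 1) = x.2
  edge_inj : ∀ q q' e, a 5 q = e + 1 → a 5 q' = e + 1 → a 0 q = a 0 q' →
    a 0 (q + 1) = a 0 (q' + 1) → q = q'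
  src : ∀ e : Fin m, a 0 (a 4 e) = G.src e
  tgt : ∀ e : Fin m, a 0 (a 4 e + 1) = G.tgt e
  root : ∀ z i', a 7 z = i' + 1 →
    z < L ∧ ∃ i : Fin k, (i : ℕ) = i' ∧ ∃ x ∈ R i, a 0 z = x.1 ∧ a 0 (z + 1) = x.2
  exists_root : ∀ i, ∀ x ∈ R i, ∃ z, a 7 z = i + 1 ∧ a 0 z = x.1 ∧ a 0 (z + 1) = x.2

/-- Read the input. -/
def parseCmd : Cmd :=
  .seq (.assign 3 (.get 0 (.const 0))) <|
  .seq (.assign 4 (.get 0 (.const 1))) <|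
  .seq (.assign 5 (.get 0 (.const 2))) <|
  .seq (.assign 6 (.const 3)) <|
  .seq (scanCmd 3 0 1 2 3) <| .seq (scanCmd 4 2 2 4 5) (scanCmd 5 0 2 6 7)

theorem getD_flatMap_singleton (l : List ℕ) (j : ℕ) :
    (l.flatMap fun t => [t]).getD j 0 = l.getD j 0 := by
  simp

theorem getD_flatMap_pair {α : Type*} (f g : α → ℕ) (l : List α) (j : ℕ) (hj : j < l.length) :
    (l.flatMap fun x => [f x, g x]).getD (2 * j) 0 = f l[j] ∧
      (l.flatMap fun x => [f x, g x]).getD (2 * j + 1) 0 = g l[j] := by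
  induction l generalizing j with
  | nil => simp at hj
  | cons x l ih =>
    cases j with
    | zero => simp
    | succ j => simpa [Nat.mul_succ] using ih j (by simpa using hj)

theorem length_flatMap_pair {α : Type*} (f g : α → ℕ) (l : List α) :
    (l.flatMap fun x => [f x, g x]).length = 2 * l.length := by
  induction l with
  | nil => rfl
  | cons x l ih => simp at ih ⊢; omega

/-- The parts of the input have the form that `scanCmd` expects. -/
theorem exists_scan {N h d : ℕ} (hd : 0 < d) (hdr : Fin N → List ℕ) (len : Fin N → ℕ)
    (body : Fin N → List ℕ) (hh : ∀ u, (hdr u).length = h)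
    (hb : ∀ u, (body u).length = d * len u) {w pre post : List ℕ}
    (hw : w = pre ++ (List.finRange N).flatMap (fun u => hdr u ++ len u :: body u) ++ post) :
    ∃ off c : ℕ → ℕ, off 0 = pre.length ∧
      off N = (pre ++ (List.finRange N).flatMap fun u => hdr u ++ len u :: body u).length ∧
      N ≤ w.length ∧
      (∀ u < N, off (u + 1) = off u + (h + 1) + d * c u) ∧
      (∀ u < N, w.getD (off u + h) 0 = c u) ∧ (∀ u < N, c u ≤ w.length) ∧
      (∀ u : Fin N, c u = len u) ∧
      (∀ u : Fin N, ∀ i < h, w.getD (off u + i) 0 = (hdr u).getD i 0) ∧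
      ∀ u : Fin N, ∀ i < d * len u, off u + (h + 1) + i < w.length ∧
        w.getD (off u + (h + 1) + i) 0 = (body u).getD i 0 := by
  obtain ⟨off, h0, hN, hoff⟩ := exists_offsets (fun u => hdr u ++ len u :: body u) pre post
  rw [← hw] at hoff
  have hlen : ∀ u, (hdr u ++ len u :: body u).length = h + 1 + d * len u := by
    intro u
    simp only [List.length_append, List.length_cons, hh, hb]
    omega
  simp only [hlen] at hoff
  have hmono : ∀ u ≤ N, u ≤ off u := by
    intro u
    induction u with
    | zero => intro _; exact Nat.zero_le _
    | succ u ih =>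
      intro hu
      have := (hoff ⟨u, hu⟩).1
      have := ih (by omega)
      dsimp only at *
      omega
  refine ⟨off, fun u => if hu : u < N then len ⟨u, hu⟩ else 0, h0, hN, ?_, ?_, ?_, ?_, ?_, ?_, ?_⟩
  · refine (hmono N le_rfl).trans ?_
    rw [hN, hw]
    simp
  · intro u hu
    have := (hoff ⟨u, hu⟩).1
    simp only [hu, dite_true] at this ⊢
    omega
  · intro u hu
    have := (hoff ⟨u, hu⟩).2.2 h (by omega)
    simp only [hu, dite_true] at this ⊢
    rw [this, List.getD_append_right _ _ _ _ (by rw [hh]), hh, Nat.sub_self, List.getD_cons_zero]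
  · intro u hu
    obtain ⟨h1, h2, -⟩ := hoff ⟨u, hu⟩
    simp only [hu, dite_true] at h1 h2 ⊢
    have := Nat.le_mul_of_pos_left (len ⟨u, hu⟩) hd
    omega
  · intro u
    simp
  · intro u i hi
    rw [(hoff u).2.2 i (by omega), List.getD_append _ _ _ _ (by rwa [hh])]
  · intro u i hi
    obtain ⟨h1, h2, h3⟩ := hoff u
    have := h3 (h + 1 + i) (by omega)
    rw [← add_assoc] at this
    refine ⟨by omega, ?_⟩
    rw [this, List.getD_append_right _ _ _ _ (by rw [hh]; omega), hh,
      show h + 1 + i - h = i + 1 by omega, List.getD_cons_succ]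

theorem run_parseCmd {n m k : ℕ} {G : TemporalDigraph (Fin n) (Fin m)}
    {R : Fin k → Finset (Fin n × ℕ)} {w : List ℕ} (henc : EncodesInstance G R w) {s : State}
    (hK : w.length ≤ s.var 0) (hw : s.arr 0 = fun i => w.getD i 0)
    (hz : ∀ a, a ≠ 0 → ∀ i, s.arr a i = 0) :
    (parseCmd.run s).var 5 = k ∧ Parsed G R w.length (parseCmd.run s).arr := by
  obtain ⟨g, l, r, hg, hl, hr, hwe⟩ := henc
  set bV : Fin n → List ℕ := fun v => encodeList (fun t => [t]) (g v) with hbV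
  set bE : Fin m → List ℕ := fun e =>
    [(G.src e : ℕ), (G.tgt e : ℕ)] ++ encodeList (fun p => [p.1, p.2]) (l e) with hbE
  set bR : Fin k → List ℕ := fun i => encodeList (fun x => [(x.1 : ℕ), x.2]) (r i) with hbR
  obtain ⟨oV, cV, v0, vN, vle, voff, vw, vc, vlen, -, vbody⟩ := exists_scan (h := 0) one_pos
    (fun _ => []) (fun v => (g v).length) (fun v => (g v).flatMap fun t => [t]) (fun _ => rfl)
    (fun v => by simp) (w := w) (pre := [n, m, k])
    (post := (List.finRange m).flatMap bE ++ (List.finRange k).flatMap bR)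
    (by rw [hwe]; simp only [List.append_assoc]; rfl)
  obtain ⟨oE, cE, e0, eN, ele, eoff, ew, ec, elen, ehdr, ebody⟩ := exists_scan (h := 2) two_pos
    (fun e => [(G.src e : ℕ), (G.tgt e : ℕ)]) (fun e => (l e).length)
    (fun e => (l e).flatMap fun p => [p.1, p.2]) (fun _ => rfl)
    (fun e => length_flatMap_pair (fun p : ℕ × ℕ => p.1) (fun p => p.2) _) (w := w)
    (pre := [n, m, k] ++ (List.finRange n).flatMap bV)
    (post := (List.finRange k).flatMap bR) hwe
  obtain ⟨oR, cR, r0, rN, rle, roff, rw', rc, rlen, -, rbody⟩ := exists_scan (h := 0) two_pos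
    (fun _ => []) (fun i => (r i).length) (fun i => (r i).flatMap fun x => [(x.1 : ℕ), x.2])
    (fun _ => rfl)
    (fun i => length_flatMap_pair (fun x : Fin n × ℕ => (x.1 : ℕ)) (fun x => x.2) _) (w := w)
    (pre := [n, m, k] ++ (List.finRange n).flatMap bV ++ (List.finRange m).flatMap bE) (post := [])
    (by rw [List.append_nil]; exact hwe)
  have w0 : w.getD 0 0 = n := by rw [hwe]; simp
  have w1 : w.getD 1 0 = m := by rw [hwe]; simp
  have w2 : w.getD 2 0 = k := by rw [hwe]; simp
  have hpos : 0 < w.length := by rw [hwe]; simp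
  rw [parseCmd]
  simp only [run_seq]
  set s1 := (Cmd.assign 6 (.const 3)).run ((Cmd.assign 5 (.get 0 (.const 2))).run
    ((Cmd.assign 4 (.get 0 (.const 1))).run ((Cmd.assign 3 (.get 0 (.const 0))).run s))) with hs1
  have a1 : s1.arr = s.arr := rfl
  have k1 : s1.var 0 = s.var 0 := by simp [hs1]
  have n1 : s1.var 3 = n := by simpa [hs1, hw] using w0
  have m1 : s1.var 4 = m := by simpa [hs1, hw] using w1
  have r1 : s1.var 5 = k := by simpa [hs1, hw] using w2
  have p1 : s1.var 6 = 3 := by simp [hs1]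
  have A := run_scanCmd (s := s1) (n := 3) (h := 0) (d := 1) (bs := 2) (mark := 3) (by decide)
    (by decide) (by decide) (by decide) one_pos (off := oV) (c := cV) (by omega)
    (by rw [p1, v0]; rfl) (by rwa [n1]) (by rw [n1, a1, hw]; exact vw)
    (by rw [n1, k1]; exact fun u hu => (vc u hu).trans hK)
    (hz 3 (by decide))
  have fA := frame_run (scanCmd 3 0 1 2 3) s1
  set s2 := (scanCmd 3 0 1 2 3).run s1
  rw [n1] at A
  have k2 : s2.var 0 = s.var 0 := (fA.1 0 (by decide)).trans k1
  have m2 : s2.var 4 = m := (fA.1 4 (by decide)).trans m1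
  have r2 : s2.var 5 = k := (fA.1 5 (by decide)).trans r1
  have w2' : s2.arr 0 = fun i => w.getD i 0 := (fA.2 0 (by decide)).trans hw
  have B := run_scanCmd (s := s2) (n := 4) (h := 2) (d := 2) (bs := 4) (mark := 5) (by decide)
    (by decide) (by decide) (by decide) two_pos (off := oE) (c := cE) (by omega)
    (by rw [A.1, e0, vN]; rfl)
    (by rwa [m2]) (by rw [m2, w2']; exact ew) (by rw [m2, k2]; exact fun u hu => (ec u hu).trans hK)
    (by rw [fA.2 5 (by decide)]; exact hz 5 (by decide))
  have fB := frame_run (scanCmd 4 2 2 4 5) s2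
  set s3 := (scanCmd 4 2 2 4 5).run s2
  rw [m2] at B
  have k3 : s3.var 0 = s.var 0 := (fB.1 0 (by decide)).trans k2
  have r3 : s3.var 5 = k := (fB.1 5 (by decide)).trans r2
  have w3' : s3.arr 0 = fun i => w.getD i 0 := (fB.2 0 (by decide)).trans w2'
  have C := run_scanCmd (s := s3) (n := 5) (h := 0) (d := 2) (bs := 6) (mark := 7) (by decide)
    (by decide) (by decide) (by decide) two_pos (off := oR) (c := cR) (by omega)
    (by rw [B.1, r0, eN]; rfl)
    (by rwa [r3]) (by rw [r3, w3']; exact rw')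
    (by rw [r3, k3]; exact fun u hu => (rc u hu).trans hK)
    (by rw [fB.2 7 (by decide), fA.2 7 (by decide)]; exact hz 7 (by decide))
  have fC := frame_run (scanCmd 5 0 2 6 7) s3
  set s4 := (scanCmd 5 0 2 6 7).run s3
  rw [r3] at C
  have b0 : s4.arr 0 = fun i => w.getD i 0 := (fC.2 0 (by decide)).trans w3'
  have b3 : ∀ p u, s4.arr 3 p = u + 1 ↔ u < n ∧ ∃ j < cV u, p = oV u + (0 + 1) + 1 * j := by
    rw [fC.2 3 (by decide), fB.2 3 (by decide)]; exact A.2.2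
  have b4 : ∀ u < m, s4.arr 4 u = oE u := by
    rw [fC.2 4 (by decide)]; exact B.2.1
  have b5 : ∀ p u, s4.arr 5 p = u + 1 ↔ u < m ∧ ∃ j < cE u, p = oE u + (2 + 1) + 2 * j := by
    rw [fC.2 5 (by decide)]; exact B.2.2
  have hV : ∀ v : Fin n, ∀ j (hj : j < (g v).length), oV v + (0 + 1) + 1 * j < w.length ∧
      s4.arr 0 (oV v + (0 + 1) + 1 * j) = (g v)[j] := by
    intro v j hj
    obtain ⟨h1, h2⟩ := vbody v (1 * j) (by omega)
    refine ⟨h1, ?_⟩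
    rw [b0]
    dsimp only
    rw [h2, one_mul, getD_flatMap_singleton, List.getD_eq_getElem _ _ hj]
  have hE : ∀ e : Fin m, ∀ j (hj : j < (l e).length), oE e + (2 + 1) + 2 * j < w.length ∧
      s4.arr 0 (oE e + (2 + 1) + 2 * j) = (l e)[j].1 ∧
      s4.arr 0 (oE e + (2 + 1) + 2 * j + 1) = (l e)[j].2 := by
    intro e j hj
    obtain ⟨h1, h2⟩ := ebody e (2 * j) (by omega)
    obtain ⟨-, h3⟩ := ebody e (2 * j + 1) (by omega)
    obtain ⟨h4, h5⟩ := getD_flatMap_pair (fun p : ℕ × ℕ => p.1) (fun p => p.2) (l e) j hj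
    refine ⟨h1, ?_, ?_⟩
    · rw [b0, ← h4, ← h2]
    · rw [b0, ← h5, ← h3]; rfl
  have hR : ∀ i : Fin k, ∀ j (hj : j < (r i).length), oR i + (0 + 1) + 2 * j < w.length ∧
      s4.arr 0 (oR i + (0 + 1) + 2 * j) = (r i)[j].1 ∧
      s4.arr 0 (oR i + (0 + 1) + 2 * j + 1) = (r i)[j].2 := by
    intro i j hj
    obtain ⟨h1, h2⟩ := rbody i (2 * j) (by omega)
    obtain ⟨-, h3⟩ := rbody i (2 * j + 1) (by omega)
    obtain ⟨h4, h5⟩ := getD_flatMap_pair (fun x : Fin n × ℕ => (x.1 : ℕ)) (fun x => x.2) (r i) j hj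
    refine ⟨h1, ?_, ?_⟩
    · rw [b0, ← h4, ← h2]
    · rw [b0, ← h5, ← h3]; rfl
  refine ⟨(fC.1 5 (by decide)).trans r3, hpos, rle, ?_, ?_, ?_, ?_, ?_, ?_, ?_, ?_, ?_, ?_⟩
  · intro p v' hp
    obtain ⟨hv, j, hj, rfl⟩ := (b3 p v').1 hp
    have hj' : j < (g ⟨v', hv⟩).length := by rw [← vlen ⟨v', hv⟩]; exact hj
    obtain ⟨h1, h2⟩ := hV ⟨v', hv⟩ j hj'
    refine ⟨h1, ⟨v', hv⟩, rfl, ?_⟩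
    dsimp only at h2
    rw [h2, ← (hg _).2]
    exact List.getElem_mem _
  · intro v t ht
    obtain ⟨j, hj, rfl⟩ := List.getElem_of_mem (((hg v).2 t).2 ht)
    exact ⟨_, (b3 _ _).2 ⟨v.2, j, by rwa [vlen], rfl⟩, (hV v j hj).2⟩
  · intro p p' v hp hp' he
    obtain ⟨hv, j, hj, rfl⟩ := (b3 p v).1 hp
    obtain ⟨-, j', hj', rfl⟩ := (b3 p' v).1 hp'
    have h1 : j < (g ⟨v, hv⟩).length := by rw [← vlen ⟨v, hv⟩]; exact hj
    have h2 : j' < (g ⟨v, hv⟩).length := by rw [← vlen ⟨v, hv⟩]; exact hj'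
    have e1 := (hV ⟨v, hv⟩ j h1).2
    have e2 := (hV ⟨v, hv⟩ j' h2).2
    dsimp only at e1 e2
    rw [e1, e2] at he
    rw [((hg ⟨v, hv⟩).1.getElem_inj_iff).1 he]
  · intro q e' hq
    obtain ⟨he, j, hj, rfl⟩ := (b5 q e').1 hq
    have hj' : j < (l ⟨e', he⟩).length := by rw [← elen ⟨e', he⟩]; exact hj
    obtain ⟨h1, h2, h3⟩ := hE ⟨e', he⟩ j hj'
    refine ⟨h1, ⟨e', he⟩, rfl, ?_⟩
    dsimp only at h2 h3
    rw [h2, h3, ← (hl _).2]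
    exact List.getElem_mem _
  · intro e x hx
    obtain ⟨j, hj, rfl⟩ := List.getElem_of_mem (((hl e).2 x).2 hx)
    exact ⟨_, (b5 _ _).2 ⟨e.2, j, by rwa [elen], rfl⟩, (hE e j hj).2⟩
  · intro q q' e hq hq' he1 he2
    obtain ⟨he, j, hj, rfl⟩ := (b5 q e).1 hq
    obtain ⟨-, j', hj', rfl⟩ := (b5 q' e).1 hq'
    have h1 : j < (l ⟨e, he⟩).length := by rw [← elen ⟨e, he⟩]; exact hj
    have h2 : j' < (l ⟨e, he⟩).length := by rw [← elen ⟨e, he⟩]; exact hj'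
    obtain ⟨-, e1, e2⟩ := hE ⟨e, he⟩ j h1
    obtain ⟨-, e3, e4⟩ := hE ⟨e, he⟩ j' h2
    dsimp only at e1 e2 e3 e4
    rw [e1, e3] at he1
    rw [e2, e4] at he2
    rw [((hl ⟨e, he⟩).1.getElem_inj_iff).1 (Prod.ext he1 he2)]
  · intro e
    rw [b4 e e.2, b0]
    exact ehdr e 0 (by decide)
  · intro e
    rw [b4 e e.2, b0]
    exact ehdr e 1 (by decide)
  · intro z i' hi
    obtain ⟨hi', j, hj, rfl⟩ := (C.2.2 z i').1 hi
    have hj' : j < (r ⟨i', hi'⟩).length := by rw [← rlen ⟨i', hi'⟩]; exact hj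
    obtain ⟨h1, h2, h3⟩ := hR ⟨i', hi'⟩ j hj'
    exact ⟨h1, ⟨i', hi'⟩, rfl, _, ((hr _).2 _).1 (List.getElem_mem hj'), h2, h3⟩
  · intro i x hx
    obtain ⟨j, hj, rfl⟩ := List.getElem_of_mem (((hr i).2 x).2 hx)
    exact ⟨_, (C.2.2 _ _).2 ⟨i.2, j, by rwa [rlen], rfl⟩, (hR i j hj).2⟩

end Edmonds

/-! ### The contracted instance -/

namespace Edmonds

open LoopLang
open Ram (State)

/-- Mark in array 8 the positions of the starts. -/
def startCmd : Cmd :=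
  .fill 8 10 <| .cond (.conj (.get 3 (.var 10)) <| .neg <| .ex 11 <|
      .conj (.eq (.get 3 (.var 11)) (.get 3 (.var 10)))
        (.eq (.add (.get 0 (.var 11)) (.const 1)) (.get 0 (.var 10))))
    (.const 1) (.const 0)

/-- Put the positions of the heads of the temporal edges into array 9. -/
def headCmd : Cmd :=
  .fill 9 10 <| .sum 11 <| .cond (.conj
      (.eq (.get 3 (.var 11))
        (.add (.get 0 (.add (.get 4 (.sub (.get 5 (.var 10)) (.const 1))) (.const 1))) (.const 1)))
      (.eq (.get 0 (.var 11)) (.get 0 (.add (.var 10) (.const 1)))))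
    (.var 11) (.const 0)

/-- Put the positions of the starts of the tails of the temporal edges into array 10. -/
def tailCmd : Cmd :=
  .fill 10 10 <| .sum 11 <| .cond (.conj (.get 8 (.var 11)) <|
      .conj (.eq (.get 3 (.var 11))
        (.add (.get 0 (.get 4 (.sub (.get 5 (.var 10)) (.const 1)))) (.const 1))) <|
      .conj (.le (.get 0 (.var 11)) (.get 0 (.var 10))) <|
      .neg <| .ex 12 <| .conj (.get 8 (.var 12)) <|
        .conj (.eq (.get 3 (.var 12)) (.get 3 (.var 11))) <|
        .conj (.lt (.get 0 (.var 11)) (.get 0 (.var 12)))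
          (.le (.get 0 (.var 12)) (.get 0 (.var 10))))
    (.var 11) (.const 0)

/-- Set array 11 to `0`, "available", for the temporal edges that lead to starts. -/
def ownerCmd : Cmd :=
  .fill 11 10 <| .cond (.conj (.get 5 (.var 10)) (.get 8 (.get 9 (.var 10)))) (.const 0) (.var 0)

/-- Set the matrix 12 to the roots.  The colour of the branching `i` is `L + i`.  Colours without a
branching and positions other than those of starts are filled up. -/
def rootCmd : Cmd :=
  .fillMatrix 12 10 11 <| .cond (.conj (.conj (.le (.var 2) (.var 10)) (.lt (.var 11) (.var 2))) <|
      .disj (.le (.add (.var 2) (.var 5)) (.var 10)) <| .disj (.neg (.get 8 (.var 11))) <|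
      .ex 12 <| .conj (.eq (.get 7 (.var 12)) (.add (.sub (.var 10) (.var 2)) (.const 1))) <|
        .conj (.eq (.add (.get 0 (.var 12)) (.const 1)) (.get 3 (.var 11)))
          (.eq (.get 0 (.add (.var 12) (.const 1))) (.get 0 (.var 11))))
    (.const 1) (.const 0)

/-- Test in variable 31 whether some root is not a start. -/
def badRootCmd : Cmd :=
  .assign 31 <| .ex 10 <| .conj (.get 7 (.var 10)) <| .ex 11 <|
    .conj (.eq (.get 3 (.var 11)) (.add (.get 0 (.var 10)) (.const 1))) <|
    .conj (.eq (.get 0 (.var 11)) (.get 0 (.add (.var 10) (.const 1)))) (.neg (.get 8 (.var 11)))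

/-- Build the contracted instance. -/
def contractCmd : Cmd :=
  .seq startCmd <| .seq headCmd <| .seq tailCmd <| .seq ownerCmd <| .seq rootCmd badRootCmd

/-- What the arrays say about the contracted instance, in which each waiting interval is
represented by its start. -/
structure Contracted {n m k : ℕ} (G : TemporalDigraph (Fin n) (Fin m))
    (R : Fin k → Finset (Fin n × ℕ)) (L K : ℕ) (a : ℕ → ℕ → ℕ) (bad : ℕ) : Prop
    extends Parsed G R L a where
  start_iff : ∀ p (v : Fin n), a 3 p = v + 1 → (a 8 p ≠ 0 ↔ G.IsStart (v, a 0 p))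
  start_vertex : ∀ p < K, a 8 p ≠ 0 → a 3 p ≠ 0
  head : ∀ q (e : Fin m), a 5 q = e + 1 → ∀ p, a 3 p = G.tgt e + 1 → a 0 p = a 0 (q + 1) → a 9 q = p
  tail : ∀ q (e : Fin m), a 5 q = e + 1 → ∀ p y, G.StartOf (G.src e, a 0 q) y → a 3 p = y.1 + 1 →
    a 0 p = y.2 → a 10 q = p
  owner : ∀ q < K, a 11 q = if a 5 q ≠ 0 ∧ a 8 (a 9 q) ≠ 0 then 0 else K
  le_one : ∀ x < K, ∀ y < K, a 12 (K * x + y) ≤ 1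
  matrix_iff : ∀ x < K, ∀ y < K, a 12 (K * x + y) ≠ 0 ↔ (L ≤ x ∧ y < L) ∧ (L + k ≤ x ∨ a 8 y = 0 ∨
    ∃ z < K, a 7 z = x - L + 1 ∧ a 0 z + 1 = a 3 y ∧ a 0 (z + 1) = a 0 y)
  bad_iff : bad ≠ 0 ↔
    ∃ z < K, a 7 z ≠ 0 ∧ ∃ p < K, a 3 p = a 0 z + 1 ∧ a 0 p = a 0 (z + 1) ∧ a 8 p = 0

theorem Parsed.congr {n m k : ℕ} {G : TemporalDigraph (Fin n) (Fin m)}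
    {R : Fin k → Finset (Fin n × ℕ)} {L : ℕ} {a b : ℕ → ℕ → ℕ} (h : Parsed G R L a)
    (hb : ∀ i < 8, b i = a i) : Parsed G R L b := by
  have h0 := hb 0 (by decide)
  have h3 := hb 3 (by decide)
  have h4 := hb 4 (by decide)
  have h5 := hb 5 (by decide)
  have h7 := hb 7 (by decide)
  refine ⟨h.pos, h.le, ?_, ?_, ?_, ?_, ?_, ?_, ?_, ?_, ?_, ?_⟩ <;> simp only [h0, h3, h4, h5, h7]
  exacts [h.vertex, h.exists_vertex, h.vertex_inj, h.edge, h.exists_edge, h.edge_inj, h.src, h.tgt,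
    h.root, h.exists_root]

theorem sum_ite_eq_of_unique {K p : ℕ} {P : ℕ → Prop} [DecidablePred P] (hp : p < K) (h : P p)
    (hu : ∀ j < K, P j → j = p) : ∑ j ∈ range K, (if P j then j else 0) = p := by
  rw [sum_eq_single p, if_pos h]
  · intro j hj hjp
    rw [if_neg]
    exact fun hP => hjp (hu j (mem_range.1 hj) hP)
  · intro hn
    exact absurd (mem_range.2 hp) hn

open Classical in
theorem run_startCmd (s : State) : ∀ p < s.var 0, (startCmd.run s).arr 8 p =
    if s.arr 3 p ≠ 0 ∧ ¬ ∃ p' < s.var 0, s.arr 3 p' = s.arr 3 p ∧ s.arr 0 p' + 1 = s.arr 0 p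
      then 1 else 0 := by
  intro p hp
  rw [startCmd, run_fill (fun p => if s.arr 3 p ≠ 0 ∧
    ¬ ∃ p' < s.var 0, s.arr 3 p' = s.arr 3 p ∧ s.arr 0 p' + 1 = s.arr 0 p then 1 else 0)]
  · simp only [hp, if_true]
  · intro p hp t h1 h2 h3
    simp [h3, h2, h1]

open Classical in
theorem run_headCmd (s : State) : ∀ q < s.var 0, (headCmd.run s).arr 9 q =
    ∑ p ∈ range (s.var 0), if s.arr 3 p = s.arr 0 (s.arr 4 (s.arr 5 q - 1) + 1) + 1 ∧
      s.arr 0 p = s.arr 0 (q + 1) then p else 0 := by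
  intro q hq
  rw [headCmd, run_fill (fun q => ∑ p ∈ range (s.var 0),
    if s.arr 3 p = s.arr 0 (s.arr 4 (s.arr 5 q - 1) + 1) + 1 ∧
      s.arr 0 p = s.arr 0 (q + 1) then p else 0)]
  · simp only [hq, if_true]
  · intro p hp t h1 h2 h3
    simp [h3, h2, h1]

open Classical in
theorem run_tailCmd (s : State) : ∀ q < s.var 0, (tailCmd.run s).arr 10 q =
    ∑ p ∈ range (s.var 0), if s.arr 8 p ≠ 0 ∧ s.arr 3 p = s.arr 0 (s.arr 4 (s.arr 5 q - 1)) + 1 ∧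
      s.arr 0 p ≤ s.arr 0 q ∧ ¬ ∃ p' < s.var 0, s.arr 8 p' ≠ 0 ∧ s.arr 3 p' = s.arr 3 p ∧
        s.arr 0 p < s.arr 0 p' ∧ s.arr 0 p' ≤ s.arr 0 q then p else 0 := by
  intro q hq
  rw [tailCmd, run_fill (fun q => ∑ p ∈ range (s.var 0),
    if s.arr 8 p ≠ 0 ∧ s.arr 3 p = s.arr 0 (s.arr 4 (s.arr 5 q - 1)) + 1 ∧
      s.arr 0 p ≤ s.arr 0 q ∧ ¬ ∃ p' < s.var 0, s.arr 8 p' ≠ 0 ∧ s.arr 3 p' = s.arr 3 p ∧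
        s.arr 0 p < s.arr 0 p' ∧ s.arr 0 p' ≤ s.arr 0 q then p else 0)]
  · simp only [hq, if_true]
  · intro p hp t h1 h2 h3
    simp [h3, h2, h1]

theorem run_ownerCmd (s : State) : ∀ q < s.var 0, (ownerCmd.run s).arr 11 q =
    if s.arr 5 q ≠ 0 ∧ s.arr 8 (s.arr 9 q) ≠ 0 then 0 else s.var 0 := by
  intro q hq
  rw [ownerCmd, run_fill (fun q => if s.arr 5 q ≠ 0 ∧ s.arr 8 (s.arr 9 q) ≠ 0 then 0 else s.var 0)]
  · simp only [hq, if_true]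
  · intro p hp t h1 h2 h3
    simp [h3, h2, h1]

open Classical in
theorem run_rootCmd (s : State) : ∀ x < s.var 0, ∀ y < s.var 0,
    (rootCmd.run s).arr 12 (s.var 0 * x + y) =
      if (s.var 2 ≤ x ∧ y < s.var 2) ∧ (s.var 2 + s.var 5 ≤ x ∨ s.arr 8 y = 0 ∨
        ∃ z < s.var 0, s.arr 7 z = x - s.var 2 + 1 ∧ s.arr 0 z + 1 = s.arr 3 y ∧
          s.arr 0 (z + 1) = s.arr 0 y) then 1 else 0 := by
  refine run_fillMatrix (by decide) (by decide) (by decide) (by decide) (fun x y =>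
      if (s.var 2 ≤ x ∧ y < s.var 2) ∧ (s.var 2 + s.var 5 ≤ x ∨ s.arr 8 y = 0 ∨
        ∃ z < s.var 0, s.arr 7 z = x - s.var 2 + 1 ∧ s.arr 0 z + 1 = s.arr 3 y ∧
          s.arr 0 (z + 1) = s.arr 0 y) then 1 else 0) ?_
  intro x hx y hy t h1 h2 h3 h4
  simp [h4, h3, h2, h1]

theorem run_contractCmd {n m k : ℕ} {G : TemporalDigraph (Fin n) (Fin m)}
    {R : Fin k → Finset (Fin n × ℕ)} {s : State} (h : Parsed G R (s.var 2) s.arr)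
    (hL : s.var 2 ≤ s.var 0) (hk : s.var 5 = k) :
    Contracted G R (s.var 2) (s.var 0) (contractCmd.run s).arr ((contractCmd.run s).var 31) := by
  classical
  obtain ⟨K, hK⟩ : ∃ K, s.var 0 = K := ⟨_, rfl⟩
  obtain ⟨L, hL'⟩ : ∃ L, s.var 2 = L := ⟨_, rfl⟩
  rw [contractCmd]
  simp only [run_seq]
  have A := run_startCmd s
  have fA := frame_run startCmd s
  set s1 := startCmd.run s
  have B := run_headCmd s1
  have fB := frame_run headCmd s1
  set s2 := headCmd.run s1
  have C := run_tailCmd s2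
  have fC := frame_run tailCmd s2
  set s3 := tailCmd.run s2
  have D := run_ownerCmd s3
  have fD := frame_run ownerCmd s3
  set s4 := ownerCmd.run s3
  have F := run_rootCmd s4
  have fF := frame_run rootCmd s4
  set s5 := rootCmd.run s4
  have fG := frame_run badRootCmd s5
  have G' : (badRootCmd.run s5).var 31 ≠ 0 ↔ ∃ z < s5.var 0, s5.arr 7 z ≠ 0 ∧ ∃ p < s5.var 0,
      s5.arr 3 p = s5.arr 0 z + 1 ∧ s5.arr 0 p = s5.arr 0 (z + 1) ∧ s5.arr 8 p = 0 := by
    rw [badRootCmd, run_assign, var_setVar, if_pos rfl, ← Expr.Holds]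
    simp
  set s6 := badRootCmd.run s5
  have a6 : ∀ i, i ≠ 8 → i ≠ 9 → i ≠ 10 → i ≠ 11 → i ≠ 12 → s6.arr i = s.arr i := by
    intro i h8 h9 h10 h11 h12
    rw [fG.2 i (by simp [badRootCmd, Cmd.arrs]),
      fF.2 i (by simpa [rootCmd, Cmd.fillMatrix, Cmd.arrs] using h12),
      fD.2 i (by simpa [ownerCmd, Cmd.fill, Cmd.arrs] using h11),
      fC.2 i (by simpa [tailCmd, Cmd.fill, Cmd.arrs] using h10),
      fB.2 i (by simpa [headCmd, Cmd.fill, Cmd.arrs] using h9),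
      fA.2 i (by simpa [startCmd, Cmd.fill, Cmd.arrs] using h8)]
  have hP : Parsed G R L s6.arr := by
    rw [← hL']
    exact h.congr fun i hi => a6 i (by omega) (by omega) (by omega) (by omega) (by omega)
  have v1 : s1.var 0 = K := (fA.1 0 (by decide)).trans hK
  have v2 : s2.var 0 = K := (fB.1 0 (by decide)).trans v1
  have v3 : s3.var 0 = K := (fC.1 0 (by decide)).trans v2
  have v4 : s4.var 0 = K := (fD.1 0 (by decide)).trans v3
  have v5 : s5.var 0 = K := (fF.1 0 (by decide)).trans v4
  have l4 : s4.var 2 = L := by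
    rw [fD.1 2 (by decide), fC.1 2 (by decide), fB.1 2 (by decide), fA.1 2 (by decide), hL']
  have k4 : s4.var 5 = k := by
    rw [fD.1 5 (by decide), fC.1 5 (by decide), fB.1 5 (by decide), fA.1 5 (by decide), hk]
  -- all arrays in terms of the final ones
  have e2 : ∀ i, i ≠ 9 → i ≠ 10 → i ≠ 11 → i ≠ 12 → s1.arr i = s6.arr i := by
    intro i h9 h10 h11 h12
    rw [fG.2 i (by simp [badRootCmd, Cmd.arrs]),
      fF.2 i (by simpa [rootCmd, Cmd.fillMatrix, Cmd.arrs] using h12),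
      fD.2 i (by simpa [ownerCmd, Cmd.fill, Cmd.arrs] using h11),
      fC.2 i (by simpa [tailCmd, Cmd.fill, Cmd.arrs] using h10),
      fB.2 i (by simpa [headCmd, Cmd.fill, Cmd.arrs] using h9)]
  have e3 : ∀ i, i ≠ 10 → i ≠ 11 → i ≠ 12 → s2.arr i = s6.arr i := by
    intro i h10 h11 h12
    rw [fG.2 i (by simp [badRootCmd, Cmd.arrs]),
      fF.2 i (by simpa [rootCmd, Cmd.fillMatrix, Cmd.arrs] using h12),
      fD.2 i (by simpa [ownerCmd, Cmd.fill, Cmd.arrs] using h11),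
      fC.2 i (by simpa [tailCmd, Cmd.fill, Cmd.arrs] using h10)]
  have e4 : ∀ i, i ≠ 11 → i ≠ 12 → s3.arr i = s6.arr i := by
    intro i h11 h12
    rw [fG.2 i (by simp [badRootCmd, Cmd.arrs]),
      fF.2 i (by simpa [rootCmd, Cmd.fillMatrix, Cmd.arrs] using h12),
      fD.2 i (by simpa [ownerCmd, Cmd.fill, Cmd.arrs] using h11)]
  have e5 : ∀ i, i ≠ 12 → s4.arr i = s6.arr i := by
    intro i h12
    rw [fG.2 i (by simp [badRootCmd, Cmd.arrs]),
      fF.2 i (by simpa [rootCmd, Cmd.fillMatrix, Cmd.arrs] using h12)]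
  have e6 : ∀ i, s5.arr i = s6.arr i := fun i => (fG.2 i (by simp [badRootCmd, Cmd.arrs])).symm
  have e0 : ∀ i, i ≠ 8 → i ≠ 9 → i ≠ 10 → i ≠ 11 → i ≠ 12 → s.arr i = s6.arr i :=
    fun i h8 h9 h10 h11 h12 => (a6 i h8 h9 h10 h11 h12).symm
  rw [hK, e2 8 (by decide) (by decide) (by decide) (by decide),
    e0 3 (by decide) (by decide) (by decide) (by decide) (by decide),
    e0 0 (by decide) (by decide) (by decide) (by decide) (by decide)] at A
  rw [v1, e3 9 (by decide) (by decide) (by decide),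
    e2 3 (by decide) (by decide) (by decide) (by decide),
    e2 4 (by decide) (by decide) (by decide) (by decide),
    e2 5 (by decide) (by decide) (by decide) (by decide),
    e2 0 (by decide) (by decide) (by decide) (by decide)] at B
  rw [v2, e4 10 (by decide) (by decide), e3 3 (by decide) (by decide) (by decide),
    e3 4 (by decide) (by decide) (by decide), e3 5 (by decide) (by decide) (by decide),
    e3 0 (by decide) (by decide) (by decide), e3 8 (by decide) (by decide) (by decide)] at C
  rw [v3, e5 11 (by decide), e4 5 (by decide) (by decide), e4 8 (by decide) (by decide),
    e4 9 (by decide) (by decide)] at D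
  rw [v4, l4, k4, e6 12, e5 8 (by decide), e5 7 (by decide), e5 0 (by decide),
    e5 3 (by decide)] at F
  rw [v5, e6 7, e6 3, e6 0, e6 8] at G'
  rw [hK, hL'] at hL ⊢
  have hstart : ∀ p (v : Fin n), s6.arr 3 p = v + 1 →
      (s6.arr 8 p ≠ 0 ↔ G.IsStart (v, s6.arr 0 p)) := by
    intro p v hp
    obtain ⟨hpL, v', hv, hact⟩ := hP.vertex p v hp
    obtain rfl : v' = v := Fin.ext hv
    rw [A p (by omega)]
    have : (if s6.arr 3 p ≠ 0 ∧ ¬ ∃ p' < K, s6.arr 3 p' = s6.arr 3 p ∧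
        s6.arr 0 p' + 1 = s6.arr 0 p then 1 else 0) ≠ 0 ↔ s6.arr 3 p ≠ 0 ∧ ¬ ∃ p' < K,
        s6.arr 3 p' = s6.arr 3 p ∧ s6.arr 0 p' + 1 = s6.arr 0 p := by
      split_ifs with hc
      · exact ⟨fun _ => hc, fun _ => one_ne_zero⟩
      · exact ⟨fun h => absurd rfl h, fun h => absurd h hc⟩
    rw [this]
    constructor
    · rintro ⟨-, h2⟩
      refine ⟨hact, fun t ht hta => h2 ?_⟩
      obtain ⟨p', hp', ht'⟩ := hP.exists_vertex _ t hta
      exact ⟨p', (hP.vertex p' _ hp').1.trans_le hL, hp'.trans hp.symm, by rw [ht']; exact ht⟩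
    · rintro ⟨-, h2⟩
      refine ⟨by omega, ?_⟩
      rintro ⟨p', -, h3, h4⟩
      obtain ⟨-, v'', hv'', hact'⟩ := hP.vertex p' _ (h3.trans hp)
      obtain rfl : v'' = v' := Fin.ext hv''
      exact h2 _ h4 hact'
  refine ⟨hP, hstart, ?_, ?_, ?_, D, ?_, ?_, G'⟩
  · intro p hp hp8 hp3
    rw [A p hp, if_neg (by simp [hp3])] at hp8
    exact hp8 rfl
  · intro q e hq p hp3 hp0
    have hqL := (hP.edge q e hq).1
    rw [B q (by omega)]
    refine sum_ite_eq_of_unique ((hP.vertex p _ hp3).1.trans_le hL) ?_ ?_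
    · rw [hq, Nat.add_sub_cancel, hP.tgt]
      exact ⟨hp3, hp0⟩
    · rintro j - ⟨h1, h2⟩
      rw [hq, Nat.add_sub_cancel, hP.tgt] at h1
      exact hP.vertex_inj _ _ _ h1 hp3 (h2.trans hp0.symm)
  · rintro q e hq p y hy hp3 hp0
    have hqL := (hP.edge q e hq).1
    obtain ⟨y1, y2, y3, y4⟩ := hy
    dsimp only at y2 y3 y4
    rw [C q (by omega)]
    have hsrc : s6.arr 0 (s6.arr 4 (s6.arr 5 q - 1)) + 1 = (G.src e : ℕ) + 1 := by
      rw [hq, Nat.add_sub_cancel, hP.src]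
    rw [y2] at hp3
    have hst : G.IsStart (G.src e, s6.arr 0 p) := by
      rw [hp0, ← y2]; exact y1
    refine sum_ite_eq_of_unique ((hP.vertex p _ hp3).1.trans_le hL) ⟨?_, ?_, ?_, ?_⟩ ?_
    · exact (hstart p _ hp3).2 hst
    · rw [hsrc, hp3]
    · rw [hp0]; exact y3
    · rintro ⟨p', -, h1, h2, h3, h4⟩
      have := y4 _ h4 ((hstart p' _ (h2.trans hp3)).1 h1)
      omega
    · rintro j hj ⟨h1, h2, h3, h4⟩
      rw [hsrc] at h2
      have h5 := y4 _ h3 ((hstart j _ h2).1 h1)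
      refine hP.vertex_inj _ _ _ h2 hp3 (le_antisymm (by omega) ?_)
      by_contra hlt
      refine h4 ⟨p, (hP.vertex p _ hp3).1.trans_le hL, (hstart p _ hp3).2 hst, hp3.trans h2.symm,
        by omega, by omega⟩
  · intro x hx y hy
    rw [F x hx y hy]
    split_ifs <;> omega
  · intro x hx y hy
    rw [F x hx y hy]
    split_ifs with hc
    · simpa using hc
    · simpa using hc

end Edmonds

/-! ### Growing the branchings -/

namespace Edmonds

open LoopLang
open Ram (State)

/-- Give the available arc in variable 35 to the branching in variable 34, unless this violates the
cut condition. -/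
def tryCmd : Cmd :=
  .seq (.store 11 (.var 35) (.var 34)) <|
  .seq (.store 12 (.entry 34 (.get 9 (.var 35))) (.const 1)) <|
  .seq checkCmd <| .cond (.var 30) .skip <|
    .seq (.store 11 (.var 35) (.const 0)) (.store 12 (.entry 34 (.get 9 (.var 35))) (.const 0))

/-- Try the arc in variable 35 if it leaves the vertices of the branching in variable 34. -/
def extendCmd : Cmd :=
  .cond (.conj (.eq (.get 11 (.var 35)) (.const 0)) <|
      .conj (.get 12 (.entry 34 (.get 10 (.var 35))))
        (.neg (.get 12 (.entry 34 (.get 9 (.var 35))))))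
    tryCmd .skip

/-- Try all branchings and all arcs. -/
def passCmd : Cmd := .loop 34 (.loop 35 extendCmd)

/-- Repeat the passes until all branchings span. -/
def growCmd : Cmd := .loop 32 (.loop 33 passCmd)

/-- The two states agree in all that matters for the construction. -/
structure SameCore (s t : State) : Prop where
  var_zero : t.var 0 = s.var 0
  var_two : t.var 2 = s.var 2
  heads : t.arr 9 = s.arr 9
  tails : t.arr 10 = s.arr 10
  owners : t.arr 11 = s.arr 11
  matrix : t.arr 12 = s.arr 12

theorem SameCore.refl (s : State) : SameCore s s := ⟨rfl, rfl, rfl, rfl, rfl, rfl⟩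

theorem SameCore.trans {s t u : State} (h : SameCore s t) (h' : SameCore t u) : SameCore s u :=
  ⟨h'.1.trans h.1, h'.2.trans h.2, h'.3.trans h.3, h'.4.trans h.4, h'.5.trans h.5, h'.6.trans h.6⟩

theorem SameCore.setVar (s : State) {x : ℕ} (c : ℕ) (h0 : 0 ≠ x) (h2 : 2 ≠ x) :
    SameCore s (s.setVar x c) :=
  ⟨by simp [h0], by simp [h2], rfl, rfl, rfl, rfl⟩

theorem SameCore.of_frame {c : Cmd} {s t : State} (h : Frame c s t)
    (hc : 0 ∉ c.vars ∧ 2 ∉ c.vars ∧ 9 ∉ c.arrs ∧ 10 ∉ c.arrs ∧ 11 ∉ c.arrs ∧ 12 ∉ c.arrs) :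
    SameCore s t :=
  ⟨h.1 0 hc.1, h.1 2 hc.2.1, h.2 9 hc.2.2.1, h.2 10 hc.2.2.2.1, h.2 11 hc.2.2.2.2.1,
    h.2 12 hc.2.2.2.2.2⟩

theorem SameCore.shape {s t : State} (h : SameCore s t) (hs : Shape s) : Shape t := by
  refine ⟨?_, ?_, ?_, ?_, ?_⟩ <;> simp only [h.1, h.2, h.3, h.4, h.5, h.6]
  exacts [hs.pos, hs.le, hs.eq_zero, hs.le_one, hs.avail]

theorem SameCore.good_iff {s t : State} (h : SameCore s t) : Good t ↔ Good s := by
  simp only [Good, h.1, h.2, h.3, h.4, h.5, h.6]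

/-- The state after the arc `q` has been given to the branching `c`. -/
def moved (s : State) (c q : ℕ) : State :=
  (s.setArr 11 q c).setArr 12 (s.var 0 * c + s.arr 9 q) 1

theorem moved_owners (s : State) (c q : ℕ) :
    (moved s c q).arr 11 = Function.update (s.arr 11) q c := by simp [moved]

theorem moved_matrix (s : State) (c q : ℕ) :
    (moved s c q).arr 12 = Function.update (s.arr 12) (s.var 0 * c + s.arr 9 q) 1 := by simp [moved]

theorem moved_heads (s : State) (c q : ℕ) : (moved s c q).arr 9 = s.arr 9 := by simp [moved]

theorem moved_tails (s : State) (c q : ℕ) : (moved s c q).arr 10 = s.arr 10 := by simp [moved]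

theorem moved_var (s : State) (c q : ℕ) : (moved s c q).var = s.var := rfl

theorem SameCore.moved {s t : State} (h : SameCore s t) (c q : ℕ) :
    SameCore (moved s c q) (moved t c q) := by
  refine ⟨h.1, h.2, ?_, ?_, ?_, ?_⟩
  · rw [moved_heads, moved_heads, h.3]
  · rw [moved_tails, moved_tails, h.4]
  · rw [moved_owners, moved_owners, h.5]
  · rw [moved_matrix, moved_matrix, h.6, h.3, h.1]

/-- The arc `q` is available and leaves the vertices of the branching `c`. -/
structure CanMove (s : State) (c q : ℕ) : Prop where
  colour_lt : c < s.var 0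
  arc_lt : q < s.var 0
  owner_eq : s.arr 11 q = 0
  tail_mem : s.arr 12 (s.var 0 * c + s.arr 10 q) ≠ 0
  head_notMem : s.arr 12 (s.var 0 * c + s.arr 9 q) = 0

theorem SameCore.canMove {s t : State} (h : SameCore s t) {c q : ℕ} (hc : CanMove t c q) :
    CanMove s c q := by
  obtain ⟨h1, h2, h3, h4, h5⟩ := hc
  simp only [h.1, h.3, h.4, h.5, h.6] at h1 h2 h3 h4 h5
  exact ⟨h1, h2, h3, h4, h5⟩

theorem CanMove.le_colour {s : State} {c q : ℕ} (h : CanMove s c q) (hs : Shape s) :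
    s.var 2 ≤ c := by
  by_contra hlt
  have := hs.avail q h.arc_lt h.owner_eq
  exact h.tail_mem (hs.eq_zero c h.colour_lt _ (this.2.1.trans hs.le) fun hc => hlt hc.1)

theorem CanMove.shape {s : State} {c q : ℕ} (h : CanMove s c q) (hs : Shape s) :
    Shape (moved s c q) := by
  have ha := hs.avail q h.arc_lt h.owner_eq
  have hc := h.le_colour hs
  have hpos := hs.pos
  refine ⟨hs.pos, hs.le, ?_, ?_, ?_⟩
  · intro x hx y hy hxy
    rw [moved_var] at hx hy hxy ⊢
    rw [moved_matrix, Function.update_of_ne, hs.eq_zero x hx y hy hxy]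
    intro he
    obtain ⟨rfl, rfl⟩ := entry_inj hy (ha.2.2.trans hs.le) he
    exact hxy ⟨hc, ha.2.2⟩
  · intro x hx y hy
    rw [moved_var] at hx hy ⊢
    rw [moved_matrix, Function.update_apply]
    split_ifs
    · exact le_rfl
    · exact hs.le_one x hx y hy
  · intro q' hq' ho
    rw [moved_var] at hq' ⊢
    rw [moved_tails, moved_heads]
    rw [moved_owners, Function.update_apply] at ho
    split_ifs at ho
    · omega
    · exact hs.avail q' hq' ho

theorem CanMove.good_iff {s : State} {c q : ℕ} (h : CanMove s c q) (hs : Shape s) :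
    Good (moved s c q) ↔ CutCond (range (s.var 2)) (Ico (s.var 2) (s.var 0))
      (Function.update (row (s.var 2) (s.var 0) (s.arr 12)) c
        (insert (s.arr 9 q) (row (s.var 2) (s.var 0) (s.arr 12) c)))
      (s.arr 10) (s.arr 9) ((free (s.var 2) (s.arr 11)).erase q) := by
  have ha := hs.avail q h.arc_lt h.owner_eq
  have hpos := hs.pos
  have hc := h.le_colour hs
  have h1 : row (s.var 2) (s.var 0) ((moved s c q).arr 12) =
      Function.update (row (s.var 2) (s.var 0) (s.arr 12)) c
        (insert (s.arr 9 q) (row (s.var 2) (s.var 0) (s.arr 12) c)) := by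
    funext c'
    ext p
    rw [Function.update_apply, row, mem_filter, mem_range, moved_matrix, Function.update_apply]
    have key : p < s.var 2 → (s.var 0 * c' + p = s.var 0 * c + s.arr 9 q ↔
        c' = c ∧ p = s.arr 9 q) := by
      intro hp
      refine ⟨fun he => entry_inj (hp.trans hs.le) (ha.2.2.trans hs.le) he, ?_⟩
      rintro ⟨rfl, rfl⟩
      rfl
    by_cases hcc : c' = c
    · subst hcc
      rw [if_pos rfl, mem_insert, row, mem_filter, mem_range]
      constructor
      · rintro ⟨hp, hne⟩
        by_cases hpq : p = s.arr 9 q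
        · exact .inl hpq
        · rw [if_neg (fun he => hpq ((key hp).1 he).2)] at hne
          exact .inr ⟨hp, hne⟩
      · rintro (rfl | ⟨hp, hne⟩)
        · exact ⟨ha.2.2, by simp⟩
        · refine ⟨hp, ?_⟩
          split_ifs
          · exact one_ne_zero
          · exact hne
    · rw [if_neg hcc, row, mem_filter, mem_range]
      refine and_congr_right fun hp => ?_
      rw [if_neg fun he => hcc ((key hp).1 he).1]
  have h2 : free (s.var 2) ((moved s c q).arr 11) = (free (s.var 2) (s.arr 11)).erase q := by
    ext q'
    rw [free, mem_filter, mem_erase, free, mem_filter, moved_owners, Function.update_apply]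
    by_cases hqq : q' = q
    · simp only [hqq, if_true, ne_eq, not_true_eq_false, false_and, iff_false, not_and]
      omega
    · simp [hqq]
  rw [Good, moved_heads, moved_tails, moved_var, h1, h2]

/-- The vertices `p` that the arcs of the branching `c` make reachable from its initial vertices,
which are given by the matrix `m₀`; `own₀` and `own` are the initial and the present owners. -/
inductive Reach (K : ℕ) (own₀ own tl hd m₀ : ℕ → ℕ) (c : ℕ) : ℕ → Prop
  | root {p : ℕ} : m₀ (K * c + p) ≠ 0 → Reach K own₀ own tl hd m₀ c p
  | arc {q : ℕ} : q < K → own₀ q = 0 → own q = c → Reach K own₀ own tl hd m₀ c (tl q) →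
      Reach K own₀ own tl hd m₀ c (hd q)

theorem Reach.mono {K : ℕ} {own₀ own own' tl hd m₀ : ℕ → ℕ} {c p : ℕ}
    (h : Reach K own₀ own tl hd m₀ c p) (ho : ∀ q, own q = c → own' q = c) :
    Reach K own₀ own' tl hd m₀ c p := by
  induction h with
  | root h => exact .root h
  | arc h1 h2 h3 _ ih => exact .arc h1 h2 (ho _ h3) ih

/-- The branchings of the state `t` have been grown from those of the state `s`. -/
structure Grown (s t : State) : Prop where
  var_zero : t.var 0 = s.var 0
  var_two : t.var 2 = s.var 2
  heads : t.arr 9 = s.arr 9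
  tails : t.arr 10 = s.arr 10
  keep : ∀ q, s.arr 11 q ≠ 0 → t.arr 11 q = s.arr 11 q
  owner : ∀ q, s.arr 11 q = 0 → t.arr 11 q ≠ 0 →
    s.arr 12 (s.var 0 * t.arr 11 q + s.arr 9 q) = 0 ∧
      t.arr 12 (s.var 0 * t.arr 11 q + s.arr 9 q) ≠ 0
  inj : ∀ q q', s.arr 11 q = 0 → s.arr 11 q' = 0 → t.arr 11 q ≠ 0 → t.arr 11 q = t.arr 11 q' →
    s.arr 9 q = s.arr 9 q' → q = q'
  subset : ∀ i, s.arr 12 i ≠ 0 → t.arr 12 i ≠ 0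
  reach : ∀ c, s.var 2 ≤ c → c < s.var 0 → ∀ p < s.var 2, t.arr 12 (s.var 0 * c + p) ≠ 0 →
    Reach (s.var 0) (s.arr 11) (t.arr 11) (s.arr 10) (s.arr 9) (s.arr 12) c p

theorem Grown.refl (s : State) : Grown s s :=
  ⟨rfl, rfl, rfl, rfl, fun _ _ => rfl, fun _ h h' => absurd h h', fun _ _ h _ h' => absurd h h',
    fun _ => id, fun _ _ _ _ _ h => .root h⟩

theorem Grown.congr {s t u : State} (h : Grown s t) (hc : SameCore t u) : Grown s u := by
  refine ⟨hc.1.trans h.var_zero, hc.2.trans h.var_two, hc.3.trans h.heads, hc.4.trans h.tails,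
    ?_, ?_, ?_, ?_, ?_⟩ <;> simp only [hc.5, hc.6]
  exacts [h.keep, h.owner, h.inj, h.subset, h.reach]

theorem Grown.moved {s t : State} (h : Grown s t) (ht : Shape t) {c q : ℕ} (hc : CanMove t c q) :
    Grown s (moved t c q) := by
  have ha := ht.avail q hc.arc_lt hc.owner_eq
  have hcL := hc.le_colour ht
  have hpos := ht.pos
  have hK := h.var_zero
  have hL := h.var_two
  have hH := h.heads
  have hT := h.tails
  obtain ⟨h1, h2, h3, h4, h5⟩ := hc
  have hle := ht.le
  rw [hK, hL] at hle
  rw [hK] at h1 h2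
  rw [hK, hT] at h4
  rw [hK, hH] at h5
  rw [hL, hT, hH] at ha
  rw [hL] at hcL hpos
  have hq0 : s.arr 11 q = 0 := by
    by_contra hne
    exact hne ((h.keep q hne).symm.trans h3)
  have hown : ∀ q', (Edmonds.moved t c q).arr 11 q' = if q' = q then c else t.arr 11 q' := by
    intro q'; rw [moved_owners, Function.update_apply]
  have hmat : ∀ i, (Edmonds.moved t c q).arr 12 i =
      if i = s.var 0 * c + s.arr 9 q then 1 else t.arr 12 i := by
    intro i; rw [moved_matrix, Function.update_apply, hK, hH]
  refine ⟨hK, hL, (moved_heads t c q).trans hH, (moved_tails t c q).trans hT, ?_, ?_, ?_, ?_, ?_⟩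
  · intro q' hq'
    rw [hown, if_neg, h.keep q' hq']
    rintro rfl
    exact hq' hq0
  · intro q' hq' hne
    rw [hown] at hne ⊢
    by_cases hqq : q' = q
    · subst hqq
      rw [if_pos rfl, hmat, if_pos rfl]
      refine ⟨?_, one_ne_zero⟩
      by_contra hne'
      exact h.subset _ hne' h5
    · rw [if_neg hqq] at hne ⊢
      rw [hmat]
      refine ⟨(h.owner q' hq' hne).1, ?_⟩
      split_ifs
      · exact one_ne_zero
      · exact (h.owner q' hq' hne).2
  · have aux : ∀ q', s.arr 11 q' = 0 → t.arr 11 q' = c → s.arr 9 q' ≠ s.arr 9 q := by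
      intro q' hq' ho he
      have := (h.owner q' hq' (by omega)).2
      rw [ho, he] at this
      exact this h5
    intro q₁ q₂ z1 z2 hne ho he
    rw [hown] at hne
    rw [hown, hown] at ho
    by_cases e1 : q₁ = q <;> by_cases e2 : q₂ = q
    · rw [e1, e2]
    · rw [if_pos e1, if_neg e2] at ho
      exact absurd (he.symm.trans (by rw [e1])) (aux q₂ z2 ho.symm)
    · rw [if_neg e1, if_pos e2] at ho
      exact absurd (he.trans (by rw [e2])) (aux q₁ z1 ho)
    · rw [if_neg e1] at hne
      rw [if_neg e1, if_neg e2] at ho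
      exact h.inj q₁ q₂ z1 z2 hne ho he
  · intro i hi
    rw [hmat]
    split_ifs
    · exact one_ne_zero
    · exact h.subset i hi
  · have hmono : ∀ c' p, s.var 2 ≤ c' →
        Reach (s.var 0) (s.arr 11) (t.arr 11) (s.arr 10) (s.arr 9) (s.arr 12) c' p →
        Reach (s.var 0) (s.arr 11) ((Edmonds.moved t c q).arr 11) (s.arr 10) (s.arr 9)
          (s.arr 12) c' p := by
      intro c' p hc' hr
      refine hr.mono fun q' hq' => ?_
      rw [hown, if_neg, hq']
      rintro rfl
      omega
    intro c' hc1 hc2 p hp hne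
    rw [hmat] at hne
    by_cases he : s.var 0 * c' + p = s.var 0 * c + s.arr 9 q
    · obtain ⟨rfl, rfl⟩ := entry_inj (hp.trans hle) (ha.2.2.trans hle) he
      refine .arc h2 hq0 (by rw [hown, if_pos rfl]) (hmono _ _ hc1 ?_)
      exact h.reach c' hc1 hc2 _ ha.2.1 h4
    · rw [if_neg he] at hne
      exact hmono _ _ hc1 (h.reach c' hc1 hc2 p hp hne)

/-- The total number of vertices of the branchings. -/
def size (s : State) : ℕ :=
  #{z ∈ Ico (s.var 2) (s.var 0) ×ˢ range (s.var 2) | s.arr 12 (s.var 0 * z.1 + z.2) ≠ 0}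

theorem SameCore.size_eq {s t : State} (h : SameCore s t) : size t = size s := by
  simp only [size, h.1, h.2, h.6]

theorem CanMove.size_lt {s : State} {c q : ℕ} (h : CanMove s c q) (hs : Shape s) :
    size s < size (moved s c q) := by
  have ha := hs.avail q h.arc_lt h.owner_eq
  refine card_lt_card (Finset.ssubset_iff_subset_ne.2 ⟨fun z hz => ?_, fun he => ?_⟩)
  · rw [mem_filter] at hz ⊢
    refine ⟨hz.1, ?_⟩
    rw [moved_matrix, Function.update_apply]
    split_ifs
    · exact one_ne_zero
    · exact hz.2
  · have : (c, s.arr 9 q) ∈ ({z ∈ Ico (s.var 2) (s.var 0) ×ˢ range (s.var 2) |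
        s.arr 12 (s.var 0 * z.1 + z.2) ≠ 0} : Finset (ℕ × ℕ)) := by
      rw [he, mem_filter, mem_product, mem_Ico, mem_range, moved_matrix, moved_var]
      exact ⟨⟨⟨h.le_colour hs, h.colour_lt⟩, ha.2.2⟩, by simp⟩
    exact (mem_filter.1 this).2 h.head_notMem

/-- All branchings span. -/
def Full (s : State) : Prop :=
  ∀ c, s.var 2 ≤ c → c < s.var 0 → ∀ p < s.var 2, s.arr 12 (s.var 0 * c + p) ≠ 0

/-- While a branching does not span, some arc can be given to it. -/
theorem Good.exists_move {s : State} (h : Good s) (hs : Shape s) (hf : ¬ Full s) :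
    ∃ c q, CanMove s c q ∧ Good (moved s c q) := by
  rw [Full] at hf
  push Not at hf
  obtain ⟨c, hc1, hc2, p, hp, h0⟩ := hf
  have hle := hs.le
  obtain ⟨q, hq, h1, -, h2, h3⟩ := CutCond.exists_arc (i := c) h (fun q hq => by
      rw [free, mem_filter, mem_range] at hq
      exact mem_range.2 (hs.avail q (hq.1.trans hle) hq.2).2.1)
    (mem_Ico.2 ⟨hc1, hc2⟩) (fun hsub => by
      have := hsub (mem_range.2 hp)
      rw [row, mem_filter] at this
      exact this.2 h0)
  rw [free, mem_filter, mem_range] at hq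
  rw [row, mem_filter] at h1 h2
  have ha := hs.avail q (hq.1.trans hle) hq.2
  have hm : CanMove s c q := by
    refine ⟨hc2, hq.1.trans hle, hq.2, h1.2, ?_⟩
    by_contra hne
    exact h2 ⟨mem_range.2 ha.2.2, hne⟩
  exact ⟨c, q, hm, (hm.good_iff hs).2 h3⟩

/-- The invariant of the construction. -/
def Inv (s t : State) : Prop := Shape t ∧ Good t ∧ Grown s t

theorem Inv.congr {s t u : State} (h : Inv s t) (hc : SameCore t u) : Inv s u :=
  ⟨hc.shape h.1, hc.good_iff.2 h.2.1, h.2.2.congr hc⟩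

theorem run_extendCmd {t : State} (ht : Shape t) (hc : t.var 34 < t.var 0)
    (hq : t.var 35 < t.var 0) :
    (SameCore t (extendCmd.run t) ∧
      ¬ (CanMove t (t.var 34) (t.var 35) ∧ Good (moved t (t.var 34) (t.var 35)))) ∨
    (SameCore (moved t (t.var 34) (t.var 35)) (extendCmd.run t) ∧
      CanMove t (t.var 34) (t.var 35) ∧ Good (moved t (t.var 34) (t.var 35))) := by
  obtain ⟨c, hc'⟩ : ∃ c, t.var 34 = c := ⟨_, rfl⟩
  obtain ⟨q, hq'⟩ : ∃ q, t.var 35 = q := ⟨_, rfl⟩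
  rw [extendCmd, run_cond]
  simp only [Expr.holds_conj, Expr.holds_eq, Expr.holds_get, Expr.holds_neg, Expr.eval_get,
    Expr.eval_var, Expr.eval_const, Expr.eval_entry (x := 34) (by decide), hc', hq', ne_eq, not_not]
  rw [hc'] at hc
  rw [hq'] at hq
  split_ifs with h
  swap
  · rw [run_skip]
    exact .inl ⟨.refl t, fun hm => h ⟨hm.1.owner_eq, hm.1.tail_mem, hm.1.head_notMem⟩⟩
  have hm : CanMove t c q := ⟨hc, hq, h.1, h.2.1, h.2.2⟩
  rw [tryCmd, run_seq, run_seq, run_seq]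
  have e1 : (Cmd.store 12 (.entry 34 (.get 9 (.var 35))) (.const 1)).run
      ((Cmd.store 11 (.var 35) (.var 34)).run t) = moved t c q := by
    simp [moved, Expr.eval_entry, hc', hq']
  rw [e1]
  have hchk := run_checkCmd (hm.shape ht)
  have hf := frame_run checkCmd (moved t c q)
  have hsc : SameCore (moved t c q) (checkCmd.run (moved t c q)) := .of_frame hf (by decide)
  set u := checkCmd.run (moved t c q)
  rw [run_cond]
  split_ifs with hg
  · rw [run_skip]
    exact .inr ⟨hsc, hm, hchk.1 hg⟩
  · have u34 : u.var 34 = c := (hf.1 34 (by decide)).trans hc'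
    have u35 : u.var 35 = q := (hf.1 35 (by decide)).trans hq'
    have u0 : u.var 0 = t.var 0 := hsc.1
    have u9 : u.arr 9 = t.arr 9 := hsc.3.trans (moved_heads t c q)
    refine .inl ⟨⟨hsc.1, hsc.2, ?_, ?_, ?_, ?_⟩, fun h => hg (hchk.2 h.2)⟩
    · simp [u9]
    · simpa using hsc.4.trans (moved_tails t c q)
    · have : u.arr 11 = Function.update (t.arr 11) q c := hsc.5.trans (moved_owners t c q)
      simp [u35, this, h.1]
    · have : u.arr 12 = Function.update (t.arr 12) (t.var 0 * c + t.arr 9 q) 1 :=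
        hsc.6.trans (moved_matrix t c q)
      simp [u35, u34, u0, u9, this, Expr.eval_entry, h.2.2]

/-- The state `t` arises from `u` during a pass in which `c` and `q` with `P c q` have been
tried. -/
def DuringPass (s u t : State) (P : ℕ → ℕ → Prop) : Prop :=
  Inv s t ∧ (size u < size t ∨
    SameCore u t ∧ ∀ c q, P c q → ¬ (CanMove u c q ∧ Good (moved u c q)))

theorem DuringPass.congr {s u t t' : State} {P Q : ℕ → ℕ → Prop} (h : DuringPass s u t P)
    (hc : SameCore t t') (hPQ : ∀ c q, Q c q → P c q) : DuringPass s u t' Q :=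
  ⟨h.1.congr hc, h.2.imp (fun hlt => by rwa [hc.size_eq])
    fun hs => ⟨hs.1.trans hc, fun c q hQ => hs.2 c q (hPQ c q hQ)⟩⟩

theorem DuringPass.step {s u t : State} {P Q : ℕ → ℕ → Prop} (h : DuringPass s u t P)
    (hc : t.var 34 < t.var 0) (hq : t.var 35 < t.var 0)
    (hPQ : ∀ c q, Q c q → P c q ∨ c = t.var 34 ∧ q = t.var 35) :
    DuringPass s u (extendCmd.run t) Q := by
  rcases run_extendCmd h.1.1 hc hq with ⟨h1, h2⟩ | ⟨h1, h2, h3⟩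
  · refine ⟨h.1.congr h1, h.2.imp (fun hlt => by rwa [h1.size_eq]) fun hs => ⟨hs.1.trans h1, ?_⟩⟩
    intro c q hQ hm
    rcases hPQ c q hQ with hP | ⟨rfl, rfl⟩
    · exact hs.2 c q hP hm
    · have hsym : SameCore t u := ⟨hs.1.1.symm, hs.1.2.symm, hs.1.3.symm, hs.1.4.symm,
        hs.1.5.symm, hs.1.6.symm⟩
      exact h2 ⟨hsym.canMove hm.1, (hs.1.moved _ _).good_iff.2 hm.2⟩
  · have hlt := h2.size_lt h.1.1
    refine ⟨Inv.congr ⟨h2.shape h.1.1, h3, h.1.2.2.moved h.1.1 h2⟩ h1, .inl ?_⟩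
    rw [h1.size_eq]
    rcases h.2 with hs | hs
    · omega
    · rw [← hs.1.size_eq]; exact hlt

theorem run_passCmd {s u : State} (h : Inv s u) :
    Inv s (passCmd.run u) ∧ (size u < size (passCmd.run u) ∨ Full (passCmd.run u)) := by
  have key := run_loop_inv (x := 34) (c := .loop 35 extendCmd) (s := u)
    (fun j t => DuringPass s u t fun c q => c < j ∧ q < u.var 0)
    ⟨h, .inr ⟨.refl u, by simp⟩⟩ (by
    intro j hj t ht ih
    have t0 : t.var 0 = u.var 0 := ht.1 0 (by decide)
    have hin := run_loop_inv (x := 35) (c := extendCmd) (s := t.setVar 34 j)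
      (fun l v => DuringPass s u v fun c q => c < j ∧ q < u.var 0 ∨ c = j ∧ q < l)
      (ih.congr (.setVar t j (by decide) (by decide)) (by simp)) (by
      intro l hl v hv ih'
      have v0 : v.var 0 = u.var 0 := (hv.1 0 (by decide)).trans (by simp [t0])
      have v34 : v.var 34 = j := (hv.1 34 (by decide)).trans (by simp)
      simp only [var_setVar, OfNat.zero_ne_ofNat, if_false, t0] at hl
      refine (ih'.congr (.setVar v l (by decide) (by decide)) fun _ _ => id).step ?_ ?_ ?_
      · simpa [v34, v0] using hj
      · simpa [v0] using hl
      · simp only [var_setVar, Nat.reduceEqDiff, if_false, if_true, v34]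
        rintro c q (hcq | ⟨rfl, hq⟩)
        · exact .inl (.inl hcq)
        · rcases Nat.lt_succ_iff_lt_or_eq.1 hq with hlt | rfl
          · exact .inl (.inr ⟨rfl, hlt⟩)
          · exact .inr ⟨rfl, rfl⟩)
    refine hin.congr (.refl _) ?_
    simp only [var_setVar, OfNat.zero_ne_ofNat, if_false, t0]
    rintro c q ⟨hc, hq⟩
    rcases Nat.lt_succ_iff_lt_or_eq.1 hc with hlt | rfl
    · exact .inl ⟨hlt, hq⟩
    · exact .inr ⟨rfl, hq⟩)
  refine ⟨key.1, key.2.imp id fun hs => ?_⟩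
  by_contra hf
  have hfu : ¬ Full u := by
    intro hfu
    apply hf
    simp only [Full, passCmd, hs.1.1, hs.1.2, hs.1.6]
    exact hfu
  obtain ⟨c, q, hm, hg⟩ := h.2.1.exists_move h.1 hfu
  exact hs.2 c q ⟨hm.colour_lt, hm.arc_lt⟩ ⟨hm, hg⟩

theorem size_le (s : State) : size s ≤ (s.var 0 - s.var 2) * s.var 2 := by
  refine (card_filter_le _ _).trans ?_
  rw [card_product, Nat.card_Ico, card_range]

theorem Full.le_size {s : State} (h : Full s) : (s.var 0 - s.var 2) * s.var 2 ≤ size s := by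
  rw [size, filter_true_of_mem]
  · rw [card_product, Nat.card_Ico, card_range]
  · rintro ⟨c, p⟩ hz
    simp only [mem_product, mem_Ico, mem_range] at hz
    exact h c hz.1.1 hz.1.2 p hz.2

/-- Every pass enlarges some branching until all of them span. -/
theorem run_growCmd {s : State} (hs : Shape s) (hg : Good s) :
    Inv s (growCmd.run s) ∧ Full (growCmd.run s) := by
  obtain ⟨K, hK⟩ : ∃ K, s.var 0 = K := ⟨_, rfl⟩
  have hstep : ∀ (n : ℕ) (t : State), Inv s t → (Full t ∨ n ≤ size t) →
      Inv s (passCmd.run t) ∧ (Full (passCmd.run t) ∨ n + 1 ≤ size (passCmd.run t)) := by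
    intro n t ht hn
    obtain ⟨h1, h2⟩ := run_passCmd ht
    refine ⟨h1, ?_⟩
    rcases h2 with h2 | h2
    · rcases hn with hn | hn
      · have h3 := hn.le_size
        have h4 := size_le (passCmd.run t)
        rw [h1.2.2.var_zero, h1.2.2.var_two, ← ht.2.2.var_zero, ← ht.2.2.var_two] at h4
        omega
      · exact .inr (by omega)
    · exact .inl h2
  have key := run_loop_inv (x := 32) (c := .loop 33 passCmd) (s := s)
    (fun j t => Inv s t ∧ (Full t ∨ j * K ≤ size t)) ⟨⟨hs, hg, .refl s⟩, .inr (by simp)⟩ (by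
    rintro j - t ht ⟨i1, i2⟩
    have t0 : t.var 0 = K := (ht.1 0 (by decide)).trans hK
    have hsc : SameCore t (t.setVar 32 j) := .setVar t j (by decide) (by decide)
    have hfull : ∀ {a b : State}, SameCore a b → Full a → Full b := by
      intro a b hab ha
      simp only [Full, hab.1, hab.2, hab.6]
      exact ha
    have hin := run_loop_inv (x := 33) (c := passCmd) (s := t.setVar 32 j)
      (fun l v => Inv s v ∧ (Full v ∨ j * K + l ≤ size v))
      ⟨i1.congr hsc, i2.imp (hfull hsc) fun h => by rw [hsc.size_eq]; exact h⟩ (by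
      rintro l - v - ⟨k1, k2⟩
      have hsc' : SameCore v (v.setVar 33 l) := .setVar v l (by decide) (by decide)
      exact hstep _ _ (k1.congr hsc') (k2.imp (hfull hsc') fun h => by rw [hsc'.size_eq]; exact h))
    rw [var_setVar, if_neg (by decide), t0] at hin
    rwa [Nat.succ_mul])
  refine ⟨key.1, key.2.resolve_right fun h => ?_⟩
  have h1 := size_le (growCmd.run s)
  have h2 := key.1.2.2.var_zero
  have h3 := key.1.2.2.var_two
  have h4 := hs.le
  have h5 := hs.pos
  rw [growCmd, h2, h3] at h1
  rw [hK] at h h1 h4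
  have h6 : (K - s.var 2) * s.var 2 < K * K :=
    Nat.mul_lt_mul_of_lt_of_le (by omega) (by omega) (by omega)
  omega

end Edmonds

/-! ### Solutions of the instance and of the contracted instance -/

namespace Edmonds

open LoopLang TemporalSubdigraph
open Ram (State)

section Solutions

variable {n m k : ℕ} {G : TemporalDigraph (Fin n) (Fin m)} {R : Fin k → Finset (Fin n × ℕ)}
  {L K bad : ℕ} {a : ℕ → ℕ → ℕ}

/-- The temporal vertex `x` is listed at the position `p` of the input. -/
def At (a : ℕ → ℕ → ℕ) (p : ℕ) (x : Fin n × ℕ) : Prop := a 3 p = x.1 + 1 ∧ a 0 p = x.2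

theorem Parsed.lt_of_at (h : Parsed G R L a) {p : ℕ} {x : Fin n × ℕ} (hp : At a p x) : p < L :=
  (h.vertex p x.1 hp.1).1

theorem Parsed.exists_at (h : Parsed G R L a) {x : Fin n × ℕ} (hx : x ∈ G.tverts) :
    ∃ p, At a p x :=
  h.exists_vertex x.1 x.2 hx

theorem Parsed.exists_at_of_ne_zero (h : Parsed G R L a) {p : ℕ} (hp : a 3 p ≠ 0) :
    ∃ x : Fin n × ℕ, At a p x := by
  obtain ⟨v', hv'⟩ := Nat.exists_eq_succ_of_ne_zero hp
  obtain ⟨-, v, rfl, -⟩ := h.vertex p v' hv'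
  exact ⟨(v, a 0 p), hv', rfl⟩

theorem Parsed.at_inj (h : Parsed G R L a) {p p' : ℕ} {x : Fin n × ℕ} (hp : At a p x)
    (hp' : At a p' x) : p = p' :=
  h.vertex_inj p p' x.1 hp.1 hp'.1 (hp.2.trans hp'.2.symm)

theorem At.unique {p : ℕ} {x y : Fin n × ℕ} (hx : At a p x) (hy : At a p y) : x = y := by
  refine Prod.ext (Fin.ext ?_) (hx.2.symm.trans hy.2)
  have := hx.1.symm.trans hy.1
  omega

theorem Contracted.start_iff_of_at (h : Contracted G R L K a bad) {p : ℕ} {x : Fin n × ℕ}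
    (hp : At a p x) : a 8 p ≠ 0 ↔ G.IsStart x := by
  rw [h.start_iff p x.1 hp.1, hp.2]

/-- The temporal edge `(e, t, t')` is listed at the position `q` of the input, and `y` is the start
of the interval of its tail. -/
structure Arc (G : TemporalDigraph (Fin n) (Fin m)) (a : ℕ → ℕ → ℕ) (q : ℕ) (e : Fin m) (t t' : ℕ)
    (y : Fin n × ℕ) : Prop where
  edge_eq : a 5 q = e + 1
  departure : a 0 q = t
  arrival : a 0 (q + 1) = t'
  mem : (t, t') ∈ G.app e
  startOf : G.StartOf (G.src e, t) y
  tail : At a (a 10 q) y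
  head : At a (a 9 q) (G.tgt e, t')

theorem Contracted.exists_arc (h : Contracted G R L K a bad) {q : ℕ} (hq : a 5 q ≠ 0) :
    ∃ e y, Arc G a q e (a 0 q) (a 0 (q + 1)) y := by
  obtain ⟨e', he'⟩ := Nat.exists_eq_succ_of_ne_zero hq
  obtain ⟨-, e, rfl, he⟩ := h.edge q e' he'
  obtain ⟨y, hy⟩ := G.exists_startOf (x := (G.src e, a 0 q)) (G.src_act e _ he)
  obtain ⟨p, hp⟩ := h.exists_at (x := y) hy.1.1
  obtain ⟨p', hp'⟩ := h.exists_at (x := (G.tgt e, a 0 (q + 1))) (G.tgt_act e _ he)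
  refine ⟨e, y, he', rfl, rfl, he, hy, ?_, ?_⟩
  · rwa [h.tail q e he' p y hy hp.1 hp.2]
  · rwa [h.head q e he' p' hp'.1 hp'.2]

theorem Contracted.exists_arc_of_mem (h : Contracted G R L K a bad) {e : Fin m} {t t' : ℕ}
    (he : (t, t') ∈ G.app e) : ∃ q y, q < L ∧ Arc G a q e t t' y := by
  obtain ⟨q, h1, rfl, rfl⟩ := h.exists_edge e _ he
  obtain ⟨e', y, hq⟩ := h.exists_arc (q := q) (by omega)
  have h2 := hq.edge_eq
  obtain rfl : e' = e := Fin.ext (by omega)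
  exact ⟨q, y, (h.edge q e' h1).1, hq⟩

theorem Arc.owner_eq_zero_iff {q : ℕ} {e : Fin m} {t t' : ℕ} {y : Fin n × ℕ}
    (hq : Arc G a q e t t' y) (h : Contracted G R L K a bad) (hqK : q < K) :
    a 11 q = 0 ↔ G.IsStart (G.tgt e, t') := by
  have h1 := hq.edge_eq
  have h2 := h.start_iff_of_at hq.head
  rw [h.owner q hqK, ← h2]
  split_ifs with h3
  · simp [h3.2]
  · constructor
    · omega
    · exact fun h4 => absurd ⟨by omega, h4⟩ h3

theorem Contracted.edge_ne_zero (h : Contracted G R L K a bad) {q : ℕ} (hqK : q < K)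
    (hq : a 11 q = 0) : a 5 q ≠ 0 := by
  rw [h.owner q hqK] at hq
  split_ifs at hq with h3
  · exact h3.1
  · omega

theorem Contracted.shape {s : State} (h : Contracted G R (s.var 2) (s.var 0) s.arr bad)
    (hL : s.var 2 < s.var 0) : Shape s := by
  refine ⟨h.pos, hL, fun x hx y hy hxy => ?_, h.le_one, fun q hq ho => ?_⟩
  · by_contra hne
    exact hxy ((h.matrix_iff x hx y hy).1 hne).1
  · obtain ⟨e, y, he⟩ := h.exists_arc (h.edge_ne_zero hq ho)
    exact ⟨(h.edge q e he.edge_eq).1, h.lt_of_at he.tail, h.lt_of_at he.head⟩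

theorem Contracted.isStart_of_mem (h : Contracted G R L K a 0) (hLK : L < K)
    (hR : ∀ i, (R i : Set (Fin n × ℕ)) ⊆ G.tverts) {i : Fin k} {x : Fin n × ℕ} (hx : x ∈ R i) :
    G.IsStart x := by
  obtain ⟨z, hz, h1, h2⟩ := h.exists_root i x hx
  obtain ⟨p, hp⟩ := h.exists_at (hR i hx)
  rw [← h.start_iff_of_at hp]
  intro h0
  refine h.bad_iff.2 ⟨z, (h.root z i hz).1.trans hLK, by omega, p, (h.lt_of_at hp).trans hLK, ?_,
    ?_, h0⟩ rfl
  · rw [hp.1, h1]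
  · rw [hp.2, h2]

/-- The test for roots that are not starts rejects no solvable instance. -/
theorem Contracted.bad_eq_zero (h : Contracted G R L K a bad)
    (hR : ∀ i, (R i : Set (Fin n × ℕ)) ⊆ G.tverts) {B : Fin k → TemporalSubdigraph G}
    (hB : IsDisjointBranchings G R B) : bad = 0 := by
  by_contra hbad
  obtain ⟨z, -, hz, p, -, h1, h2, h3⟩ := h.bad_iff.1 hbad
  obtain ⟨i', hi'⟩ := Nat.exists_eq_succ_of_ne_zero hz
  obtain ⟨-, i, rfl, x, hx, h4, h5⟩ := h.root z i' hi'
  have hp : At a p x := ⟨by rw [h1, h4], by rw [h2, h5]⟩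
  exact (h.start_iff_of_at hp).2 ((hB.1 i).isStart_of_mem (hR i) hx) h3

/-- The cut condition is necessary, since disjoint branchings enter a set of starts by different
temporal edges. -/
theorem Contracted.good {s : State} (h : Contracted G R (s.var 2) (s.var 0) s.arr bad)
    (hLK : s.var 2 < s.var 0) (hR : ∀ i, (R i : Set (Fin n × ℕ)) ⊆ G.tverts)
    {B : Fin k → TemporalSubdigraph G} (hB : IsDisjointBranchings G R B) : Good s := by
  intro X hX hne
  have key : ∀ c ∈ missing (Ico (s.var 2) (s.var 0)) (row (s.var 2) (s.var 0) (s.arr 12)) X,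
      ∃ q ∈ entering (s.arr 10) (s.arr 9) (free (s.var 2) (s.arr 11)) X, ∃ i : Fin k,
        c = s.var 2 + i ∧ ∃ e : Fin m, s.arr 5 q = e + 1 ∧
          (s.arr 0 q, s.arr 0 (q + 1)) ∈ (B i).app e := by
    intro c hc
    rw [missing, mem_filter, mem_Ico] at hc
    obtain ⟨⟨hc1, hc2⟩, hdis⟩ := hc
    have hzero : ∀ p ∈ X, s.var 2 + k > c ∧ s.arr 8 p ≠ 0 ∧ ¬ ∃ z < s.var 0,
        s.arr 7 z = c - s.var 2 + 1 ∧ s.arr 0 z + 1 = s.arr 3 p ∧ s.arr 0 (z + 1) = s.arr 0 p := by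
      intro p hp
      have hpL := mem_range.1 (hX hp)
      have h0 : s.arr 12 (s.var 0 * c + p) = 0 := by
        by_contra hne0
        exact Finset.disjoint_left.1 hdis (mem_filter.2 ⟨mem_range.2 hpL, hne0⟩) hp
      have h1 := mt (h.matrix_iff c hc2 p (hpL.trans hLK)).2 (not_not.2 h0)
      simp only [hc1, hpL, and_self, true_and, not_or, not_le] at h1
      exact h1
    obtain ⟨p₀, hp₀⟩ := hne
    obtain ⟨hck, hs₀, -⟩ := hzero p₀ hp₀
    obtain ⟨x₀, hx₀⟩ := h.exists_at_of_ne_zero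
      (h.start_vertex p₀ ((mem_range.1 (hX hp₀)).trans hLK) hs₀)
    obtain ⟨i, hi⟩ : ∃ i : Fin k, c = s.var 2 + i :=
      ⟨⟨c - s.var 2, by omega⟩, by simp only; omega⟩
    have hRX : ∀ x ∈ R i, x ∉ {x | ∃ p ∈ X, At s.arr p x} := by
      rintro x hx ⟨p, hpX, hp⟩
      obtain ⟨z, hz, h1, h2⟩ := h.exists_root i x hx
      refine (hzero p hpX).2.2 ⟨z, (h.root z i hz).1.trans hLK, ?_, ?_, ?_⟩
      · rw [hz, hi, Nat.add_sub_cancel_left]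
      · rw [h1, hp.1]
      · rw [h2, hp.2]
    obtain ⟨e, t, t', he, ⟨p, hpX, hp⟩, hout⟩ := (hB.1 i).exists_entering (hR i)
      hRX ⟨p₀, hp₀, hx₀⟩ ((h.start_iff_of_at hx₀).1 hs₀)
    obtain ⟨q, y, hqL, hq⟩ := h.exists_arc_of_mem ((B i).app_subset e he)
    refine ⟨q, ?_, i, hi, e, hq.edge_eq, ?_⟩
    · obtain rfl : p = s.arr 9 q := h.at_inj hp hq.head
      rw [entering, mem_filter, free, mem_filter, mem_range]
      refine ⟨⟨hqL, ?_⟩, hpX, fun hmem => ?_⟩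
      · rw [hq.owner_eq_zero_iff h (hqL.trans hLK), ← h.start_iff_of_at hp]
        exact (hzero _ hpX).2.1
      · exact hout y hq.startOf ⟨_, hmem, hq.tail⟩
    · rw [hq.departure, hq.arrival]
      exact he
  choose! f hf g hg ε hε hmem using key
  refine card_le_card_of_injOn f hf fun c hc c' hc' hcc => ?_
  have h1 := hmem c hc
  have h2 := hmem c' hc'
  have h3 := hε c hc
  have h4 := hε c' hc'
  rw [← hcc] at h2 h4
  rw [hg c hc, hg c' hc']
  by_contra hne
  have heq : ε c' hc' = ε c hc := Fin.ext (by omega)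
  rw [heq] at h2
  exact Finset.disjoint_left.1 (hB.2 (g c hc) (g c' hc') (fun hgg => hne (by rw [hgg])) _) h1 h2

/-- The temporal edges whose owner is the colour `c`, as a temporal subdigraph. -/
noncomputable def owned (G : TemporalDigraph (Fin n) (Fin m)) (a : ℕ → ℕ → ℕ) (own : ℕ → ℕ)
    (c : ℕ) : TemporalSubdigraph G :=
  ofEdges G fun e p => ∃ q, a 5 q = e + 1 ∧ a 0 q = p.1 ∧ a 0 (q + 1) = p.2 ∧ own q = c

/-- The colours are below `K`, and `K` marks the arcs that are not available. -/
theorem Contracted.owner_eq_zero_of_grown {s t : State}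
    (h : Contracted G R (s.var 2) (s.var 0) s.arr bad) (hg : Grown s t) {q : ℕ} (hq : q < s.var 0)
    (ho : t.arr 11 q < s.var 0) : s.arr 11 q = 0 := by
  by_contra hne
  rw [hg.keep q hne, h.owner q hq] at ho
  rw [h.owner q hq] at hne
  split_ifs at ho hne
  · exact hne rfl
  · omega

/-- The branchings that have been grown until they span are branchings of the instance. -/
theorem Contracted.isDisjointBranchings {s t : State}
    (h : Contracted G R (s.var 2) (s.var 0) s.arr 0) (hLK : s.var 2 < s.var 0)
    (hk : s.var 2 + k ≤ s.var 0) (hR : ∀ i, (R i : Set (Fin n × ℕ)) ⊆ G.tverts)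
    (hg : Grown s t) (hfull : Full t) :
    IsDisjointBranchings G R fun i => owned G s.arr (t.arr 11) (s.var 2 + i) := by
  have hpos := h.pos
  -- what is known about the arcs of a branching
  have harc : ∀ (i : Fin k) (e : Fin m) (p : ℕ × ℕ), (∃ q, s.arr 5 q = e + 1 ∧ s.arr 0 q = p.1 ∧
      s.arr 0 (q + 1) = p.2 ∧ t.arr 11 q = s.var 2 + i) → ∃ q y, q < s.var 0 ∧
      s.arr 11 q = 0 ∧ t.arr 11 q = s.var 2 + i ∧ Arc G s.arr q e p.1 p.2 y := by
    rintro i e p ⟨q, h1, h2, h3, h4⟩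
    have hq := (h.edge q e h1).1.trans hLK
    obtain ⟨e', y, he⟩ := h.exists_arc (q := q) (by omega)
    have h5 := he.edge_eq
    obtain rfl : e' = e := Fin.ext (by omega)
    rw [h2, h3] at he
    refine ⟨q, y, hq, h.owner_eq_zero_of_grown hg hq ?_, h4, he⟩
    have := i.2
    omega
  refine ⟨fun i => isTemporalSpanningBranching_ofEdges (fun x hx => h.isStart_of_mem hLK hR hx)
    ?_ ?_ ?_, ?_⟩
  · rintro e p - hF
    obtain ⟨q, y, hq, h0, ho, he⟩ := harc i e p hF
    have hst := (he.owner_eq_zero_iff h hq).1 h0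
    refine ⟨hst, fun hRi => ?_⟩
    obtain ⟨z, hz, h1, h2⟩ := h.exists_root i _ hRi
    have hlt := h.lt_of_at he.head
    have hi := i.2
    have hzero := (hg.owner q h0 (by omega)).1
    rw [ho] at hzero
    refine (h.matrix_iff _ (by omega) _ (hlt.trans hLK)).2 ⟨⟨by omega, hlt⟩, .inr (.inr
      ⟨z, (h.root z i hz).1.trans hLK, ?_, ?_, ?_⟩)⟩ hzero
    · rw [hz, Nat.add_sub_cancel_left]
    · rw [h1, he.head.1]
    · rw [h2, he.head.2]
  · rintro e p e' p' - hF - hF' heq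
    obtain ⟨q, y, hq, h0, ho, he⟩ := harc i e p hF
    obtain ⟨q', y', hq', h0', ho', he'⟩ := harc i e' p' hF'
    have hh := he.head
    rw [heq] at hh
    have := hg.inj q q' h0 h0' (by omega) (by omega) (h.at_inj hh he'.head)
    subst this
    have h1 := he.edge_eq
    have h2 := he'.edge_eq
    refine ⟨Fin.ext (by omega), Prod.ext ?_ ?_⟩
    · exact he.departure.symm.trans he'.departure
    · exact he.arrival.symm.trans he'.arrival
  · intro x hx
    have hi := i.2
    obtain ⟨p, hp⟩ := h.exists_at (x := x) hx.1
    have hr := hg.reach (s.var 2 + i) (by omega) (by omega) p (h.lt_of_at hp) (by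
      have := hfull (s.var 2 + i)
      rw [hg.var_zero, hg.var_two] at this
      exact this (by omega) (by omega) p (h.lt_of_at hp))
    clear * - hr hp hx h hLK hk hi
    induction hr generalizing x with
    | @root p hne =>
      have hpL := h.lt_of_at hp
      rcases ((h.matrix_iff _ (by omega) p (hpL.trans hLK)).1 hne).2 with
        h1 | h1 | ⟨z, hz, h1, h2, h3⟩
      · omega
      · exact absurd h1 ((h.start_iff_of_at hp).2 hx)
      · rw [Nat.add_sub_cancel_left] at h1
        obtain ⟨-, j, hj, y, hy, h4, h5⟩ := h.root z i h1
        obtain rfl : j = i := Fin.ext hj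
        obtain rfl : y = x := At.unique (p := p) ⟨by rw [← h2, h4], by rw [← h3, h5]⟩ hp
        exact ⟨y, [], hy, hx.1, rfl⟩
    | @arc q hq h0 ho _ ih =>
      obtain ⟨e, y, he⟩ := h.exists_arc (h.edge_ne_zero hq h0)
      obtain rfl : (G.tgt e, s.arr 0 (q + 1)) = x := he.head.unique hp
      obtain ⟨b, l, hb, hl⟩ := ih y he.startOf.1 he.tail
      obtain ⟨l', hl'⟩ := exists_isWalk_of_startOf (G.src_act e _ he.mem) he.startOf ⟨l, hl⟩
      exact ⟨b, l' ++ [.traverse e (s.arr 0 q) (s.arr 0 (q + 1))], hb,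
        isWalk_append_singleton.2 ⟨_, hl', show IsStep _ _ (.traverse _ _ _) _ from ⟨rfl,
          mem_app_ofEdges.2 ⟨he.mem, q, he.edge_eq, rfl, rfl, ho⟩, rfl⟩⟩⟩
  · intro i j hij e
    rw [Finset.disjoint_left]
    intro p hpi hpj
    obtain ⟨q, y, -, -, ho, he⟩ := harc i e p (mem_app_ofEdges.1 hpi).2
    obtain ⟨q', y', -, -, ho', he'⟩ := harc j e p (mem_app_ofEdges.1 hpj).2
    have := h.edge_inj q q' e he.edge_eq he'.edge_eq (he.departure.trans he'.departure.symm)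
      (he.arrival.trans he'.arrival.symm)
    subst this
    exact hij (Fin.ext (by omega))

end Solutions

end Edmonds

/-! ### The algorithm -/

namespace Edmonds

open LoopLang TemporalSubdigraph
open Ram (State)

/-- Append the value of `e` to the output. -/
def emit (e : Expr) : Cmd :=
  .seq (.store 1 (.var 1) e) (.assign 1 (.add (.var 1) (.const 1)))

theorem output_emit {e : Expr} {s : State} :
    ((emit e).run s).output = s.output ++ [e.eval s] := by
  simp only [emit, run_seq, run_store, run_assign, State.output, Expr.eval_add, Expr.eval_var,
    Expr.eval_const, var_setVar, if_true, List.range_succ, List.map_append, List.map_cons,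
    List.map_nil, arr_setVar]
  congr 1
  · refine List.map_congr_left fun i hi => ?_
    have : i ≠ s.var 1 := (List.mem_range.1 hi).ne
    simp [State.setArr, this]
  · simp [State.setArr]

/-- Output the temporal edge at the position in variable 37 if it belongs to the branching in
variable 36. -/
def emitEdgeCmd : Cmd :=
  .cond (.eq (.get 11 (.var 37)) (.add (.var 2) (.var 36)))
    (.seq (emit (.sub (.get 5 (.var 37)) (.const 1))) <|
      .seq (emit (.get 0 (.var 37))) (emit (.get 0 (.add (.var 37) (.const 1)))))
    .skip

/-- Output the branching in variable 36. -/
def emitBranchingCmd : Cmd :=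
  .seq (emit (.sum 37 (.cond (.eq (.get 11 (.var 37)) (.add (.var 2) (.var 36)))
    (.const 1) (.const 0)))) (.loop 37 emitEdgeCmd)

/-- Output all branchings. -/
def outputCmd : Cmd :=
  .seq (emit (.const 1)) (.loop 36 (.cond (.lt (.var 36) (.var 5)) emitBranchingCmd .skip))

/-- The positions below `K` whose owner is `c`. -/
def positions (K : ℕ) (own : ℕ → ℕ) (c : ℕ) : List ℕ := (List.range K).filter (own · = c)

theorem sum_range_eq_length_positions (K : ℕ) (own : ℕ → ℕ) (c : ℕ) :
    (∑ j ∈ range K, if own j = c then 1 else 0) = (positions K own c).length := by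
  induction K with
  | zero => rfl
  | succ K ih =>
    rw [sum_range_succ, ih, positions, positions, List.range_succ, List.filter_append,
      List.length_append]
    by_cases h : own K = c <;> simp [h]

theorem output_emitBranchingCmd (s : State) :
    (emitBranchingCmd.run s).output = s.output ++ encodeList
      (fun q => [s.arr 5 q - 1, s.arr 0 q, s.arr 0 (q + 1)])
      (positions (s.var 0) (s.arr 11) (s.var 2 + s.var 36)) := by
  obtain ⟨u, hu⟩ : ∃ u, (emit (.sum 37 (.cond (.eq (.get 11 (.var 37)) (.add (.var 2) (.var 36)))
    (.const 1) (.const 0)))).run s = u := ⟨_, rfl⟩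
  have hf : Frame _ s u := hu ▸ frame_run _ s
  have ho : u.output = s.output ++
      [(positions (s.var 0) (s.arr 11) (s.var 2 + s.var 36)).length] := by
    rw [← hu, output_emit, ← sum_range_eq_length_positions]
    simp
  have u0 : u.var 0 = s.var 0 := hf.1 0 (by decide)
  have u2 : u.var 2 = s.var 2 := hf.1 2 (by decide)
  have u36 : u.var 36 = s.var 36 := hf.1 36 (by decide)
  have a0 : u.arr 0 = s.arr 0 := hf.2 0 (by decide)
  have a5 : u.arr 5 = s.arr 5 := hf.2 5 (by decide)
  have a11 : u.arr 11 = s.arr 11 := hf.2 11 (by decide)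
  have key := run_loop_inv (x := 37) (c := emitEdgeCmd) (s := u)
    (fun j t => t.output = u.output ++ (positions j (s.arr 11) (s.var 2 + s.var 36)).flatMap
      fun q => [s.arr 5 q - 1, s.arr 0 q, s.arr 0 (q + 1)])
    (by simp [positions]) (by
    intro j hj t ht ih
    have t2 : t.var 2 = s.var 2 := (ht.1 2 (by decide)).trans u2
    have t36 : t.var 36 = s.var 36 := (ht.1 36 (by decide)).trans u36
    have b0 : t.arr 0 = s.arr 0 := (ht.2 0 (by decide)).trans a0
    have b5 : t.arr 5 = s.arr 5 := (ht.2 5 (by decide)).trans a5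
    have b11 : t.arr 11 = s.arr 11 := (ht.2 11 (by decide)).trans a11
    have hout : (t.setVar 37 j).output = t.output := by simp [State.output]
    rw [emitEdgeCmd, run_cond, positions, List.range_succ, List.filter_append, List.flatMap_append,
      ← List.append_assoc, ← positions, ← ih]
    by_cases h : s.arr 11 j = s.var 2 + s.var 36
    · rw [if_pos (by simp [b11, t2, t36, h]), run_seq, run_seq, output_emit, output_emit,
        output_emit, hout]
      simp [emit, b0, b5, h]
    · rw [if_neg (by simp [b11, t2, t36, h]), run_skip, hout]
      simp [h])
  rw [emitBranchingCmd, run_seq, hu, key, ho, u0, encodeList]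
  simp

theorem output_outputCmd (s : State) (hk : s.var 5 ≤ s.var 0) :
    (outputCmd.run s).output = s.output ++ 1 :: (List.range (s.var 5)).flatMap fun i => encodeList
      (fun q => [s.arr 5 q - 1, s.arr 0 q, s.arr 0 (q + 1)])
      (positions (s.var 0) (s.arr 11) (s.var 2 + i)) := by
  obtain ⟨u, hu⟩ : ∃ u, (emit (.const 1)).run s = u := ⟨_, rfl⟩
  have hf : Frame _ s u := hu ▸ frame_run _ s
  have ho : u.output = s.output ++ [1] := by rw [← hu, output_emit]; rfl
  have u0 : u.var 0 = s.var 0 := hf.1 0 (by decide)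
  have u5 : u.var 5 = s.var 5 := hf.1 5 (by decide)
  have u2 : u.var 2 = s.var 2 := hf.1 2 (by decide)
  have a0 : u.arr 0 = s.arr 0 := hf.2 0 (by decide)
  have a5 : u.arr 5 = s.arr 5 := hf.2 5 (by decide)
  have a11 : u.arr 11 = s.arr 11 := hf.2 11 (by decide)
  have key := run_loop_inv (x := 36)
    (c := .cond (.lt (.var 36) (.var 5)) emitBranchingCmd .skip) (s := u)
    (fun j t => t.output = u.output ++ (List.range (min j (s.var 5))).flatMap fun i => encodeList
      (fun q => [s.arr 5 q - 1, s.arr 0 q, s.arr 0 (q + 1)])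
      (positions (s.var 0) (s.arr 11) (s.var 2 + i)))
    (by simp) (by
    intro j hj t ht ih
    have t0 : t.var 0 = s.var 0 := (ht.1 0 (by decide)).trans u0
    have t2 : t.var 2 = s.var 2 := (ht.1 2 (by decide)).trans u2
    have t5 : t.var 5 = s.var 5 := (ht.1 5 (by decide)).trans u5
    have b0 : t.arr 0 = s.arr 0 := (ht.2 0 (by decide)).trans a0
    have b5 : t.arr 5 = s.arr 5 := (ht.2 5 (by decide)).trans a5
    have b11 : t.arr 11 = s.arr 11 := (ht.2 11 (by decide)).trans a11
    have hout : (t.setVar 36 j).output = t.output := by simp [State.output]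
    rw [run_cond]
    by_cases h : j < s.var 5
    · rw [if_pos (by simp [t5, h]), output_emitBranchingCmd, hout, ih, min_eq_left h.le,
        min_eq_left h, List.range_succ, List.flatMap_append, List.append_assoc]
      simp [t0, t2, b0, b5, b11]
    · rw [if_neg (by simp [t5, h]), run_skip, hout, ih, min_eq_right (by omega),
        min_eq_right (by omega)])
  rw [outputCmd, run_seq, hu, key, ho, u0, min_eq_right hk]
  simp

/-- Decide the cut condition and construct the branchings if it holds. -/
def solveCmd : Cmd :=
  .seq checkCmd <| .cond (.conj (.var 30) (.neg (.var 31))) (.seq growCmd outputCmd)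
    (emit (.const 0))

/-- The algorithm. -/
def program : Cmd := .seq parseCmd (.seq contractCmd solveCmd)

theorem SameCore.grown {s t u : State} (h : SameCore s t) (hg : Grown t u) : Grown s u := by
  refine ⟨?_, ?_, ?_, ?_, ?_, ?_, ?_, ?_, ?_⟩ <;>
    simp only [← h.1, ← h.2, ← h.3, ← h.4, ← h.5, ← h.6]
  exacts [hg.var_zero, hg.var_two, hg.heads, hg.tails, hg.keep, hg.owner, hg.inj, hg.subset,
    hg.reach]

section Correctness

variable {n m k : ℕ} {G : TemporalDigraph (Fin n) (Fin m)} {R : Fin k → Finset (Fin n × ℕ)}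

/-- The output describes the branchings that have been grown. -/
theorem encodesBranchings_owned {s t : State} {bad : ℕ}
    (h : Contracted G R (s.var 2) (s.var 0) s.arr bad) (hLK : s.var 2 < s.var 0)
    (hk : s.var 2 + k ≤ s.var 0) (hg : Grown s t) :
    EncodesBranchings (fun i : Fin k => owned G s.arr (t.arr 11) (s.var 2 + i))
      (1 :: (List.range k).flatMap fun i => encodeList
        (fun q => [s.arr 5 q - 1, s.arr 0 q, s.arr 0 (q + 1)])
        (positions (s.var 0) (t.arr 11) (s.var 2 + i))) := by
  have harc : ∀ (i : Fin k), ∀ q ∈ positions (s.var 0) (t.arr 11) (s.var 2 + i),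
      t.arr 11 q = s.var 2 + i ∧
        ∃ e y, Arc G s.arr q e (s.arr 0 q) (s.arr 0 (q + 1)) y := by
    intro i q hq
    rw [positions, List.mem_filter, List.mem_range, decide_eq_true_eq] at hq
    have := i.2
    exact ⟨hq.2, h.exists_arc (h.edge_ne_zero hq.1 (h.owner_eq_zero_of_grown hg hq.1 (by omega)))⟩
  have hlt : ∀ (i : Fin k), ∀ q ∈ positions (s.var 0) (t.arr 11) (s.var 2 + i),
      s.arr 5 q - 1 < m := by
    intro i q hq
    obtain ⟨-, e, y, he⟩ := harc i q hq
    rw [he.edge_eq, Nat.add_sub_cancel]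
    exact e.2
  refine ⟨fun i => (positions (s.var 0) (t.arr 11) (s.var 2 + i)).pmap
    (fun q hq => (⟨s.arr 5 q - 1, hlt i q hq⟩, s.arr 0 q, s.arr 0 (q + 1))) (fun _ hq => hq),
    fun i => ⟨?_, ?_⟩, ?_⟩
  · refine List.Nodup.pmap ?_ (List.nodup_range.filter _)
    intro q hq q' hq' heq
    obtain ⟨-, e, y, he⟩ := harc i q hq
    obtain ⟨-, e', y', he'⟩ := harc i q' hq'
    have h1 := he.edge_eq
    have h2 := he'.edge_eq
    simp only [Prod.mk.injEq, Fin.ext_iff] at heq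
    exact h.edge_inj q q' e h1 (by omega) heq.2.1 heq.2.2
  · intro e u u'
    refine List.mem_pmap.trans (Iff.trans ?_ mem_app_ofEdges.symm)
    constructor
    · rintro ⟨q, hq, heq⟩
      obtain ⟨ho, e', y, he⟩ := harc i q hq
      have h1 := he.edge_eq
      simp only [Prod.mk.injEq, Fin.ext_iff] at heq
      obtain ⟨h2, rfl, rfl⟩ := heq
      obtain rfl : e' = e := Fin.ext (by omega)
      exact ⟨he.mem, q, h1, rfl, rfl, ho⟩
    · rintro ⟨-, q, h1, h2, h3, h4⟩
      have hq := (h.edge q e h1).1.trans hLK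
      refine ⟨q, ?_, ?_⟩
      · rw [positions, List.mem_filter, List.mem_range, decide_eq_true_eq]
        exact ⟨hq, h4⟩
      · simp only [Prod.mk.injEq, Fin.ext_iff]
        exact ⟨by omega, h2, h3⟩
  · rw [← List.map_coe_finRange_eq_range, List.flatMap_map, List.singleton_append]
    congr 2
    funext i
    simp [encodeList, List.flatMap_def, List.map_pmap]

/-- The algorithm is correct if the bound `K` of the loops is twice the length of the input. -/
theorem run_program (hR : ∀ i, (R i : Set (Fin n × ℕ)) ⊆ G.tverts) {w : List ℕ}
    (henc : EncodesInstance G R w) {s : State} (h0 : s.var 0 = w.length + w.length)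
    (h1 : s.var 1 = 0) (h2 : s.var 2 = w.length)
    (hw : s.arr 0 = fun i => w.getD i 0) (hz : ∀ a, a ≠ 0 → ∀ i, s.arr a i = 0) :
    (∃ B : Fin k → TemporalSubdigraph G,
        IsDisjointBranchings G R B ∧ EncodesBranchings B (program.run s).output) ∨
      ((¬ ∃ B : Fin k → TemporalSubdigraph G, IsDisjointBranchings G R B) ∧
        (program.run s).output = [0]) := by
  obtain ⟨hk, hp⟩ := run_parseCmd henc (s := s) (by omega) hw hz
  have f1 := frame_run parseCmd s
  rw [program, run_seq, run_seq]
  set s1 := parseCmd.run s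
  have a0 : s1.var 0 = w.length + w.length := (f1.1 0 (by decide)).trans h0
  have a1 : s1.var 1 = 0 := (f1.1 1 (by decide)).trans h1
  have a2 : s1.var 2 = w.length := (f1.1 2 (by decide)).trans h2
  rw [← a2] at hp
  have hc := run_contractCmd hp (by omega) hk
  have f2 := frame_run contractCmd s1
  set s2 := contractCmd.run s1
  have b0 : s2.var 0 = w.length + w.length := (f2.1 0 (by decide)).trans a0
  have b1 : s2.var 1 = 0 := (f2.1 1 (by decide)).trans a1
  have b2 : s2.var 2 = s1.var 2 := f2.1 2 (by decide)
  have b5 : s2.var 5 = k := (f2.1 5 (by decide)).trans hk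
  rw [← b2, ← f2.1 0 (by decide)] at hc
  have hpos := hc.pos
  have hkL := hc.le
  have hLK : s2.var 2 < s2.var 0 := by omega
  have hkK : s2.var 2 + k ≤ s2.var 0 := by omega
  have hshape := hc.shape hLK
  have hcheck := run_checkCmd hshape
  have f3 := frame_run checkCmd s2
  rw [solveCmd, run_seq]
  set s3 := checkCmd.run s2
  have hsc : SameCore s2 s3 := .of_frame f3 (by decide)
  have c1 : s3.var 1 = 0 := (f3.1 1 (by decide)).trans b1
  have c5 : s3.var 5 = k := (f3.1 5 (by decide)).trans b5
  have c31 : s3.var 31 = s2.var 31 := f3.1 31 (by decide)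
  have d0 : s3.arr 0 = s2.arr 0 := f3.2 0 (by decide)
  have d5 : s3.arr 5 = s2.arr 5 := f3.2 5 (by decide)
  rw [run_cond]
  split_ifs with hb
  · rw [Expr.holds_conj, Expr.holds_neg, Expr.holds_var, Expr.holds_var, not_not, c31, hcheck] at hb
    rw [hb.2] at hc
    obtain ⟨⟨-, -, hg⟩, hfull⟩ := run_growCmd (hsc.shape hshape) (hsc.good_iff.2 hb.1)
    have f4 := frame_run growCmd s3
    rw [run_seq]
    set s4 := growCmd.run s3
    have hg2 := hsc.grown hg
    refine .inl ⟨_, hc.isDisjointBranchings hLK hkK hR hg2 hfull, ?_⟩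
    have e1 : s4.var 1 = 0 := (f4.1 1 (by decide)).trans c1
    have e5 : s4.var 5 = k := (f4.1 5 (by decide)).trans c5
    have g0 : s4.arr 0 = s2.arr 0 := (f4.2 0 (by decide)).trans d0
    have g5 : s4.arr 5 = s2.arr 5 := (f4.2 5 (by decide)).trans d5
    rw [output_outputCmd s4 (by rw [e5, hg2.var_zero]; omega), e5, g0, g5, hg2.var_zero,
      hg2.var_two, State.output, e1]
    exact encodesBranchings_owned hc hLK hkK hg2
  · refine .inr ⟨?_, ?_⟩
    · rintro ⟨B, hB⟩
      refine hb ?_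
      rw [Expr.holds_conj, Expr.holds_neg, Expr.holds_var, Expr.holds_var, not_not, c31, hcheck]
      exact ⟨hc.good hLK hR hB, hc.bad_eq_zero hR hB⟩
    · rw [output_emit, State.output, c1]
      rfl

theorem eval_mono (p : Polynomial ℕ) {x y : ℕ} (h : x ≤ y) : p.eval x ≤ p.eval y := by
  rw [Polynomial.eval_eq_sum, Polynomial.eval_eq_sum]
  exact sum_le_sum fun i _ => Nat.mul_le_mul_left _ (Nat.pow_le_pow_left h i)

/-- The compiled program, whose scratch variables start at 50, preceded by two additions that set
the variable 2 to the length `L` of the input and the variable 0 to `2 L`, solves the problem in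
polynomial time. -/
theorem exists_exec (hR : ∀ i, (R i : Set (Fin n × ℕ)) ⊆ G.tverts) {w : List ℕ}
    (henc : EncodesInstance G R w) :
    Runs (.seq (.add 2 0 2) (.seq (.add 0 0 0) (program.comp 50))) (State.start w)
      ((program.cost.comp (2 * Polynomial.X) + 2).eval (Ram.bitSize w)) fun s =>
      (∃ B : Fin k → TemporalSubdigraph G,
          IsDisjointBranchings G R B ∧ EncodesBranchings B s.output) ∨
        ((¬ ∃ B : Fin k → TemporalSubdigraph G, IsDisjointBranchings G R B) ∧ s.output = [0]) := by
  have hlen : w.length ≤ Ram.bitSize w := by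
    rw [Ram.bitSize]
    simpa only [List.length_map] using
      List.length_le_sum_of_one_le (w.map fun a => Nat.size a + 1) (by simp)
  obtain ⟨s, hs⟩ : ∃ s, ((State.start w).setVar 2 (w.length + 0)).setVar 0
    (w.length + w.length) = s := ⟨_, rfl⟩
  have hrun := run_program hR henc (s := s) (by simp [← hs]) (by simp [← hs, State.start])
    (by simp [← hs]) (by simp [← hs, State.start])
    (by intro a ha i; simp [← hs, State.start, ha])
  refine (Runs.seq (runs_add (Q := fun t => t = (State.start w).setVar 2 (w.length + 0)) (by
    simp [State.start])) ?_).mono (T := 1 + (1 + program.cost.eval (s.var 0))) ?_ (fun _ => id)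
  · rintro _ rfl
    refine Runs.seq (runs_add (Q := fun t => t = s) (by simp [← hs, State.start])) ?_
    rintro _ ht
    rw [ht]
    refine (program.comp_runs (by decide) 50 s s (by decide) le_rfl ⟨fun _ _ => rfl, rfl⟩).mono
      le_rfl ?_
    rintro t ⟨⟨h1, h2⟩, -, -⟩
    have : t.output = (program.run s).output := by
      rw [State.output, State.output, h1 1 (by decide), h2]
    rw [this]
    exact hrun
  · have hs0 : s.var 0 = 2 * w.length := by simp [← hs, two_mul]
    have : program.cost.eval (2 * w.length) ≤ program.cost.eval (2 * Ram.bitSize w) :=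
      eval_mono _ (by omega)
    simp [hs0]
    omega

end Correctness

end Edmonds

/-- There are one program `P` and one polynomial `p` such that `P`, on every description `w` of a
temporal digraph `G` and of sets `R 0, …, R (k-1)` of temporal vertices of `G`, halts within
`p (bitSize w)` steps and finds temporal-edge-disjoint temporal-spanning branchings of `G` with
these roots if there are any; otherwise its output is the word `0`. -/
theorem theorem1 :
    ∃ (P : Ram) (p : Polynomial ℕ),
      ∀ (n m k : ℕ) (G : TemporalDigraph (Fin n) (Fin m)) (R : Fin k → Finset (Fin n × ℕ)),
        (∀ i, (R i : Set (Fin n × ℕ)) ⊆ G.tverts) →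
        ∀ w : List ℕ, EncodesInstance G R w →
          ∃ (N : ℕ) (s : Ram.State),
            Ram.Exec P (Ram.State.start w) N s ∧ N ≤ p.eval (Ram.bitSize w) ∧
            ((∃ B : Fin k → TemporalSubdigraph G,
                IsDisjointBranchings G R B ∧ EncodesBranchings B s.output) ∨
              ((¬ ∃ B : Fin k → TemporalSubdigraph G, IsDisjointBranchings G R B) ∧
                s.output = [0])) := by
  refine ⟨.seq (.add 2 0 2) (.seq (.add 0 0 0) (Edmonds.program.comp 50)),
    Edmonds.program.cost.comp (2 * Polynomial.X) + 2, fun n m k G R hR w henc => ?_⟩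
  exact Edmonds.exists_exec hR henc
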